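/- For nonempty open intervals $I,J\subseteq\mathbb R$, let $\mathfrak g=\mathfrak g(I,J)$ be the Lie algebra of vector fields in the variables $(t,x,y,u,v)$, $t\in I$, $y\in J$, $x,u,v\in\mathbb R$, spanned by $$D(f)=f\partial_t+\tfrac12f_tx\partial_x-\left(\tfrac12f_tu+\tfrac14f_{tt}x\right)\partial_u,\quad S(\alpha)=\alpha\partial_y-\alpha_yv\partial_v,\quad P(g)=g\partial_x-\tfrac12g_t\partial_u,\quad Z(\beta)=\beta\partial_v,$$ where $f=f(t)$, $g=g(t)$ run through the smooth functions on $I$ and $\alpha=\alpha(y)$, $\beta=\beta(y)$ through the smooth functions on $J$ (the maximal Lie invariance algebra of the Boiti--Leon--Pempinelli system). Let $G$ be the pseudogroup of the transformations (the complete point-symmetry pseudogroup of this system) $$\tilde t=T(t),\quad \tilde x=\varepsilon T_t^{1/2}x+X^0(t),\quad \tilde y=Y(y),\quad \tilde u=\frac{\varepsilon}{T_t^{1/2}}u-\frac{\varepsilon T_{tt}}{4T_t^{3/2}}x-\frac{X^0_t}{2T_t},\quad \tilde v=\frac1{Y_y}v+V^0(y),$$ where $T,X^0$ (resp. $Y,V^0$)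 are smooth functions on an open interval of $t$ (resp. $y$), $T_t>0$, $Y_y\ne0$ everywhere, and $\varepsilon=\pm1$. Subalgebras $\mathfrak s\subset\mathfrak g(I,J)$ and $\mathfrak s'\subset\mathfrak g(I',J')$ are $G$-equivalent if $\Phi_*\mathfrak s=\mathfrak s'$ for some $\Phi\in G$ defined for $t\in I$, $y\in J$ with $T(I)=I'$, $Y(J)=J'$. As usual in this local setting, the subalgebras considered are those that restrict faithfully: no nonzero element vanishes identically over nonempty open subintervals $I_0\subseteq I$, $J_0\subseteq J$ (automatic for real-analytic parameter functions). Consider, for $\delta,\delta'\in\{0,1\}$, the non-Abelian algebras $$\begin{gathered} \mathfrak s_{2.1}=\langle D(1)+S(1),D(t)+S(y)\rangle,\quad \mathfrak s_{2.2}^\delta=\langle D(1)+Z(\delta),D(t)-S(y)\rangle,\quad \mathfrak s_{2.3}^\delta=\langle D(1),D(t)+Z(\delta)\rangle,\\ \mathfrak s_{2.4}^\delta=\langle S(1)-P(\delta),D(2t)+S(y)\rangle,\quad \mathfrak s_{2.5}^\delta=\langle S(1),S(y)+P(\delta)\rangle,\\ \mathfrak s_{2.6}^{\delta\delta'}=\langle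 P(\delta)+Z(\delta'),D(2t)-S(y)\rangle_{(\delta,\delta')\neq(0,0)},\\ \mathfrak s_{2.7}^\delta=\langle P(1),D(2t)+Z(\delta)\rangle,\quad \mathfrak s_{2.8}^\delta=\langle Z(1),-S(y)+P(\delta)\rangle \end{gathered}$$ and the Abelian algebras $$\begin{gathered} \mathfrak s_{2.9}^{\delta\delta'}=\langle D(1)+Z(\delta),S(1)-P(\delta')\rangle,\quad \mathfrak s_{2.10}^{\delta\delta'}=\langle D(1)+S(1),P(\delta)+Z(\delta')\rangle_{(\delta,\delta')\neq(0,0)},\\ \mathfrak s_{2.11}^{\delta\beta}=\langle D(1)+Z(\beta),P(\delta)+Z(1)\rangle,\quad \mathfrak s_{2.12}^\delta=\langle D(1)+Z(\delta),P(1)\rangle,\\ \mathfrak s_{2.13}^{g\delta}=\langle S(1)+P(g),P(1)+Z(\delta)\rangle,\quad \mathfrak s_{2.14}^\delta=\langle S(1)-P(\delta),Z(1)\rangle,\quad \mathfrak s_{2.15}=\langle P(1),Z(1)\rangle,\\ \mathfrak s_{2.16}^{g\delta}=\langle P(1)+Z(\delta),P(g)\rangle_{g\ne\mathrm{const}},\quad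 \mathfrak s_{2.17}^{\delta\beta}=\langle P(\delta)+Z(1),Z(\beta)\rangle_{\beta\ne\mathrm{const}},\\ \mathfrak s_{2.18}^{g\beta}=\langle P(1)+Z(1),P(g)+Z(\beta)\rangle_{g,\beta\ne\mathrm{const}}, \end{gathered}$$ where $g=g(t)$ and $\beta=\beta(y)$ are arbitrary smooth functions subject to the indicated constraints, and "$\ne\mathrm{const}$" means constant on no nonempty open subinterval. Then: 1. Over any nonempty open intervals, each listed algebra is a two-dimensional subalgebra of $\mathfrak g$ that restricts faithfully, and it is non-Abelian or Abelian as indicated. 2. The list is complete: for every two-dimensional subalgebra $\mathfrak s$ of $\mathfrak g(I,J)$ that restricts faithfully, there are nonempty open subintervals $I_0\subseteq I$, $J_0\subseteq J$ such that the restriction of $\mathfrak s$ to $t\in I_0$, $y\in J_0$ is $G$-equivalent to a listed algebra over some nonempty open intervals. 3. Listed algebras from different families, or from the same family with different values of $(\delta,\delta')$, are not $G$-equivalent over any nonempty open intervals. -/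

import Mathlib

open Set
open scoped ContDiff

noncomputable section

namespace BLP

/-- The space with coordinates `(t, x, y, u, v) = (p 0, p 1, p 2, p 3, p 4)`. -/
abbrev Pt := Fin 5 → ℝ

/-- Nonempty open intervals of the real line, possibly unbounded. -/
def IsOpenInterval (I : Set ℝ) : Prop := IsOpen I ∧ I.OrdConnected ∧ I.Nonempty

/-- The domain `t ∈ I`, `y ∈ J`, with `x`, `u`, `v` arbitrary. -/
def strip (I J : Set ℝ) : Set Pt := {p | p 0 ∈ I ∧ p 2 ∈ J}

/-- Restriction of vector fields to `Ω`. A vector field on an open set `Ω` is represented by the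
function `Pt → Pt` that equals it on `Ω` and is zero outside `Ω`. -/
def restrictTo (Ω : Set Pt) : (Pt → Pt) →ₗ[ℝ] (Pt → Pt) where
  toFun V := Ω.indicator V
  map_add' V W := Set.indicator_add Ω V W
  map_smul' c V := Set.indicator_const_smul Ω c V

/-- `D(f) = f ∂_t + (1/2) f_t x ∂_x - ((1/2) f_t u + (1/4) f_tt x) ∂_u`. -/
def D (I J : Set ℝ) (f : ℝ → ℝ) : Pt → Pt :=
  restrictTo (strip I J) fun p =>
    ![f (p 0), 1 / 2 * deriv f (p 0) * p 1, 0,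
      -(1 / 2 * deriv f (p 0) * p 3 + 1 / 4 * deriv (deriv f) (p 0) * p 1), 0]

/-- `S(α) = α ∂_y - α_y v ∂_v`. -/
def S (I J : Set ℝ) (α : ℝ → ℝ) : Pt → Pt :=
  restrictTo (strip I J) fun p => ![0, 0, α (p 2), 0, -(deriv α (p 2) * p 4)]

/-- `P(g) = g ∂_x - (1/2) g_t ∂_u`. -/
def P (I J : Set ℝ) (g : ℝ → ℝ) : Pt → Pt :=
  restrictTo (strip I J) fun p => ![0, g (p 0), 0, -(1 / 2 * deriv g (p 0)), 0]

/-- `Z(β) = β ∂_v`. -/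
def Z (I J : Set ℝ) (β : ℝ → ℝ) : Pt → Pt :=
  restrictTo (strip I J) fun p => ![0, 0, 0, 0, β (p 2)]

/-- The algebra `𝔤` over the domain `t ∈ I`, `y ∈ J`: the span of all `D(f)`, `S(α)`, `P(g)`, `Z(β)`
with `f`, `g` smooth on `I` and `α`, `β` smooth on `J`. -/
def symAlgebra (I J : Set ℝ) : Submodule ℝ (Pt → Pt) :=
  Submodule.span ℝ
    ({V | ∃ f, ContDiffOn ℝ ∞ f I ∧ V = D I J f} ∪ {V | ∃ α, ContDiffOn ℝ ∞ α J ∧ V = S I J α} ∪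
      {V | ∃ g, ContDiffOn ℝ ∞ g I ∧ V = P I J g} ∪ {V | ∃ β, ContDiffOn ℝ ∞ β J ∧ V = Z I J β})

/-- Two-dimensional Lie subalgebras of `𝔤` (with the Lie bracket of vector fields). -/
def IsTwoDimSubalgebra (I J : Set ℝ) (s : Submodule ℝ (Pt → Pt)) : Prop :=
  s ≤ symAlgebra I J ∧ Module.finrank ℝ s = 2 ∧
    ∀ V ∈ s, ∀ W ∈ s, VectorField.lieBracket ℝ V W ∈ s

def IsAbelian (s : Submodule ℝ (Pt → Pt)) : Prop :=
  ∀ V ∈ s, ∀ W ∈ s, VectorField.lieBracket ℝ V W = 0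

/-- No nonzero element of `s` vanishes identically over a smaller domain `t ∈ I'`, `y ∈ J'`;
that is, `s` keeps its dimension when it is restricted to smaller intervals. -/
def RestrictsFaithfully (I J : Set ℝ) (s : Submodule ℝ (Pt → Pt)) : Prop :=
  ∀ I' ⊆ I, ∀ J' ⊆ J, IsOpenInterval I' → IsOpenInterval J' →
    ∀ V ∈ s, V ≠ 0 → ∃ p ∈ strip I' J', V p ≠ 0

/-- The point transformation
`t ↦ T`, `x ↦ ε T_t^{1/2} x + X⁰`, `y ↦ Y`,
`u ↦ ε T_t^{-1/2} u - (ε/4) T_tt T_t^{-3/2} x - X⁰_t / (2 T_t)`, `v ↦ v / Y_y + V⁰`. -/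
def pointTransformation (ε : ℝ) (T X₀ Y V₀ : ℝ → ℝ) : Pt → Pt := fun p =>
  ![T (p 0),
    ε * √(deriv T (p 0)) * p 1 + X₀ (p 0),
    Y (p 2),
    ε / √(deriv T (p 0)) * p 3 - ε * deriv (deriv T) (p 0) / (4 * √(deriv T (p 0)) ^ 3) * p 1
      - deriv X₀ (p 0) / (2 * deriv T (p 0)),
    1 / deriv Y (p 2) * p 4 + V₀ (p 2)]

/-- `Φ` belongs to the pseudogroup `G` and is defined for `t ∈ I`, `y ∈ J`, with image
`t ∈ I'`, `y ∈ J'`. -/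
def InPseudogroup (I J I' J' : Set ℝ) (Φ : Pt → Pt) : Prop :=
  ∃ (ε : ℝ) (T X₀ Y V₀ : ℝ → ℝ), (ε = 1 ∨ ε = -1) ∧
    ContDiffOn ℝ ∞ T I ∧ ContDiffOn ℝ ∞ X₀ I ∧ ContDiffOn ℝ ∞ Y J ∧ ContDiffOn ℝ ∞ V₀ J ∧
    (∀ t ∈ I, 0 < deriv T t) ∧ (∀ y ∈ J, deriv Y y ≠ 0) ∧ T '' I = I' ∧ Y '' J = J' ∧
    Φ = pointTransformation ε T X₀ Y V₀

/-- `W` is the pushforward by `Φ` of the vector field `V` on `Ω`, that is, `W ∘ Φ = dΦ (V)`. -/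
def IsPushforward (Φ : Pt → Pt) (Ω : Set Pt) (V W : Pt → Pt) : Prop :=
  ∀ p ∈ Ω, W (Φ p) = fderiv ℝ Φ p (V p)

/-- `G`-equivalence of a space `s` of vector fields over `t ∈ I`, `y ∈ J` and a space `s'` of vector
fields over `t ∈ I'`, `y ∈ J'`: `Φ_* s = s'` for some `Φ ∈ G`. -/
def GEquivalent (I J : Set ℝ) (s : Submodule ℝ (Pt → Pt))
    (I' J' : Set ℝ) (s' : Submodule ℝ (Pt → Pt)) : Prop :=
  ∃ Φ, InPseudogroup I J I' J' Φ ∧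
    (∀ V ∈ s, ∃ W ∈ s', IsPushforward Φ (strip I J) V W) ∧
    (∀ W ∈ s', ∃ V ∈ s, IsPushforward Φ (strip I J) V W)

/-- The eighteen families, each with the values of its parameters `δ, δ' ∈ {0, 1}`. -/
inductive Label
  | s1
  | s2 (δ : Fin 2)
  | s3 (δ : Fin 2)
  | s4 (δ : Fin 2)
  | s5 (δ : Fin 2)
  | s6 (δ δ' : Fin 2)
  | s7 (δ : Fin 2)
  | s8 (δ : Fin 2)
  | s9 (δ δ' : Fin 2)
  | s10 (δ δ' : Fin 2)
  | s11 (δ : Fin 2)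
  | s12 (δ : Fin 2)
  | s13 (δ : Fin 2)
  | s14 (δ : Fin 2)
  | s15
  | s16 (δ : Fin 2)
  | s17 (δ : Fin 2)
  | s18

/-- The families of the Abelian part of the list. -/
def Label.InAbelianPart : Label → Prop
  | .s1 | .s2 _ | .s3 _ | .s4 _ | .s5 _ | .s6 _ _ | .s7 _ | .s8 _ => False
  | _ => True

/-- `h` is constant on no nonempty open subinterval of `I`. -/
def NowhereConstantOn (h : ℝ → ℝ) (I : Set ℝ) : Prop :=
  ∀ I' ⊆ I, IsOpenInterval I' → ¬ ∃ c, ∀ x ∈ I', h x = c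

/-- The constraints on the parameters `δ, δ'`, `g = g(t)` and `β = β(y)`. -/
def Label.Admissible (I J : Set ℝ) (g β : ℝ → ℝ) : Label → Prop
  | .s6 δ δ' => (δ, δ') ≠ (0, 0)
  | .s10 δ δ' => (δ, δ') ≠ (0, 0)
  | .s11 _ => ContDiffOn ℝ ∞ β J
  | .s13 _ => ContDiffOn ℝ ∞ g I
  | .s16 _ => ContDiffOn ℝ ∞ g I ∧ NowhereConstantOn g I
  | .s17 _ => ContDiffOn ℝ ∞ β J ∧ NowhereConstantOn β J
  | .s18 => (ContDiffOn ℝ ∞ g I ∧ NowhereConstantOn g I) ∧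
      (ContDiffOn ℝ ∞ β J ∧ NowhereConstantOn β J)
  | _ => True

/-- The constant function with the value `δ ∈ {0, 1}`. -/
def const (δ : Fin 2) : ℝ → ℝ := fun _ => (δ.val : ℝ)

/-- The two basis elements of the listed algebras. -/
def Label.basis (I J : Set ℝ) (g β : ℝ → ℝ) : Label → (Pt → Pt) × (Pt → Pt)
  | .s1 => (D I J (const 1) + S I J (const 1), D I J (fun t => t) + S I J (fun y => y))
  | .s2 δ => (D I J (const 1) + Z I J (const δ), D I J (fun t => t) - S I J (fun y => y))
  | .s3 δ => (D I J (const 1), D I J (fun t => t) + Z I J (const δ))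
  | .s4 δ => (S I J (const 1) - P I J (const δ), D I J (fun t => 2 * t) + S I J (fun y => y))
  | .s5 δ => (S I J (const 1), S I J (fun y => y) + P I J (const δ))
  | .s6 δ δ' => (P I J (const δ) + Z I J (const δ'), D I J (fun t => 2 * t) - S I J (fun y => y))
  | .s7 δ => (P I J (const 1), D I J (fun t => 2 * t) + Z I J (const δ))
  | .s8 δ => (Z I J (const 1), -S I J (fun y => y) + P I J (const δ))
  | .s9 δ δ' => (D I J (const 1) + Z I J (const δ), S I J (const 1) - P I J (const δ'))
  | .s10 δ δ' => (D I J (const 1) + S I J (const 1), P I J (const δ) + Z I J (const δ'))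
  | .s11 δ => (D I J (const 1) + Z I J β, P I J (const δ) + Z I J (const 1))
  | .s12 δ => (D I J (const 1) + Z I J (const δ), P I J (const 1))
  | .s13 δ => (S I J (const 1) + P I J g, P I J (const 1) + Z I J (const δ))
  | .s14 δ => (S I J (const 1) - P I J (const δ), Z I J (const 1))
  | .s15 => (P I J (const 1), Z I J (const 1))
  | .s16 δ => (P I J (const 1) + Z I J (const δ), P I J g)
  | .s17 δ => (P I J (const δ) + Z I J (const 1), Z I J β)
  | .s18 => (P I J (const 1) + Z I J (const 1), P I J g + Z I J β)

/-- The listed algebra with the given label and functional parameters, over `t ∈ I`, `y ∈ J`. -/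
def Label.algebra (I J : Set ℝ) (g β : ℝ → ℝ) (l : Label) : Submodule ℝ (Pt → Pt) :=
  Submodule.span ℝ {(l.basis I J g β).1, (l.basis I J g β).2}

end BLP

end

/-!
The fields of `𝔤` split into those in `t, x, u` and those in `y, v`. Each of the two blocks is the
algebra of vector fields on an interval, `f ∂_t` respectively `α ∂_y`, extended by a space of
densities, on which it acts with weight `1/2` for `P` and `-1` for `Z`. The pseudogroup acts on the
blocks separately: `T` and `Y` change the variable, while `X⁰` and `V⁰` shift the density of a field
by its Lie derivative.

Locally a block of a two-dimensional algebra can be straightened in one of a few ways: a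
nonvanishing vector part becomes constant, after which a shift removes the density; two
noncommuting vector parts become `∂_t` and `t ∂_t`; a purely density-valued part becomes a constant
density. Combining a normal form of one block with one of the other leaves constants that dilations
normalize to `0` or `1`.

Listed algebras are told apart by which of the four components `f, g, α, β` vanish identically on
the elements of the algebra, and by whether the algebra is Abelian; both are invariant under the
pseudogroup.
-/

noncomputable section

namespace BLP

open Filter Topology

section OneVariable

variable {E : Type*} [NormedAddCommGroup E] [NormedSpace ℝ E] {I : Set ℝ} {f T : ℝ → ℝ} {t : ℝ}

theorem IsOpenInterval.isOpen (hI : IsOpenInterval I) : IsOpen I := hI.1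

theorem IsOpenInterval.ordConnected (hI : IsOpenInterval I) : I.OrdConnected := hI.2.1

theorem IsOpenInterval.nonempty (hI : IsOpenInterval I) : I.Nonempty := hI.2.2

theorem IsOpenInterval.isPreconnected (hI : IsOpenInterval I) : IsPreconnected I :=
  hI.ordConnected.isPreconnected

theorem exists_isOpenInterval_subset (hI : IsOpen I) (ht : t ∈ I) :
    ∃ I₀ ⊆ I, IsOpenInterval I₀ ∧ t ∈ I₀ := by
  obtain ⟨l, u, ⟨hl, hu⟩, hsub⟩ := mem_nhds_iff_exists_Ioo_subset.1 (hI.mem_nhds ht)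
  exact ⟨Ioo l u, hsub, ⟨isOpen_Ioo, ordConnected_Ioo, t, hl, hu⟩, hl, hu⟩

theorem exists_isOpenInterval_forall_ne_zero (hI : IsOpen I) (hf : ContinuousOn f I) (ht : t ∈ I)
    (h : f t ≠ 0) : ∃ I₀ ⊆ I, IsOpenInterval I₀ ∧ ∀ t ∈ I₀, f t ≠ 0 := by
  have hO : IsOpen (I ∩ f ⁻¹' {0}ᶜ) := hf.isOpen_inter_preimage hI isOpen_compl_singleton
  obtain ⟨I₀, hsub, hI₀, -⟩ := exists_isOpenInterval_subset hO (t := t) ⟨ht, h⟩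
  exact ⟨I₀, fun x hx => (hsub hx).1, hI₀, fun x hx => (hsub hx).2⟩

theorem contDiffOn_deriv {A : ℝ → E} (hI : IsOpen I) (hA : ContDiffOn ℝ ∞ A I) :
    ContDiffOn ℝ ∞ (deriv A) I :=
  ((contDiffOn_infty_iff_deriv_of_isOpen hI).1 hA).2

theorem hasDerivAt_of_contDiffOn {A : ℝ → E} (hI : IsOpen I) (hA : ContDiffOn ℝ ∞ A I)
    (ht : t ∈ I) : HasDerivAt A (deriv A t) t :=
  ((hA.differentiableOn (by simp)).differentiableAt (hI.mem_nhds ht)).hasDerivAt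

theorem contDiffOn_of_hasDerivAt {A A' : ℝ → E} (hI : IsOpen I) (hA' : ContDiffOn ℝ ∞ A' I)
    (h : ∀ t ∈ I, HasDerivAt A (A' t) t) : ContDiffOn ℝ ∞ A I :=
  (contDiffOn_infty_iff_deriv_of_isOpen hI).2
    ⟨fun t ht => (h t ht).differentiableAt.differentiableWithinAt,
      hA'.congr fun t ht => (h t ht).deriv⟩

theorem deriv_eq_of_eqOn {A B : ℝ → E} {b : E} (hI : IsOpen I) (h : EqOn A B I) (ht : t ∈ I)
    (hB : HasDerivAt B b t) : deriv A t = b :=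
  (h.eventuallyEq_of_mem (hI.mem_nhds ht)).deriv_eq.trans hB.deriv

theorem exists_hasDerivAt (hI : IsOpenInterval I) (hf : ContDiffOn ℝ ∞ f I) :
    ∃ F : ℝ → ℝ, ContDiffOn ℝ ∞ F I ∧ ∀ t ∈ I, HasDerivAt F (f t) t := by
  obtain ⟨t₀, ht₀⟩ := hI.nonempty
  have hF : ∀ t ∈ I, HasDerivAt (fun u => ∫ x in t₀..u, f x) (f t) t := fun t ht =>
    intervalIntegral.integral_hasDerivAt_right
      (hf.continuousOn.mono (hI.ordConnected.uIcc_subset ht₀ ht)).intervalIntegrable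
      (hf.continuousOn.stronglyMeasurableAtFilter hI.isOpen t ht)
      (hf.continuousOn.continuousAt (hI.isOpen.mem_nhds ht))
  exact ⟨_, contDiffOn_of_hasDerivAt hI.isOpen hf hF, hF⟩

theorem exists_eqOn_const_of_hasDerivAt_zero {A : ℝ → E} (hI : IsOpenInterval I)
    (h : ∀ t ∈ I, HasDerivAt A 0 t) : ∃ c, EqOn A (fun _ => c) I :=
  hI.isOpen.exists_is_const_of_deriv_eq_zero hI.isPreconnected
    (fun t ht => (h t ht).differentiableAt.differentiableWithinAt) fun t ht => (h t ht).deriv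

theorem forall_neg_or_forall_pos (hI : IsPreconnected I) (hf : ContinuousOn f I)
    (h : ∀ t ∈ I, f t ≠ 0) : (∀ t ∈ I, f t < 0) ∨ ∀ t ∈ I, 0 < f t := by
  contrapose! h
  obtain ⟨⟨a, ha, hfa⟩, ⟨b, hb, hfb⟩⟩ := h
  exact (hI.image f hf).ordConnected.out (mem_image_of_mem f hb) (mem_image_of_mem f ha) ⟨hfb, hfa⟩

theorem injOn_of_deriv_ne_zero (hI : I.OrdConnected) (hT : ContinuousOn T I)
    (h : ∀ t ∈ I, deriv T t ≠ 0) : InjOn T I := by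
  have no_eq : ∀ a ∈ I, ∀ b ∈ I, a < b → T a ≠ T b := by
    intro a ha b hb hab heq
    have hsub := hI.out ha hb
    obtain ⟨c, hc, hc'⟩ := exists_deriv_eq_zero hab (hT.mono hsub) heq
    exact h c (hsub (Ioo_subset_Icc_self hc)) hc'
  intro a ha b hb heq
  by_contra hne
  rcases lt_or_gt_of_ne hne with hab | hab
  exacts [no_eq a ha b hb hab heq, no_eq b hb a ha hab heq.symm]

theorem exists_openPartialHomeomorph (hI : IsOpenInterval I) (hT : ContDiffOn ℝ ∞ T I)
    (h : ∀ t ∈ I, deriv T t ≠ 0) :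
    ∃ e : OpenPartialHomeomorph ℝ ℝ, ⇑e = T ∧ e.source = I ∧ ContDiffOn ℝ ∞ e.symm (T '' I) := by
  have hT' : ∀ t ∈ I, HasStrictDerivAt T (deriv T t) t := fun t ht =>
    (hT.contDiffAt (hI.isOpen.mem_nhds ht)).hasStrictDerivAt (by simp)
  have hopen : IsOpenMap (I.domRestrict T) := by
    refine isOpenMap_iff_nhds_le.2 fun t => ?_
    rw [domRestrict_apply, ← (hT' t t.2).map_nhds_eq (h t t.2), domRestrict_eq, ← map_map,
      map_nhds_subtype_coe_eq_nhds t.2 (hI.isOpen.mem_nhds t.2)]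
  let e := OpenPartialHomeomorph.ofContinuousOpenRestrict
    ((injOn_of_deriv_ne_zero hI.ordConnected hT.continuousOn h).toPartialEquiv T I)
    hT.continuousOn hopen hI.isOpen
  refine ⟨e, rfl, rfl, fun s hs => ?_⟩
  have hs' : e.symm s ∈ I := e.map_target hs
  exact (e.contDiffAt_symm_deriv (h _ hs') hs (hT' _ hs').hasDerivAt
    (hT.contDiffAt (hI.isOpen.mem_nhds hs'))).contDiffWithinAt

theorem IsOpenInterval.image (hI : IsOpenInterval I) (hT : ContDiffOn ℝ ∞ T I)
    (h : ∀ t ∈ I, deriv T t ≠ 0) : IsOpenInterval (T '' I) := by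
  obtain ⟨e, rfl, rfl, -⟩ := exists_openPartialHomeomorph hI hT h
  exact ⟨e.image_source_eq_target ▸ e.open_target,
    (hI.isPreconnected.image e hT.continuousOn).ordConnected, hI.nonempty.image e⟩

theorem IsOpenInterval.inter_preimage {I₁ : Set ℝ} (hI : IsOpenInterval I)
    (hI₁ : IsOpenInterval I₁) (hT : ContDiffOn ℝ ∞ T I) (h : ∀ t ∈ I, deriv T t ≠ 0)
    (hsub : I₁ ⊆ T '' I) : IsOpenInterval (I ∩ T ⁻¹' I₁) := by
  refine ⟨hT.continuousOn.isOpen_inter_preimage hI.isOpen hI₁.isOpen, ?_, ?_⟩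
  · obtain ⟨e, rfl, rfl, he⟩ := exists_openPartialHomeomorph hI hT h
    rw [e.image_source_eq_target] at hsub
    rw [← e.symm_image_eq_source_inter_preimage hsub]
    exact (hI₁.isPreconnected.image _ (e.continuousOn_symm.mono hsub)).ordConnected
  · obtain ⟨s, hs⟩ := hI₁.nonempty
    obtain ⟨t, ht, rfl⟩ := hsub hs
    exact ⟨t, ht, hs⟩

end OneVariable

/-- A field on one of the two blocks of variables: a pair `(f, g)` of functions of one variable
stands for `D(f) + P(g)` in the variables `(t, x, u)` and for `S(f) + Z(g)` in `(y, v)`. -/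
abbrev BlockField := ℝ → ℝ × ℝ

/-- The two blocks of variables, `(t, x, u)` and `(y, v)`. -/
inductive Block
  | txu
  | yv

/-- Each block of `𝔤` is the semidirect product of the vector fields on the line with the densities
of this weight. -/
def Block.weight : Block → ℝ
  | .txu => 1 / 2
  | .yv => -1

/-- The Lie bracket of two block fields, in which second components are densities of weight `k`. -/
def bracket (k : ℝ) (A B : BlockField) : BlockField := fun t =>
  ((A t).1 * (deriv B t).1 - (B t).1 * (deriv A t).1,
    (A t).1 * (deriv B t).2 - k * (deriv A t).1 * (B t).2 -
      ((B t).1 * (deriv A t).2 - k * (deriv B t).1 * (A t).2))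

/-- A transformation of one block: the change of variable, the factor by which it multiplies the
second components of block fields, and the function added to the fibre variable (`X⁰` or `V⁰`). -/
structure BlockMap where
  /-- The change of variable `T` or `Y`. -/
  base : ℝ → ℝ
  /-- The factor `ε T_t^{1/2}` or `1 / Y_y`. -/
  mult : ℝ → ℝ
  /-- The shift `X⁰` or `V⁰`. -/
  shift : ℝ → ℝ

/-- `m` is one of the factors by which the change of variable `T` acts on second components. -/
def Block.IsMultiplier (I : Set ℝ) (T m : ℝ → ℝ) : Block → Prop
  | .txu => ∃ ε : ℝ, (ε = 1 ∨ ε = -1) ∧ ∀ t ∈ I, 0 < deriv T t ∧ m t = ε * √(deriv T t)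
  | .yv => ∀ t ∈ I, deriv T t ≠ 0 ∧ m t = 1 / deriv T t

/-- `Φ` is the part of an element of the pseudogroup `G` that acts on the block `σ`, over `I`. -/
structure BlockMap.IsMoveOn (σ : Block) (I : Set ℝ) (Φ : BlockMap) : Prop where
  isOpenInterval : IsOpenInterval I
  contDiffOn_base : ContDiffOn ℝ ∞ Φ.base I
  contDiffOn_shift : ContDiffOn ℝ ∞ Φ.shift I
  isMultiplier : σ.IsMultiplier I Φ.base Φ.mult

/-- The derivative, in the new variable, of the first component of the pushforward of `A`. -/
def BlockMap.pushFstDeriv (Φ : BlockMap) (A : BlockField) (t : ℝ) : ℝ :=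
  (deriv A t).1 + deriv (deriv Φ.base) t * (A t).1 / deriv Φ.base t

/-- The pushforward of the block field `A`, as a function of the old variable. -/
def BlockMap.push (σ : Block) (Φ : BlockMap) (A : BlockField) : BlockField := fun t =>
  (deriv Φ.base t * (A t).1,
    Φ.mult t * (A t).2 + deriv Φ.shift t * (A t).1 - σ.weight * Φ.shift t * Φ.pushFstDeriv A t)

/-- `B` is the pushforward of `A` by `Φ`. -/
def BlockMap.Pushes (σ : Block) (I : Set ℝ) (Φ : BlockMap) (A B : BlockField) : Prop :=
  ∀ t ∈ I, B (Φ.base t) = Φ.push σ A t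

/-- The map `Φ` followed by `Ψ`. -/
def BlockMap.comp (Ψ Φ : BlockMap) : BlockMap where
  base := Ψ.base ∘ Φ.base
  mult t := Ψ.mult (Φ.base t) * Φ.mult t
  shift t := Ψ.mult (Φ.base t) * Φ.shift t + Ψ.shift (Φ.base t)

section BlockMaps

variable {σ : Block} {I I' : Set ℝ} {T m : ℝ → ℝ} {Φ Ψ : BlockMap} {A A₁ A₂ B B₁ B₂ C : BlockField}
  {t : ℝ}

theorem Block.weight_ne_zero (σ : Block) : σ.weight ≠ 0 := by cases σ <;> norm_num [Block.weight]

theorem hasDerivAt_fst (hI : IsOpen I) (hA : ContDiffOn ℝ ∞ A I) (ht : t ∈ I) :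
    HasDerivAt (fun t => (A t).1) (deriv A t).1 t :=
  (ContinuousLinearMap.fst ℝ ℝ ℝ).hasFDerivAt.comp_hasDerivAt t (hasDerivAt_of_contDiffOn hI hA ht)

theorem hasDerivAt_snd (hI : IsOpen I) (hA : ContDiffOn ℝ ∞ A I) (ht : t ∈ I) :
    HasDerivAt (fun t => (A t).2) (deriv A t).2 t :=
  (ContinuousLinearMap.snd ℝ ℝ ℝ).hasFDerivAt.comp_hasDerivAt t (hasDerivAt_of_contDiffOn hI hA ht)

theorem Block.IsMultiplier.deriv_ne_zero (h : σ.IsMultiplier I T m) : ∀ t ∈ I, deriv T t ≠ 0 := by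
  intro t ht
  cases σ with
  | txu => obtain ⟨ε, -, h⟩ := h; exact (h t ht).1.ne'
  | yv => exact (h t ht).1

theorem Block.IsMultiplier.ne_zero (h : σ.IsMultiplier I T m) (ht : t ∈ I) : m t ≠ 0 := by
  cases σ with
  | txu =>
    obtain ⟨ε, hε, h⟩ := h
    rw [(h t ht).2]
    have hε0 : ε ≠ 0 := by rcases hε with rfl | rfl <;> norm_num
    exact mul_ne_zero hε0 (Real.sqrt_pos.2 (h t ht).1).ne'
  | yv => rw [(h t ht).2]; exact one_div_ne_zero (h t ht).1

theorem Block.IsMultiplier.hasDerivAt (hI : IsOpen I) (hT : ContDiffOn ℝ ∞ T I)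
    (h : σ.IsMultiplier I T m) (ht : t ∈ I) :
    HasDerivAt m (σ.weight * m t * deriv (deriv T) t / deriv T t) t := by
  have hT' := hasDerivAt_of_contDiffOn hI (contDiffOn_deriv hI hT) ht
  have hne := h.deriv_ne_zero t ht
  cases σ with
  | txu =>
    obtain ⟨ε, -, h⟩ := h
    have hs0 := (Real.sqrt_pos.2 (h t ht).1).ne'
    have hsq := Real.sq_sqrt (h t ht).1.le
    have hm := ((hT'.sqrt hne).const_mul ε).congr_of_eventuallyEq
      (eventually_of_mem (hI.mem_nhds ht) fun s hs => (h s hs).2)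
    refine hm.congr_deriv ?_
    rw [(h t ht).2, Block.weight, eq_div_iff hne]
    field_simp
    linear_combination -ε * deriv (deriv T) t * hsq
  | yv =>
    have hm := (hT'.inv hne).congr_of_eventuallyEq
      (eventually_of_mem (hI.mem_nhds ht) fun s hs => (h s hs).2.trans (one_div _))
    refine hm.congr_deriv ?_
    rw [(h t ht).2, Block.weight]
    field_simp

theorem Block.IsMultiplier.contDiffOn (hI : IsOpen I) (hT : ContDiffOn ℝ ∞ T I)
    (h : σ.IsMultiplier I T m) : ContDiffOn ℝ ∞ m I := by
  have hT' := contDiffOn_deriv hI hT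
  have hne := h.deriv_ne_zero
  cases σ with
  | txu =>
    obtain ⟨ε, -, h⟩ := h
    exact (contDiffOn_const.mul (hT'.sqrt hne)).congr fun t ht => (h t ht).2
  | yv => exact (contDiffOn_const.div hT' hne).congr fun t ht => (h t ht).2

theorem Block.IsMultiplier.mono (h : σ.IsMultiplier I T m) (hI : I' ⊆ I) :
    σ.IsMultiplier I' T m := by
  cases σ with
  | txu => obtain ⟨ε, hε, h⟩ := h; exact ⟨ε, hε, fun t ht => h t (hI ht)⟩
  | yv => exact fun t ht => h t (hI ht)

theorem Block.exists_isMultiplier (σ : Block) (h : ∀ t ∈ I, 0 < deriv T t) :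
    ∃ m, σ.IsMultiplier I T m := by
  cases σ with
  | txu => exact ⟨_, 1, Or.inl rfl, fun t ht => ⟨h t ht, rfl⟩⟩
  | yv => exact ⟨_, fun t ht => ⟨(h t ht).ne', rfl⟩⟩

theorem BlockMap.IsMoveOn.isOpen (h : Φ.IsMoveOn σ I) : IsOpen I := h.isOpenInterval.isOpen

theorem BlockMap.IsMoveOn.deriv_ne_zero (h : Φ.IsMoveOn σ I) : ∀ t ∈ I, deriv Φ.base t ≠ 0 :=
  h.isMultiplier.deriv_ne_zero

theorem BlockMap.IsMoveOn.hasDerivAt_base (h : Φ.IsMoveOn σ I) (ht : t ∈ I) :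
    HasDerivAt Φ.base (deriv Φ.base t) t :=
  hasDerivAt_of_contDiffOn h.isOpen h.contDiffOn_base ht

theorem BlockMap.IsMoveOn.hasDerivAt_deriv_base (h : Φ.IsMoveOn σ I) (ht : t ∈ I) :
    HasDerivAt (deriv Φ.base) (deriv (deriv Φ.base) t) t :=
  hasDerivAt_of_contDiffOn h.isOpen (contDiffOn_deriv h.isOpen h.contDiffOn_base) ht

theorem BlockMap.IsMoveOn.hasDerivAt_shift (h : Φ.IsMoveOn σ I) (ht : t ∈ I) :
    HasDerivAt Φ.shift (deriv Φ.shift t) t :=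
  hasDerivAt_of_contDiffOn h.isOpen h.contDiffOn_shift ht

theorem BlockMap.IsMoveOn.hasDerivAt_mult (h : Φ.IsMoveOn σ I) (ht : t ∈ I) :
    HasDerivAt Φ.mult
      (σ.weight * Φ.mult t * deriv (deriv Φ.base) t / deriv Φ.base t) t :=
  h.isMultiplier.hasDerivAt h.isOpen h.contDiffOn_base ht

theorem BlockMap.IsMoveOn.contDiffOn_mult (h : Φ.IsMoveOn σ I) : ContDiffOn ℝ ∞ Φ.mult I :=
  h.isMultiplier.contDiffOn h.isOpen h.contDiffOn_base

theorem BlockMap.IsMoveOn.mono (h : Φ.IsMoveOn σ I) (hI : I' ⊆ I) (hI' : IsOpenInterval I') :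
    Φ.IsMoveOn σ I' :=
  ⟨hI', h.contDiffOn_base.mono hI, h.contDiffOn_shift.mono hI, h.isMultiplier.mono hI⟩

theorem BlockMap.IsMoveOn.image (h : Φ.IsMoveOn σ I) : IsOpenInterval (Φ.base '' I) :=
  h.isOpenInterval.image h.contDiffOn_base h.deriv_ne_zero

theorem BlockMap.IsMoveOn.hasDerivAt_comp_base (h : Φ.IsMoveOn σ I) {f : ℝ → ℝ}
    (hf : ContDiffOn ℝ ∞ f (Φ.base '' I)) (ht : t ∈ I) :
    HasDerivAt (f ∘ Φ.base) (deriv f (Φ.base t) * deriv Φ.base t) t :=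
  (hasDerivAt_of_contDiffOn h.image.isOpen hf (mem_image_of_mem _ ht)).comp t (h.hasDerivAt_base ht)

theorem contDiffOn_fst (hA : ContDiffOn ℝ ∞ A I) : ContDiffOn ℝ ∞ (fun t => (A t).1) I :=
  contDiff_fst.comp_contDiffOn hA

theorem contDiffOn_snd (hA : ContDiffOn ℝ ∞ A I) : ContDiffOn ℝ ∞ (fun t => (A t).2) I :=
  contDiff_snd.comp_contDiffOn hA

theorem BlockMap.IsMoveOn.contDiffOn_pushFstDeriv (h : Φ.IsMoveOn σ I) (hA : ContDiffOn ℝ ∞ A I) :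
    ContDiffOn ℝ ∞ (Φ.pushFstDeriv A) I := by
  have hT' := contDiffOn_deriv h.isOpen h.contDiffOn_base
  exact (contDiffOn_fst (contDiffOn_deriv h.isOpen hA)).add
    (((contDiffOn_deriv h.isOpen hT').mul (contDiffOn_fst hA)).div hT' h.deriv_ne_zero)

theorem BlockMap.IsMoveOn.contDiffOn_push (h : Φ.IsMoveOn σ I) (hA : ContDiffOn ℝ ∞ A I) :
    ContDiffOn ℝ ∞ (Φ.push σ A) I :=
  ((contDiffOn_deriv h.isOpen h.contDiffOn_base).mul (contDiffOn_fst hA)).prodMk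
    (((h.contDiffOn_mult.mul (contDiffOn_snd hA)).add
      ((contDiffOn_deriv h.isOpen h.contDiffOn_shift).mul (contDiffOn_fst hA))).sub
      ((contDiffOn_const.mul h.contDiffOn_shift).mul (h.contDiffOn_pushFstDeriv hA)))

theorem BlockMap.IsMoveOn.exists_pushes (h : Φ.IsMoveOn σ I) (hA : ContDiffOn ℝ ∞ A I) :
    ∃ B, ContDiffOn ℝ ∞ B (Φ.base '' I) ∧ Φ.Pushes σ I A B := by
  obtain ⟨e, he, rfl, hsymm⟩ :=
    exists_openPartialHomeomorph h.isOpenInterval h.contDiffOn_base h.deriv_ne_zero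
  rw [← he, e.image_source_eq_target] at hsymm ⊢
  refine ⟨Φ.push σ A ∘ e.symm, (h.contDiffOn_push hA).comp hsymm e.symm.mapsTo, fun t ht => ?_⟩
  rw [Function.comp_apply, ← he, e.left_inv ht]

theorem BlockMap.Pushes.unique (h₁ : Φ.Pushes σ I A B₁) (h₂ : Φ.Pushes σ I A B₂) :
    EqOn B₁ B₂ (Φ.base '' I) := by
  rintro _ ⟨t, ht, rfl⟩
  rw [h₁ t ht, h₂ t ht]

theorem BlockMap.Pushes.contDiffOn (h : Φ.IsMoveOn σ I) (hA : ContDiffOn ℝ ∞ A I)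
    (hP : Φ.Pushes σ I A B) : ContDiffOn ℝ ∞ B (Φ.base '' I) := by
  obtain ⟨B', hB', hP'⟩ := h.exists_pushes hA
  exact hB'.congr (hP.unique hP')

theorem BlockMap.Pushes.congr_right (hP : Φ.Pushes σ I A B₁) (h : EqOn B₁ B₂ (Φ.base '' I)) :
    Φ.Pushes σ I A B₂ := fun t ht => (h (mem_image_of_mem _ ht)).symm.trans (hP t ht)

theorem BlockMap.Pushes.congr_left (hI : IsOpen I) (h : EqOn A₁ A₂ I) (hP : Φ.Pushes σ I A₁ B) :
    Φ.Pushes σ I A₂ B := by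
  intro t ht
  have hd : deriv A₁ t = deriv A₂ t := (h.eventuallyEq_of_mem (hI.mem_nhds ht)).deriv_eq
  rw [hP t ht, push, push, pushFstDeriv, pushFstDeriv, h ht, hd]

theorem BlockMap.Pushes.mono (h : Φ.Pushes σ I A B) (hI : I' ⊆ I) : Φ.Pushes σ I' A B :=
  fun t ht => h t (hI ht)

theorem BlockMap.IsMoveOn.hasDerivAt_pushFstDeriv (h : Φ.IsMoveOn σ I) (hA : ContDiffOn ℝ ∞ A I)
    (ht : t ∈ I) : HasDerivAt (Φ.pushFstDeriv A) ((deriv (deriv A) t).1 +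
      ((deriv (deriv (deriv Φ.base)) t * (A t).1 + deriv (deriv Φ.base) t * (deriv A t).1) *
        deriv Φ.base t - deriv (deriv Φ.base) t * (A t).1 * deriv (deriv Φ.base) t) /
        deriv Φ.base t ^ 2) t := by
  have hT'' := contDiffOn_deriv h.isOpen (contDiffOn_deriv h.isOpen h.contDiffOn_base)
  exact (hasDerivAt_fst h.isOpen (contDiffOn_deriv h.isOpen hA) ht).add
    (((hasDerivAt_of_contDiffOn h.isOpen hT'' ht).mul (hasDerivAt_fst h.isOpen hA ht)).div
      (h.hasDerivAt_deriv_base ht) (h.deriv_ne_zero t ht))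

theorem BlockMap.IsMoveOn.hasDerivAt_push (h : Φ.IsMoveOn σ I) (hA : ContDiffOn ℝ ∞ A I)
    (ht : t ∈ I) : HasDerivAt (Φ.push σ A) (deriv Φ.base t * Φ.pushFstDeriv A t,
      σ.weight * Φ.mult t * deriv (deriv Φ.base) t / deriv Φ.base t * (A t).2 +
      Φ.mult t * (deriv A t).2 + deriv (deriv Φ.shift) t * (A t).1 +
      deriv Φ.shift t * (deriv A t).1 - σ.weight * (deriv Φ.shift t * Φ.pushFstDeriv A t +
        Φ.shift t * deriv (Φ.pushFstDeriv A) t)) t := by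
  have hfst := (h.hasDerivAt_deriv_base ht).mul (hasDerivAt_fst h.isOpen hA ht)
  have hsnd := (((h.hasDerivAt_mult ht).mul (hasDerivAt_snd h.isOpen hA ht)).add
    ((hasDerivAt_of_contDiffOn h.isOpen (contDiffOn_deriv h.isOpen h.contDiffOn_shift) ht).mul
      (hasDerivAt_fst h.isOpen hA ht))).sub (((h.hasDerivAt_shift ht).const_mul σ.weight).mul
    (hasDerivAt_of_contDiffOn h.isOpen (h.contDiffOn_pushFstDeriv hA) ht))
  refine (hfst.prodMk hsnd).congr_deriv (Prod.ext ?_ ?_)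
  · have := h.deriv_ne_zero t ht
    simp only [pushFstDeriv]
    field_simp
    ring
  · ring

theorem BlockMap.Pushes.smul_deriv (h : Φ.IsMoveOn σ I) (hA : ContDiffOn ℝ ∞ A I)
    (hP : Φ.Pushes σ I A B) (ht : t ∈ I) :
    deriv Φ.base t • deriv B (Φ.base t) = deriv (Φ.push σ A) t := by
  have hB := (hasDerivAt_of_contDiffOn h.image.isOpen (hP.contDiffOn h hA)
    (mem_image_of_mem _ ht)).scomp t (h.hasDerivAt_base ht)
  exact hB.deriv.symm.trans (deriv_eq_of_eqOn h.isOpen hP ht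
    (hasDerivAt_of_contDiffOn h.isOpen (h.contDiffOn_push hA) ht))

theorem BlockMap.Pushes.deriv_fst (h : Φ.IsMoveOn σ I) (hA : ContDiffOn ℝ ∞ A I)
    (hP : Φ.Pushes σ I A B) (ht : t ∈ I) : (deriv B (Φ.base t)).1 = Φ.pushFstDeriv A t := by
  have hd := congrArg Prod.fst (hP.smul_deriv h hA ht)
  rw [(h.hasDerivAt_push hA ht).deriv] at hd
  exact mul_left_cancel₀ (h.deriv_ne_zero t ht) hd

theorem BlockMap.Pushes.deriv_snd (h : Φ.IsMoveOn σ I) (hA : ContDiffOn ℝ ∞ A I)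
    (hP : Φ.Pushes σ I A B) (ht : t ∈ I) :
    (deriv B (Φ.base t)).2 = (deriv (Φ.push σ A) t).2 / deriv Φ.base t :=
  (eq_div_iff (h.deriv_ne_zero t ht)).2
    ((mul_comm _ _).trans (congrArg Prod.snd (hP.smul_deriv h hA ht)))

theorem contDiffOn_bracket (hI : IsOpen I) (k : ℝ) (hA : ContDiffOn ℝ ∞ A I)
    (hB : ContDiffOn ℝ ∞ B I) : ContDiffOn ℝ ∞ (bracket k A B) I := by
  have hA' := contDiffOn_deriv hI hA
  have hB' := contDiffOn_deriv hI hB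
  exact (((contDiffOn_fst hA).mul (contDiffOn_fst hB')).sub
    ((contDiffOn_fst hB).mul (contDiffOn_fst hA'))).prodMk
      ((((contDiffOn_fst hA).mul (contDiffOn_snd hB')).sub
        ((contDiffOn_const.mul (contDiffOn_fst hA')).mul (contDiffOn_snd hB))).sub
        (((contDiffOn_fst hB).mul (contDiffOn_snd hA')).sub
          ((contDiffOn_const.mul (contDiffOn_fst hB')).mul (contDiffOn_snd hA))))

theorem BlockMap.Pushes.bracket (h : Φ.IsMoveOn σ I) (h₁ : ContDiffOn ℝ ∞ A₁ I)
    (h₂ : ContDiffOn ℝ ∞ A₂ I) (hP₁ : Φ.Pushes σ I A₁ B₁) (hP₂ : Φ.Pushes σ I A₂ B₂) :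
    Φ.Pushes σ I (bracket σ.weight A₁ A₂) (bracket σ.weight B₁ B₂) := by
  intro t ht
  have hd := h.deriv_ne_zero t ht
  have hbr : (deriv (BLP.bracket σ.weight A₁ A₂) t).1 = _ :=
    (hasDerivAt_fst h.isOpen (contDiffOn_bracket h.isOpen σ.weight h₁ h₂) ht).unique
      (((hasDerivAt_fst h.isOpen h₁ ht).mul
        (hasDerivAt_fst h.isOpen (contDiffOn_deriv h.isOpen h₂) ht)).sub
        ((hasDerivAt_fst h.isOpen h₂ ht).mul
          (hasDerivAt_fst h.isOpen (contDiffOn_deriv h.isOpen h₁) ht)))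
  rw [push, pushFstDeriv, hbr]
  simp only [BLP.bracket, hP₁ t ht, hP₂ t ht, hP₁.deriv_fst h h₁ ht, hP₂.deriv_fst h h₂ ht,
    hP₁.deriv_snd h h₁ ht, hP₂.deriv_snd h h₂ ht, (h.hasDerivAt_push h₁ ht).deriv,
    (h.hasDerivAt_push h₂ ht).deriv, (h.hasDerivAt_pushFstDeriv h₁ ht).deriv,
    (h.hasDerivAt_pushFstDeriv h₂ ht).deriv, push, pushFstDeriv]
  refine Prod.ext ?_ ?_ <;> field_simp <;> ring

theorem BlockMap.pushes_zero : Φ.Pushes σ I 0 0 := fun t _ => by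
  simp [push, pushFstDeriv, Prod.ext_iff]

theorem BlockMap.Pushes.add (h : Φ.IsMoveOn σ I) (h₁ : ContDiffOn ℝ ∞ A₁ I)
    (h₂ : ContDiffOn ℝ ∞ A₂ I) (hP₁ : Φ.Pushes σ I A₁ B₁) (hP₂ : Φ.Pushes σ I A₂ B₂) :
    Φ.Pushes σ I (A₁ + A₂) (B₁ + B₂) := by
  intro t ht
  have hd := ((hasDerivAt_of_contDiffOn h.isOpen h₁ ht).add
    (hasDerivAt_of_contDiffOn h.isOpen h₂ ht)).deriv
  rw [Pi.add_apply, hP₁ t ht, hP₂ t ht]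
  simp only [push, pushFstDeriv, hd, Pi.add_apply, Prod.fst_add, Prod.snd_add, Prod.mk_add_mk]
  exact Prod.ext (by ring) (by ring)

theorem BlockMap.Pushes.smul (h : Φ.IsMoveOn σ I) (hA : ContDiffOn ℝ ∞ A I)
    (hP : Φ.Pushes σ I A B) (c : ℝ) : Φ.Pushes σ I (c • A) (c • B) := by
  intro t ht
  have hd := ((hasDerivAt_of_contDiffOn h.isOpen hA ht).const_smul c).deriv
  rw [Pi.smul_apply, hP t ht]
  simp only [push, pushFstDeriv, hd, Pi.smul_apply, Prod.smul_fst, Prod.smul_snd, Prod.smul_mk,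
    smul_eq_mul]
  exact Prod.ext (by ring) (by ring)

theorem BlockMap.Pushes.eqOn_zero (h : Φ.IsMoveOn σ I) (hA : ContDiffOn ℝ ∞ A I)
    (hP : Φ.Pushes σ I A B) (hI : I' ⊆ I) (hI' : IsOpen I')
    (hB : ∀ t ∈ I', B (Φ.base t) = 0) : EqOn A 0 I' := by
  have hfst : ∀ t ∈ I', (A t).1 = 0 := fun t ht => by
    have hpush := congrArg Prod.fst ((hB t ht).symm.trans (hP t (hI ht)))
    exact (mul_eq_zero.1 hpush.symm).resolve_left (h.deriv_ne_zero t (hI ht))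
  intro t ht
  have hd : (deriv A t).1 = 0 :=
    (hasDerivAt_fst h.isOpen hA (hI ht)).deriv.symm.trans
      (deriv_eq_of_eqOn hI' hfst ht (hasDerivAt_const t 0))
  have hpush := congrArg Prod.snd ((hB t ht).symm.trans (hP t (hI ht)))
  simp only [push, pushFstDeriv, hfst t ht, hd, mul_zero, zero_div, add_zero, sub_zero,
    Prod.snd_zero] at hpush
  exact Prod.ext (hfst t ht)
    ((mul_eq_zero.1 hpush.symm).resolve_left (h.isMultiplier.ne_zero (hI ht)))

theorem BlockMap.IsMoveOn.comp (hΦ : Φ.IsMoveOn σ I) (hΨ : Ψ.IsMoveOn σ (Φ.base '' I)) :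
    (Ψ.comp Φ).IsMoveOn σ I := by
  have hmaps : MapsTo Φ.base I (Φ.base '' I) := mapsTo_image _ _
  refine ⟨hΦ.isOpenInterval, hΨ.contDiffOn_base.comp hΦ.contDiffOn_base hmaps, ?_, ?_⟩
  · exact ((hΨ.contDiffOn_mult.comp hΦ.contDiffOn_base hmaps).mul hΦ.contDiffOn_shift).add
      (hΨ.contDiffOn_shift.comp hΦ.contDiffOn_base hmaps)
  · have hd : ∀ t ∈ I, deriv (Ψ.base ∘ Φ.base) t = deriv Ψ.base (Φ.base t) * deriv Φ.base t :=
      fun t ht => (hΦ.hasDerivAt_comp_base hΨ.contDiffOn_base ht).deriv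
    have hmΦ := hΦ.isMultiplier
    have hmΨ := hΨ.isMultiplier
    cases σ with
    | txu =>
      obtain ⟨ε, hε, hmΦ⟩ := hmΦ
      obtain ⟨ε', hε', hmΨ⟩ := hmΨ
      refine ⟨ε' * ε, by rcases hε with rfl | rfl <;> rcases hε' with rfl | rfl <;> simp,
        fun t ht => ?_⟩
      obtain ⟨hposΦ, heqΦ⟩ := hmΦ t ht
      obtain ⟨hposΨ, heqΨ⟩ := hmΨ _ (hmaps ht)
      simp only [hd t ht, Real.sqrt_mul hposΨ.le, BlockMap.comp, heqΦ, heqΨ]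
      exact ⟨mul_pos hposΨ hposΦ, by ring⟩
    | yv =>
      intro t ht
      obtain ⟨hneΦ, heqΦ⟩ := hmΦ t ht
      obtain ⟨hneΨ, heqΨ⟩ := hmΨ _ (hmaps ht)
      simp only [hd t ht, BlockMap.comp, heqΦ, heqΨ]
      exact ⟨mul_ne_zero hneΨ hneΦ, by field_simp⟩

theorem BlockMap.Pushes.comp (hΦ : Φ.IsMoveOn σ I) (hΨ : Ψ.IsMoveOn σ (Φ.base '' I))
    (hA : ContDiffOn ℝ ∞ A I) (hAB : Φ.Pushes σ I A B) (hBC : Ψ.Pushes σ (Φ.base '' I) B C) :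
    (Ψ.comp Φ).Pushes σ I A C := by
  intro t ht
  have hmem := mem_image_of_mem Φ.base ht
  have hd : ∀ t ∈ I, deriv (Ψ.base ∘ Φ.base) t = deriv Ψ.base (Φ.base t) * deriv Φ.base t :=
    fun t ht => (hΦ.hasDerivAt_comp_base hΨ.contDiffOn_base ht).deriv
  have hdd : deriv (deriv (Ψ.base ∘ Φ.base)) t = _ := deriv_eq_of_eqOn hΦ.isOpen hd ht
    ((hΦ.hasDerivAt_comp_base (contDiffOn_deriv hΨ.isOpen hΨ.contDiffOn_base) ht).mul
      (hΦ.hasDerivAt_deriv_base ht))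
  have hshift : deriv (fun t => Ψ.mult (Φ.base t) * Φ.shift t + Ψ.shift (Φ.base t)) t = _ :=
    HasDerivAt.deriv ((((hΨ.hasDerivAt_mult hmem).comp t (hΦ.hasDerivAt_base ht)).mul
      (hΦ.hasDerivAt_shift ht)).add (hΦ.hasDerivAt_comp_base hΨ.contDiffOn_shift ht))
  have hneΦ := hΦ.deriv_ne_zero t ht
  have hneΨ := hΨ.deriv_ne_zero _ hmem
  simp only [Function.comp_apply] at hdd
  simp only [BlockMap.comp, push, pushFstDeriv, Function.comp_apply, hd t ht, hdd, hshift,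
    hBC _ hmem, hAB t ht, hAB.deriv_fst hΦ hA ht]
  exact Prod.ext (by ring) (by field_simp; ring)

end BlockMaps

/-- The block field with first component `p + q t` and constant second component `r`. -/
def affine (p q r : ℝ) : BlockField := fun t => (p + q * t, r)

/-- The block field with first component zero and second component `f`. -/
def density (f : ℝ → ℝ) : BlockField := fun t => (0, f t)

section Affine

variable {I : Set ℝ} (p q r p' q' r' c k : ℝ)

theorem contDiffOn_affine : ContDiffOn ℝ ∞ (affine p q r) I :=
  (contDiff_const.add (contDiff_const.mul contDiff_id)).contDiffOn.prodMk contDiffOn_const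

theorem contDiffOn_density {f : ℝ → ℝ} (hf : ContDiffOn ℝ ∞ f I) : ContDiffOn ℝ ∞ (density f) I :=
  contDiffOn_const.prodMk hf

theorem hasDerivAt_affine (t : ℝ) : HasDerivAt (affine p q r) (affine q 0 0 t) t := by
  refine ((((hasDerivAt_id t).const_mul q).const_add p).prodMk
    (hasDerivAt_const t r)).congr_deriv ?_
  simp [affine]

theorem deriv_affine : deriv (affine p q r) = affine q 0 0 :=
  funext fun t => (hasDerivAt_affine p q r t).deriv

theorem affine_zero : affine 0 0 0 = 0 := by
  ext <;> simp [affine]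

theorem affine_add : affine p q r + affine p' q' r' = affine (p + p') (q + q') (r + r') := by
  ext t <;> simp only [affine, Pi.add_apply, Prod.mk_add_mk]
  ring

theorem smul_affine : c • affine p q r = affine (c * p) (c * q) (c * r) := by
  ext t <;> simp only [affine, Pi.smul_apply, Prod.smul_mk, smul_eq_mul]
  ring

theorem smul_density (f : ℝ → ℝ) : c • density f = density (c • f) := by
  ext t <;> simp [density]

theorem bracket_affine : bracket k (affine p q r) (affine p' q' r') =
    affine (p * q' - p' * q) 0 (k * (q' * r - q * r')) := by
  ext t <;> simp only [bracket, deriv_affine, affine] <;> ring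

theorem bracket_const_left (B : BlockField) : bracket k (affine c 0 0) B = c • deriv B := by
  ext t <;> simp only [bracket, deriv_affine, affine] <;> simp

theorem bracket_zero_left (B : BlockField) : bracket k 0 B = 0 := by
  ext t <;> simp [bracket]

theorem bracket_zero_right (A : BlockField) : bracket k A 0 = 0 := by
  ext t <;> simp [bracket]

theorem deriv_density_fst (f : ℝ → ℝ) (t : ℝ) : (deriv (density f) t).1 = 0 := by
  by_cases h : DifferentiableAt ℝ (density f) t
  · exact ((ContinuousLinearMap.fst ℝ ℝ ℝ).hasFDerivAt.comp_hasDerivAt t h.hasDerivAt).unique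
      (hasDerivAt_const t 0)
  · rw [deriv_zero_of_not_differentiableAt h, Prod.fst_zero]

theorem affine_eq_density : affine 0 0 r = density fun _ => r := by
  ext t <;> simp [affine, density]

theorem bracket_density (f h : ℝ → ℝ) : bracket k (density f) (density h) = 0 := by
  ext t <;> simp only [bracket, deriv_density_fst] <;> simp [density]

theorem bracket_affine_density (f : ℝ → ℝ) : bracket k (affine 0 0 r) (density f) = 0 := by
  rw [affine_eq_density, bracket_density]

theorem bracket_density_affine (f : ℝ → ℝ) : bracket k (density f) (affine 0 0 r) = 0 := by
  rw [affine_eq_density, bracket_density]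

end Affine

/-- A move of the block `σ`, over some open subinterval of `I`, onto `I'`. -/
structure Reduction (σ : Block) (I I' : Set ℝ) where
  map : BlockMap
  dom : Set ℝ
  dom_subset : dom ⊆ I
  isMoveOn : map.IsMoveOn σ dom
  image_dom : map.base '' dom = I'

/-- The reduction `ρ` takes the smooth block field `A` to `B`. -/
def Reduction.Sends {σ : Block} {I I' : Set ℝ} (ρ : Reduction σ I I') (A B : BlockField) : Prop :=
  ContDiffOn ℝ ∞ A ρ.dom ∧ ρ.map.Pushes σ ρ.dom A B

section Reductions

variable {σ : Block} {I I₀ I' I'' : Set ℝ} {Φ : BlockMap} {A A₁ A₂ B B₁ B₂ C : BlockField} {t : ℝ}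

/-- A move over a subinterval, as a reduction. -/
def BlockMap.IsMoveOn.toReduction (h : Φ.IsMoveOn σ I₀) (hI : I₀ ⊆ I) :
    Reduction σ I (Φ.base '' I₀) where
  map := Φ
  dom := I₀
  dom_subset := hI
  isMoveOn := h
  image_dom := rfl

theorem Reduction.image_inter_preimage_dom (ρ : Reduction σ I I') (ρ' : Reduction σ I' I'') :
    ρ.map.base '' (ρ.dom ∩ ρ.map.base ⁻¹' ρ'.dom) = ρ'.dom := by
  rw [image_inter_preimage, ρ.image_dom, inter_eq_right.2 ρ'.dom_subset]

/-- First `ρ`, then `ρ'`. -/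
def Reduction.trans (ρ : Reduction σ I I') (ρ' : Reduction σ I' I'') : Reduction σ I I'' where
  map := ρ'.map.comp ρ.map
  dom := ρ.dom ∩ ρ.map.base ⁻¹' ρ'.dom
  dom_subset := inter_subset_left.trans ρ.dom_subset
  isMoveOn := by
    have hdom := ρ.isMoveOn.isOpenInterval.inter_preimage ρ'.isMoveOn.isOpenInterval
      ρ.isMoveOn.contDiffOn_base ρ.isMoveOn.deriv_ne_zero (ρ.image_dom.symm ▸ ρ'.dom_subset)
    refine (ρ.isMoveOn.mono inter_subset_left hdom).comp ?_
    rw [ρ.image_inter_preimage_dom]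
    exact ρ'.isMoveOn
  image_dom := by
    rw [BlockMap.comp, image_comp, ρ.image_inter_preimage_dom, ρ'.image_dom]

theorem Reduction.isOpenInterval (ρ : Reduction σ I I') : IsOpenInterval I' :=
  ρ.image_dom ▸ ρ.isMoveOn.image

theorem Reduction.exists_sends (ρ : Reduction σ I I') (hA : ContDiffOn ℝ ∞ A I) :
    ∃ B, ρ.Sends A B := by
  obtain ⟨B, -, hB⟩ := ρ.isMoveOn.exists_pushes (hA.mono ρ.dom_subset)
  exact ⟨B, hA.mono ρ.dom_subset, hB⟩

variable {ρ : Reduction σ I I'}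

theorem Reduction.Sends.contDiffOn (h : ρ.Sends A B) : ContDiffOn ℝ ∞ B I' :=
  ρ.image_dom ▸ h.2.contDiffOn ρ.isMoveOn h.1

theorem Reduction.Sends.congr (h : ρ.Sends A₁ B₁) (hA : EqOn A₁ A₂ I) (hB : EqOn B₁ B₂ I') :
    ρ.Sends A₂ B₂ :=
  ⟨h.1.congr fun _ ht => (hA (ρ.dom_subset ht)).symm,
    (h.2.congr_left ρ.isMoveOn.isOpen (hA.mono ρ.dom_subset)).congr_right
      (ρ.image_dom.symm ▸ hB)⟩

theorem Reduction.Sends.congr_right (h : ρ.Sends A B₁) (hB : EqOn B₁ B₂ I') : ρ.Sends A B₂ :=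
  h.congr (eqOn_refl _ _) hB

theorem Reduction.Sends.eqOn (h₁ : ρ.Sends A₁ B₁) (h₂ : ρ.Sends A₂ B₂) (hA : EqOn A₁ A₂ I) :
    EqOn B₁ B₂ I' :=
  ρ.image_dom ▸ (h₁.congr hA (eqOn_refl _ _)).2.unique h₂.2

theorem Reduction.sends_zero (ρ : Reduction σ I I') : ρ.Sends 0 0 :=
  ⟨contDiffOn_const, BlockMap.pushes_zero⟩

theorem Reduction.Sends.add (h₁ : ρ.Sends A₁ B₁) (h₂ : ρ.Sends A₂ B₂) :
    ρ.Sends (A₁ + A₂) (B₁ + B₂) :=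
  ⟨h₁.1.add h₂.1, h₁.2.add ρ.isMoveOn h₁.1 h₂.1 h₂.2⟩

theorem Reduction.Sends.smul (h : ρ.Sends A B) (c : ℝ) : ρ.Sends (c • A) (c • B) :=
  ⟨contDiffOn_const.smul h.1, h.2.smul ρ.isMoveOn h.1 c⟩

theorem Reduction.Sends.bracket (h₁ : ρ.Sends A₁ B₁) (h₂ : ρ.Sends A₂ B₂) :
    ρ.Sends (bracket σ.weight A₁ A₂) (bracket σ.weight B₁ B₂) :=
  ⟨contDiffOn_bracket ρ.isMoveOn.isOpen _ h₁.1 h₂.1, h₁.2.bracket ρ.isMoveOn h₁.1 h₂.1 h₂.2⟩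

theorem Reduction.Sends.trans {ρ' : Reduction σ I' I''} (h : ρ.Sends A B) (h' : ρ'.Sends B C) :
    (ρ.trans ρ').Sends A C := by
  have hdom := (ρ.trans ρ').isMoveOn.isOpenInterval
  have himg : ρ.map.base '' (ρ.trans ρ').dom = ρ'.dom := ρ.image_inter_preimage_dom ρ'
  have hA : ContDiffOn ℝ ∞ A (ρ.trans ρ').dom := h.1.mono inter_subset_left
  refine ⟨hA, (h.2.mono inter_subset_left).comp (ρ.isMoveOn.mono inter_subset_left hdom) ?_ hA ?_⟩
  · rw [himg]; exact ρ'.isMoveOn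
  · rw [himg]; exact h'.2

theorem Reduction.Sends.fst_eq_zero (h : ρ.Sends A B) (hA : ∀ t ∈ I, (A t).1 = 0) :
    ∀ t ∈ I', (B t).1 = 0 := by
  rw [← ρ.image_dom]
  rintro _ ⟨t, ht, rfl⟩
  rw [h.2 t ht, BlockMap.push, hA t (ρ.dom_subset ht), mul_zero]

theorem Reduction.Sends.exists_eqOn_zero (h : ρ.Sends A B) (hI'' : IsOpenInterval I'')
    (hsub : I'' ⊆ I') (hB : EqOn B 0 I'') : ∃ I₁ ⊆ I, IsOpenInterval I₁ ∧ EqOn A 0 I₁ := by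
  have hdom := ρ.isMoveOn.isOpenInterval.inter_preimage hI'' ρ.isMoveOn.contDiffOn_base
    ρ.isMoveOn.deriv_ne_zero (ρ.image_dom.symm ▸ hsub)
  exact ⟨_, inter_subset_left.trans ρ.dom_subset, hdom, h.2.eqOn_zero ρ.isMoveOn h.1
    inter_subset_left hdom.isOpen fun t ht => hB ht.2⟩

theorem Reduction.Sends.density (h : ρ.Sends A B) (hA : ∀ t ∈ I, (A t).1 = 0) :
    ρ.Sends A (density fun t => (B t).2) :=
  h.congr_right fun t ht => Prod.ext (h.fst_eq_zero hA t ht) rfl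

theorem Reduction.Sends.zero_of_eqOn_zero (hA : EqOn A 0 I) : ρ.Sends A (affine 0 0 0) :=
  affine_zero ▸ ρ.sends_zero.congr hA.symm (eqOn_refl _ _)

end Reductions

section NormalForms

variable {σ : Block} {I : Set ℝ} {A A₁ A₂ : BlockField} {t : ℝ}

/-- The change of variable `T_t = s / f` and the shift `X_t = -m g / f` take `(f, g)` to `(s, 0)`;
the sign `s` makes `T_t` positive. -/
theorem exists_reduction_const_of_fst_ne_zero (hI : IsOpen I) (hA : ContDiffOn ℝ ∞ A I)
    (ht : t ∈ I) (h : (A t).1 ≠ 0) :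
    ∃ (s : ℝ) (I' : Set ℝ) (ρ : Reduction σ I I'), s ≠ 0 ∧ ρ.Sends A (affine s 0 0) := by
  obtain ⟨I₀, hsub, hI₀, hne⟩ :=
    exists_isOpenInterval_forall_ne_zero hI (contDiffOn_fst hA).continuousOn ht h
  replace hA := hA.mono hsub
  obtain ⟨s, hs, hpos⟩ : ∃ s : ℝ, s ≠ 0 ∧ ∀ t ∈ I₀, 0 < s / (A t).1 := by
    rcases forall_neg_or_forall_pos hI₀.isPreconnected (contDiffOn_fst hA).continuousOn hne
      with hneg | hpos
    · exact ⟨-1, by norm_num, fun t ht => div_pos_of_neg_of_neg (by norm_num) (hneg t ht)⟩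
    · exact ⟨1, one_ne_zero, fun t ht => div_pos one_pos (hpos t ht)⟩
  obtain ⟨T, hT, hT'⟩ := exists_hasDerivAt hI₀ (f := fun t => s / (A t).1)
    (contDiffOn_const.div (contDiffOn_fst hA) hne)
  obtain ⟨m, hm⟩ := σ.exists_isMultiplier (T := T) fun t ht => (hT' t ht).deriv ▸ hpos t ht
  obtain ⟨X, hX, hX'⟩ := exists_hasDerivAt hI₀ (f := fun t => -(m t * (A t).2 / (A t).1))
    (((hm.contDiffOn hI₀.isOpen hT).mul (contDiffOn_snd hA)).div (contDiffOn_fst hA) hne).neg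
  have hΦ : BlockMap.IsMoveOn σ I₀ ⟨T, m, X⟩ := ⟨hI₀, hT, hX, hm⟩
  refine ⟨s, _, hΦ.toReduction hsub, hs, hA, fun t ht => ?_⟩
  have hT'' := deriv_eq_of_eqOn hI₀.isOpen (fun t ht => (hT' t ht).deriv) ht
    ((hasDerivAt_const t s).div (hasDerivAt_fst hI₀.isOpen hA ht) (hne t ht))
  have hne := hne t ht
  simp only [BlockMap.IsMoveOn.toReduction, BlockMap.push, BlockMap.pushFstDeriv, affine, hT'',
    (hT' t ht).deriv, (hX' t ht).deriv]
  exact Prod.ext (by field_simp; ring) (by field_simp; ring)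

theorem exists_reduction_dilation_of_fst_ne_zero (hI : IsOpen I) (hA : ContDiffOn ℝ ∞ A I)
    (ht : t ∈ I) (h : (A t).1 ≠ 0) :
    ∃ (I' : Set ℝ) (ρ : Reduction σ I I'),
      (∀ t ∈ I', t ≠ 0) ∧ ρ.Sends A (affine 0 σ.weight⁻¹ 0) := by
  obtain ⟨s, I₁, ρ, hs, hA⟩ := exists_reduction_const_of_fst_ne_zero (σ := σ) hI hA ht h
  have hw := σ.weight_ne_zero
  let T : ℝ → ℝ := fun t => s * σ.weight * Real.exp (t / (s * σ.weight))
  have hT : ContDiffOn ℝ ∞ T I₁ :=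
    (contDiff_const.mul (Real.contDiff_exp.comp (contDiff_id.div_const _))).contDiffOn
  have hT' : deriv T = fun t => Real.exp (t / (s * σ.weight)) := by
    ext t
    refine (((((hasDerivAt_id t).div_const _).exp).const_mul _).congr_deriv ?_).deriv
    rw [mul_one_div, id, mul_div_cancel₀ _ (mul_ne_zero hs hw)]
  obtain ⟨m, hm⟩ := σ.exists_isMultiplier (I := I₁) (T := T) fun t _ => hT' ▸ Real.exp_pos _
  have hΦ : BlockMap.IsMoveOn σ I₁ ⟨T, m, fun _ => 0⟩ :=
    ⟨ρ.isOpenInterval, hT, contDiffOn_const, hm⟩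
  refine ⟨_, ρ.trans (hΦ.toReduction Subset.rfl), ?_,
    hA.trans ⟨contDiffOn_affine _ _ _, fun t _ => ?_⟩⟩
  · rintro _ ⟨t, -, rfl⟩
    exact mul_ne_zero (mul_ne_zero hs hw) (Real.exp_pos _).ne'
  · simp only [BlockMap.IsMoveOn.toReduction, BlockMap.push, affine, hT', deriv_const', mul_zero,
      zero_mul, add_zero, zero_add, sub_zero, T]
    exact Prod.ext (by field_simp) rfl

/-- The dilation of the variable under which second components are multiplied by `M`. -/
def Block.dilation : Block → ℝ → ℝ
  | .txu, M => M ^ 2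
  | .yv, M => 1 / M

theorem isMultiplier_dilation (I : Set ℝ) {M : ℝ} (hM : M ≠ 0) :
    σ.IsMultiplier I (fun t => σ.dilation M * t) fun _ => M := by
  have hd : deriv (fun t => σ.dilation M * t) = fun _ => σ.dilation M := by ext; simp
  cases σ with
  | txu =>
    refine ⟨SignType.sign M, ?_, fun t _ => ?_⟩
    · rcases hM.lt_or_gt with h | h <;> simp [h]
    · rw [hd, Block.dilation, Real.sqrt_sq_eq_abs, sign_mul_abs]
      exact ⟨by positivity, rfl⟩
  | yv =>
    intro t _
    rw [hd, Block.dilation, one_div_one_div]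
    exact ⟨one_div_ne_zero hM, rfl⟩

theorem exists_reduction_dilate (hI : IsOpenInterval I) {M : ℝ} (hM : M ≠ 0) :
    ∃ (I' : Set ℝ) (ρ : Reduction σ I I'),
      ∀ p q r : ℝ, ρ.Sends (affine p q r) (affine (σ.dilation M * p) q (M * r)) := by
  have hd : deriv (fun t => σ.dilation M * t) = fun _ => σ.dilation M := by ext; simp
  have hΦ : BlockMap.IsMoveOn σ I ⟨fun t => σ.dilation M * t, fun _ => M, fun _ => 0⟩ :=
    ⟨hI, by fun_prop, contDiffOn_const, isMultiplier_dilation I hM⟩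
  refine ⟨_, hΦ.toReduction Subset.rfl, fun p q r => ⟨contDiffOn_affine _ _ _, fun t _ => ?_⟩⟩
  simp only [BlockMap.IsMoveOn.toReduction, BlockMap.push, affine, hd, deriv_const', mul_zero,
    zero_mul, add_zero, sub_zero]
  exact Prod.ext (by ring) rfl

theorem exists_mul_eq_zero_or_one (c : ℝ) : ∃ M : ℝ, M ≠ 0 ∧ ∃ δ : Fin 2, M * c = (δ.val : ℝ) := by
  rcases eq_or_ne c 0 with rfl | hc
  · exact ⟨1, one_ne_zero, 0, by simp⟩
  · exact ⟨c⁻¹, inv_ne_zero hc, 1, by simp [hc]⟩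

theorem exists_isMultiplier_mul_eq_one {g : ℝ → ℝ} (hI : IsOpenInterval I)
    (hg : ContDiffOn ℝ ∞ g I) (h : ∀ t ∈ I, g t ≠ 0) :
    ∃ T m, ContDiffOn ℝ ∞ T I ∧ σ.IsMultiplier I T m ∧ ∀ t ∈ I, m t * g t = 1 := by
  cases σ with
  | txu =>
    obtain ⟨T, hT, hT'⟩ := exists_hasDerivAt hI (f := fun t => (g t)⁻¹ ^ 2) ((hg.inv h).pow 2)
    obtain ⟨ε, hε, habs⟩ : ∃ ε : ℝ, (ε = 1 ∨ ε = -1) ∧ ∀ t ∈ I, |(g t)⁻¹| = ε * (g t)⁻¹ := by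
      rcases forall_neg_or_forall_pos hI.isPreconnected hg.continuousOn h with hneg | hpos
      · refine ⟨-1, Or.inr rfl, fun t ht => ?_⟩
        rw [abs_of_neg (inv_lt_zero.2 (hneg t ht)), neg_one_mul]
      · refine ⟨1, Or.inl rfl, fun t ht => ?_⟩
        rw [abs_of_pos (inv_pos.2 (hpos t ht)), one_mul]
    have hεε : ε * ε = 1 := by rcases hε with rfl | rfl <;> norm_num
    refine ⟨T, fun t => (g t)⁻¹, hT, ⟨ε, hε, fun t ht => ?_⟩, fun t ht => inv_mul_cancel₀ (h t ht)⟩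
    rw [(hT' t ht).deriv, Real.sqrt_sq_eq_abs, habs t ht, ← mul_assoc, hεε, one_mul]
    exact ⟨by have := h t ht; positivity, rfl⟩
  | yv =>
    obtain ⟨T, hT, hT'⟩ := exists_hasDerivAt hI hg
    refine ⟨T, fun t => 1 / g t, hT, fun t ht => ?_, fun t ht => one_div_mul_cancel (h t ht)⟩
    rw [(hT' t ht).deriv]
    exact ⟨h t ht, rfl⟩

theorem exists_reduction_zero_one (hI : IsOpen I) (hA : ContDiffOn ℝ ∞ A I)
    (hfst : ∀ t ∈ I, (A t).1 = 0) (ht : t ∈ I) (h : (A t).2 ≠ 0) :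
    ∃ (I' : Set ℝ) (ρ : Reduction σ I I'), ρ.Sends A (affine 0 0 1) := by
  obtain ⟨I₀, hsub, hI₀, hne⟩ :=
    exists_isOpenInterval_forall_ne_zero hI (contDiffOn_snd hA).continuousOn ht h
  obtain ⟨T, m, hT, hm, hmA⟩ :=
    exists_isMultiplier_mul_eq_one (σ := σ) hI₀ (contDiffOn_snd (hA.mono hsub)) hne
  have hΦ : BlockMap.IsMoveOn σ I₀ ⟨T, m, fun _ => 0⟩ := ⟨hI₀, hT, contDiffOn_const, hm⟩
  refine ⟨_, hΦ.toReduction hsub, hA.mono hsub, fun t ht => ?_⟩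
  simp [BlockMap.IsMoveOn.toReduction, BlockMap.push, affine, hfst t (hsub ht), hmA t ht]

theorem exists_reduction_density (hI : IsOpen I) (h₁ : ContDiffOn ℝ ∞ A₁ I)
    (h₂ : ContDiffOn ℝ ∞ A₂ I) (hfst₁ : ∀ t ∈ I, (A₁ t).1 = 0) (hfst₂ : ∀ t ∈ I, (A₂ t).1 = 0)
    (ht : t ∈ I) (h : (A₁ t).2 ≠ 0) : ∃ (I' : Set ℝ) (ρ : Reduction σ I I') (f : ℝ → ℝ),
      ContDiffOn ℝ ∞ f I' ∧ ρ.Sends A₁ (affine 0 0 1) ∧ ρ.Sends A₂ (density f) := by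
  obtain ⟨I', ρ, hρ⟩ := exists_reduction_zero_one (σ := σ) hI h₁ hfst₁ ht h
  obtain ⟨B, hB⟩ := ρ.exists_sends h₂
  exact ⟨I', ρ, _, contDiffOn_snd hB.contDiffOn, hρ, hB.density hfst₂⟩

theorem isMoveOn_add_const (hI : IsOpenInterval I) (c e : ℝ) :
    BlockMap.IsMoveOn σ I ⟨fun t => t + c, fun _ => 1, fun _ => e⟩ := by
  refine ⟨hI, by fun_prop, contDiffOn_const, ?_⟩
  cases σ with
  | txu => exact ⟨1, Or.inl rfl, fun t _ => by simp⟩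
  | yv => exact fun t _ => by simp

theorem exists_reduction_translate (hI : IsOpenInterval I) (c e : ℝ) :
    ∃ (I' : Set ℝ) (ρ : Reduction σ I I'),
      (∀ s : ℝ, ρ.Sends (affine s 0 0) (affine s 0 0)) ∧
        ρ.Sends (affine c 1 e) (affine 0 1 0) := by
  have hd : deriv (fun t : ℝ => t + c) = fun _ => 1 := by ext; simp
  refine ⟨_, (isMoveOn_add_const hI c (e / σ.weight)).toReduction Subset.rfl,
    fun s => ⟨contDiffOn_affine _ _ _, fun t _ => ?_⟩, contDiffOn_affine _ _ _, fun t _ => ?_⟩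
  · simp [BlockMap.IsMoveOn.toReduction, BlockMap.push, BlockMap.pushFstDeriv, deriv_affine,
      affine, hd]
  · have := σ.weight_ne_zero
    simp only [BlockMap.IsMoveOn.toReduction, BlockMap.push, BlockMap.pushFstDeriv,
      deriv_affine, affine, hd, deriv_const']
    exact Prod.ext (by ring) (by field_simp; ring)

theorem exists_reduction_of_fst_eq_zero (hI : IsOpenInterval I) (hA : ContDiffOn ℝ ∞ A I)
    (hfst : ∀ t ∈ I, (A t).1 = 0) :
    ∃ (δ : Fin 2) (I' : Set ℝ) (ρ : Reduction σ I I'), ρ.Sends A (affine 0 0 δ.val) := by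
  by_cases h : ∃ t ∈ I, (A t).2 ≠ 0
  · obtain ⟨t, ht, h⟩ := h
    obtain ⟨I', ρ, hρ⟩ := exists_reduction_zero_one (σ := σ) hI.isOpen hA hfst ht h
    exact ⟨1, I', ρ, by simpa using hρ⟩
  · push Not at h
    let ρ := (isMoveOn_add_const (σ := σ) hI 0 0).toReduction Subset.rfl
    refine ⟨0, _, ρ, ρ.sends_zero.congr (fun t ht => ?_) fun t _ => by simp [affine_zero]⟩
    exact (Prod.ext (hfst t ht) (h t ht)).symm

theorem exists_reduction_of_bracket_eq_left (hI : IsOpen I)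
    (h₁ : ContDiffOn ℝ ∞ A₁ I) (h₂ : ContDiffOn ℝ ∞ A₂ I)
    (hb : EqOn (bracket σ.weight A₁ A₂) A₁ I) (ht : t ∈ I) (h : (A₁ t).1 ≠ 0) :
    ∃ (s : ℝ) (I' : Set ℝ) (ρ : Reduction σ I I'), s ≠ 0 ∧
      ρ.Sends A₁ (affine s 0 0) ∧ ρ.Sends A₂ (affine 0 1 0) := by
  obtain ⟨s, I₁, ρ, hs, hA₁⟩ := exists_reduction_const_of_fst_ne_zero (σ := σ) hI h₁ ht h
  obtain ⟨B, hA₂⟩ := ρ.exists_sends h₂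
  have hB' : ∀ t ∈ I₁, deriv B t = affine 1 0 0 t := fun t ht => by
    have hbr := (hA₁.bracket hA₂).eqOn hA₁ hb ht
    rw [bracket_const_left] at hbr
    have := congrArg (s⁻¹ • ·) hbr
    simpa [affine, hs] using this
  obtain ⟨⟨c, e⟩, hc⟩ := exists_eqOn_const_of_hasDerivAt_zero ρ.isOpenInterval
    (A := B - affine 0 1 0) fun t ht => by
      refine ((hasDerivAt_of_contDiffOn ρ.isOpenInterval.isOpen hA₂.contDiffOn ht).sub
        (hasDerivAt_affine 0 1 0 t)).congr_deriv ?_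
      rw [hB' t ht, sub_self]
  obtain ⟨I', ρ', hconst, hlin⟩ := exists_reduction_translate (σ := σ) ρ.isOpenInterval c e
  refine ⟨s, I', ρ.trans ρ', hs, hA₁.trans (hconst s), (hA₂.congr_right fun t ht => ?_).trans hlin⟩
  rw [sub_eq_iff_eq_add.1 (hc ht)]
  simp [affine]

theorem exists_reduction_of_bracket_eq_left_of_fst_eq_zero (hI : IsOpen I)
    (h₁ : ContDiffOn ℝ ∞ A₁ I) (h₂ : ContDiffOn ℝ ∞ A₂ I)
    (hb : EqOn (bracket σ.weight A₁ A₂) A₁ I) (hfst : ∀ t ∈ I, (A₁ t).1 = 0) (ht : t ∈ I)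
    (h : (A₂ t).1 ≠ 0) :
    ∃ (δ : Fin 2) (I' : Set ℝ) (ρ : Reduction σ I I'),
      ρ.Sends A₁ (affine 0 0 δ.val) ∧ ρ.Sends A₂ (affine 0 σ.weight⁻¹ 0) := by
  have hw := σ.weight_ne_zero
  obtain ⟨I₁, ρ, hne, hA₂⟩ := exists_reduction_dilation_of_fst_ne_zero (σ := σ) hI h₂ ht h
  obtain ⟨B, hA₁⟩ := ρ.exists_sends h₁
  have hI₁ := ρ.isOpenInterval
  have hBfst := hA₁.fst_eq_zero hfst
  have hB' : ∀ t ∈ I₁, deriv B t = 0 := fun t ht => by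
    have hfst' : (deriv B t).1 = 0 :=
      (hasDerivAt_fst hI₁.isOpen hA₁.contDiffOn ht).deriv.symm.trans
        (deriv_eq_of_eqOn hI₁.isOpen hBfst ht (hasDerivAt_const t 0))
    have hbr := congrArg Prod.snd ((hA₁.bracket hA₂).eqOn hA₁ hb ht)
    simp only [bracket, hBfst t ht, hfst', deriv_affine, affine] at hbr
    have hne := hne t ht
    refine Prod.ext hfst' (mul_left_cancel₀ hne ?_)
    field_simp at hbr
    simp only [Prod.snd_zero]
    linear_combination -hbr
  obtain ⟨c, hc⟩ := exists_eqOn_const_of_hasDerivAt_zero hI₁ fun t ht =>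
    (hasDerivAt_of_contDiffOn hI₁.isOpen hA₁.contDiffOn ht).congr_deriv (hB' t ht)
  obtain ⟨M, hM, δ, hδ⟩ := exists_mul_eq_zero_or_one c.2
  obtain ⟨I', ρ', hρ'⟩ := exists_reduction_dilate (σ := σ) hI₁ hM
  have hconst : EqOn B (affine 0 0 c.2) I₁ := fun t ht =>
    Prod.ext ((hBfst t ht).trans (by simp [affine])) (by rw [hc ht, affine])
  refine ⟨δ, I', ρ.trans ρ', ?_, ?_⟩
  · simpa only [mul_zero, hδ] using (hA₁.congr_right hconst).trans (hρ' 0 0 c.2)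
  · simpa only [mul_zero] using hA₂.trans (hρ' 0 σ.weight⁻¹ 0)

theorem eqOn_zero_of_bracket_eq_left (hI : IsOpen I) (h₁ : ContDiffOn ℝ ∞ A₁ I)
    (h₂ : ContDiffOn ℝ ∞ A₂ I) {k : ℝ} (hb : EqOn (bracket k A₁ A₂) A₁ I)
    (hfst₁ : ∀ t ∈ I, (A₁ t).1 = 0) (hfst₂ : ∀ t ∈ I, (A₂ t).1 = 0) : EqOn A₁ 0 I := by
  intro t ht
  have hd₁ : (deriv A₁ t).1 = 0 := (hasDerivAt_fst hI h₁ ht).deriv.symm.trans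
    (deriv_eq_of_eqOn hI hfst₁ ht (hasDerivAt_const t 0))
  have hd₂ : (deriv A₂ t).1 = 0 := (hasDerivAt_fst hI h₂ ht).deriv.symm.trans
    (deriv_eq_of_eqOn hI hfst₂ ht (hasDerivAt_const t 0))
  rw [← hb ht]
  simp [bracket, hfst₁ t ht, hfst₂ t ht, hd₁, hd₂]

theorem exists_reduction_const_of_bracket_eq_zero (hI : IsOpen I)
    (h₁ : ContDiffOn ℝ ∞ A₁ I) (h₂ : ContDiffOn ℝ ∞ A₂ I)
    (hb : EqOn (bracket σ.weight A₁ A₂) 0 I) (ht : t ∈ I) (h : (A₁ t).1 ≠ 0) :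
    ∃ (s p r : ℝ) (I' : Set ℝ) (ρ : Reduction σ I I'), s ≠ 0 ∧
      ρ.Sends A₁ (affine s 0 0) ∧ ρ.Sends A₂ (affine p 0 r) := by
  obtain ⟨s, I', ρ, hs, hA₁⟩ := exists_reduction_const_of_fst_ne_zero (σ := σ) hI h₁ ht h
  obtain ⟨B, hA₂⟩ := ρ.exists_sends h₂
  have hbr := (hA₁.bracket hA₂).eqOn ρ.sends_zero hb
  rw [bracket_const_left] at hbr
  obtain ⟨c, hc⟩ := exists_eqOn_const_of_hasDerivAt_zero ρ.isOpenInterval fun t ht =>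
    (hasDerivAt_of_contDiffOn ρ.isOpenInterval.isOpen hA₂.contDiffOn ht).congr_deriv
      ((smul_eq_zero.1 (hbr ht)).resolve_left hs)
  exact ⟨s, c.1, c.2, I', ρ, hs, hA₁, hA₂.congr_right fun t ht => by simp [hc ht, affine]⟩

theorem exists_reduction_const_of_bracket_eq_zero_of_fst_eq_zero (hI : IsOpen I)
    (h₁ : ContDiffOn ℝ ∞ A₁ I) (h₂ : ContDiffOn ℝ ∞ A₂ I)
    (hb : EqOn (bracket σ.weight A₁ A₂) 0 I) (ht : t ∈ I) (h : (A₁ t).1 ≠ 0)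
    (hfst : ∀ t ∈ I, (A₂ t).1 = 0) :
    ∃ (s r : ℝ) (I' : Set ℝ) (ρ : Reduction σ I I'), s ≠ 0 ∧
      ρ.Sends A₁ (affine s 0 0) ∧ ρ.Sends A₂ (affine 0 0 r) := by
  obtain ⟨s, p, r, I', ρ, hs, hA₁, hA₂⟩ :=
    exists_reduction_const_of_bracket_eq_zero (σ := σ) hI h₁ h₂ hb ht h
  obtain ⟨t, ht⟩ := ρ.isOpenInterval.nonempty
  obtain rfl : p = 0 := by simpa [affine] using hA₂.fst_eq_zero hfst t ht
  exact ⟨s, r, I', ρ, hs, hA₁, hA₂⟩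

theorem exists_reduction_smul_add_fst_eq_zero (hI : IsOpen I) (h₁ : ContDiffOn ℝ ∞ A₁ I)
    (h₂ : ContDiffOn ℝ ∞ A₂ I) (hb : EqOn (bracket σ.weight A₁ A₂) 0 I) (ht : t ∈ I)
    (h : (A₁ t).1 ≠ 0) :
    ∃ (c : ℝ) (I' : Set ℝ) (ρ : Reduction σ I I') (B₁ B₂ : BlockField),
      ρ.Sends A₁ B₁ ∧ ρ.Sends A₂ B₂ ∧ (∃ t ∈ I', (B₁ t).1 ≠ 0) ∧
        ∀ t ∈ I', ((c • B₁ + B₂) t).1 = 0 := by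
  obtain ⟨s, p, r, I', ρ, hs, hA₁, hA₂⟩ :=
    exists_reduction_const_of_bracket_eq_zero (σ := σ) hI h₁ h₂ hb ht h
  obtain ⟨t, ht⟩ := ρ.isOpenInterval.nonempty
  refine ⟨-(p / s), I', ρ, _, _, hA₁, hA₂, ⟨t, ht, by simpa [affine] using hs⟩, fun t _ => ?_⟩
  simp [affine, hs]

end NormalForms

/-- A pair of block fields, in `(t, x, u)` and in `(y, v)`: the components of an element of `𝔤`. -/
abbrev FieldPair := BlockField × BlockField

/-- Both block fields of the pair are smooth. -/
def FieldPair.IsSmoothOn (I J : Set ℝ) (F : FieldPair) : Prop :=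
  ContDiffOn ℝ ∞ F.1 I ∧ ContDiffOn ℝ ∞ F.2 J

/-- The Lie bracket of `𝔤`, on components. -/
def FieldPair.bracket (F G : FieldPair) : FieldPair :=
  (BLP.bracket Block.txu.weight F.1 G.1, BLP.bracket Block.yv.weight F.2 G.2)

/-- The element of `𝔤` with the components `F`. -/
def vectorField (I J : Set ℝ) (F : FieldPair) : Pt → Pt :=
  D I J (fun t => (F.1 t).1) + P I J (fun t => (F.1 t).2) + S I J (fun y => (F.2 y).1) +
    Z I J (fun y => (F.2 y).2)

section VectorFields

variable {I J I' J' : Set ℝ} {F G : FieldPair} {p : Pt} {V : Pt → Pt}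

theorem isOpen_strip (hI : IsOpen I) (hJ : IsOpen J) : IsOpen (strip I J) :=
  (hI.preimage (continuous_apply 0)).inter (hJ.preimage (continuous_apply 2))

theorem restrictTo_apply_of_mem {Ω : Set Pt} (hp : p ∈ Ω) (V : Pt → Pt) : restrictTo Ω V p = V p :=
  indicator_of_mem hp V

theorem restrictTo_apply_of_notMem {Ω : Set Pt} (hp : p ∉ Ω) (V : Pt → Pt) :
    restrictTo Ω V p = 0 :=
  indicator_of_notMem hp V

theorem restrictTo_restrictTo {Ω Ω' : Set Pt} (h : Ω' ⊆ Ω) (V : Pt → Pt) :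
    restrictTo Ω' (restrictTo Ω V) = restrictTo Ω' V := by
  change Ω'.indicator (Ω.indicator V) = Ω'.indicator V
  rw [indicator_indicator, inter_eq_left.2 h]

theorem pt_ext {v w : Pt} (h0 : v 0 = w 0) (h1 : v 1 = w 1) (h2 : v 2 = w 2) (h3 : v 3 = w 3)
    (h4 : v 4 = w 4) : v = w := by
  funext i
  fin_cases i <;> assumption

theorem D_zero : D I J (fun _ => 0) = 0 := by
  rw [D, ← map_zero (restrictTo (strip I J))]
  congr 1
  funext p
  apply pt_ext <;> simp

theorem P_zero : P I J (fun _ => 0) = 0 := by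
  rw [P, ← map_zero (restrictTo (strip I J))]
  congr 1
  funext p
  apply pt_ext <;> simp

theorem S_zero : S I J (fun _ => 0) = 0 := by
  rw [S, ← map_zero (restrictTo (strip I J))]
  congr 1
  funext p
  apply pt_ext <;> simp

theorem Z_zero : Z I J (fun _ => 0) = 0 := by
  rw [Z, ← map_zero (restrictTo (strip I J))]
  congr 1
  funext p
  apply pt_ext <;> simp

theorem FieldPair.IsSmoothOn.mono (h : F.IsSmoothOn I J) (hI : I' ⊆ I) (hJ : J' ⊆ J) :
    F.IsSmoothOn I' J' :=
  ⟨h.1.mono hI, h.2.mono hJ⟩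

theorem FieldPair.IsSmoothOn.add (hF : F.IsSmoothOn I J) (hG : G.IsSmoothOn I J) :
    (F + G).IsSmoothOn I J :=
  ⟨hF.1.add hG.1, hF.2.add hG.2⟩

theorem FieldPair.IsSmoothOn.smul (hF : F.IsSmoothOn I J) (c : ℝ) : (c • F).IsSmoothOn I J :=
  ⟨contDiffOn_const.smul hF.1, contDiffOn_const.smul hF.2⟩

theorem FieldPair.IsSmoothOn.bracket (hI : IsOpen I) (hJ : IsOpen J) (hF : F.IsSmoothOn I J)
    (hG : G.IsSmoothOn I J) : (F.bracket G).IsSmoothOn I J :=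
  ⟨contDiffOn_bracket hI _ hF.1 hG.1, contDiffOn_bracket hJ _ hF.2 hG.2⟩

/-- The value of `vectorField I J F` on the strip, for smooth `F`. -/
def FieldPair.value (F : FieldPair) (p : Pt) : Pt :=
  ![(F.1 (p 0)).1, 1 / 2 * (deriv F.1 (p 0)).1 * p 1 + (F.1 (p 0)).2, (F.2 (p 2)).1,
    -(1 / 2 * (deriv F.1 (p 0)).1 * p 3 + 1 / 4 * (deriv (deriv F.1) (p 0)).1 * p 1)
      - 1 / 2 * (deriv F.1 (p 0)).2,
    -((deriv F.2 (p 2)).1 * p 4) + (F.2 (p 2)).2]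

theorem vectorField_apply (hI : IsOpen I) (hJ : IsOpen J) (hF : F.IsSmoothOn I J)
    (hp : p ∈ strip I J) : vectorField I J F p = F.value p := by
  have hfst : ∀ t ∈ I, deriv (fun t => (F.1 t).1) t = (deriv F.1 t).1 :=
    fun t ht => (hasDerivAt_fst hI hF.1 ht).deriv
  have hfst' := deriv_eq_of_eqOn hI hfst hp.1 (hasDerivAt_fst hI (contDiffOn_deriv hI hF.1) hp.1)
  have hsnd := (hasDerivAt_snd hI hF.1 hp.1).deriv
  have hS := (hasDerivAt_fst hJ hF.2 hp.2).deriv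
  simp only [vectorField, D, P, S, Z, Pi.add_apply, restrictTo_apply_of_mem hp, hfst', hfst _ hp.1,
    hsnd, hS]
  apply pt_ext <;> simp [FieldPair.value]
  ring

theorem vectorField_apply_of_notMem (hp : p ∉ strip I J) : vectorField I J F p = 0 := by
  simp [vectorField, D, P, S, Z, restrictTo_apply_of_notMem hp]

theorem eq_vectorField (hI : IsOpen I) (hJ : IsOpen J) (hF : F.IsSmoothOn I J)
    (h : ∀ p ∈ strip I J, V p = F.value p) (h' : ∀ p ∉ strip I J, V p = 0) :
    V = vectorField I J F := by
  funext p
  by_cases hp : p ∈ strip I J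
  · rw [vectorField_apply hI hJ hF hp, h p hp]
  · rw [vectorField_apply_of_notMem hp, h' p hp]

theorem restrictTo_vectorField (hI : I' ⊆ I) (hJ : J' ⊆ J) :
    restrictTo (strip I' J') (vectorField I J F) = vectorField I' J' F := by
  have h : strip I' J' ⊆ strip I J := fun p hp => ⟨hI hp.1, hJ hp.2⟩
  simp only [vectorField, D, P, S, Z, map_add, restrictTo_restrictTo h]

theorem vectorField_zero : vectorField I J 0 = 0 := by
  simp [vectorField, D_zero, P_zero, S_zero, Z_zero]

theorem vectorField_add (hI : IsOpen I) (hJ : IsOpen J) (hF : F.IsSmoothOn I J)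
    (hG : G.IsSmoothOn I J) : vectorField I J (F + G) = vectorField I J F + vectorField I J G := by
  refine (eq_vectorField hI hJ (hF.add hG) (fun p hp => ?_) fun p hp => ?_).symm
  · have hadd : ∀ t ∈ I, deriv (F.1 + G.1) t = deriv F.1 t + deriv G.1 t := fun t ht =>
      ((hasDerivAt_of_contDiffOn hI hF.1 ht).add (hasDerivAt_of_contDiffOn hI hG.1 ht)).deriv
    have hadd' := deriv_eq_of_eqOn hI hadd hp.1
      ((hasDerivAt_of_contDiffOn hI (contDiffOn_deriv hI hF.1) hp.1).add
        (hasDerivAt_of_contDiffOn hI (contDiffOn_deriv hI hG.1) hp.1))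
    have haddY := ((hasDerivAt_of_contDiffOn hJ hF.2 hp.2).add
      (hasDerivAt_of_contDiffOn hJ hG.2 hp.2)).deriv
    rw [Pi.add_apply, vectorField_apply hI hJ hF hp, vectorField_apply hI hJ hG hp]
    simp only [FieldPair.value, Prod.fst_add, Prod.snd_add, hadd _ hp.1, hadd', haddY, Pi.add_apply]
    apply pt_ext <;> simp <;> ring
  · rw [Pi.add_apply, vectorField_apply_of_notMem hp, vectorField_apply_of_notMem hp, add_zero]

theorem vectorField_smul (hI : IsOpen I) (hJ : IsOpen J) (hF : F.IsSmoothOn I J) (c : ℝ) :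
    vectorField I J (c • F) = c • vectorField I J F := by
  refine (eq_vectorField hI hJ (hF.smul c) (fun p hp => ?_) fun p hp => ?_).symm
  · have hsmul : ∀ t ∈ I, deriv (c • F.1) t = c • deriv F.1 t := fun t ht =>
      ((hasDerivAt_of_contDiffOn hI hF.1 ht).const_smul c).deriv
    have hsmul' := deriv_eq_of_eqOn hI hsmul hp.1
      ((hasDerivAt_of_contDiffOn hI (contDiffOn_deriv hI hF.1) hp.1).const_smul c)
    have hsmulY := ((hasDerivAt_of_contDiffOn hJ hF.2 hp.2).const_smul c).deriv
    rw [Pi.smul_apply, vectorField_apply hI hJ hF hp]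
    simp only [FieldPair.value, Prod.smul_fst, Prod.smul_snd, hsmul _ hp.1, hsmul', hsmulY,
      Pi.smul_apply]
    apply pt_ext <;> simp <;> ring
  · rw [Pi.smul_apply, vectorField_apply_of_notMem hp, smul_zero]

theorem FieldPair.eqOn_of_value_eq (hI : IsOpenInterval I) (hJ : IsOpenInterval J)
    (h : ∀ p ∈ strip I J, F.value p = G.value p) : EqOn F.1 G.1 I ∧ EqOn F.2 G.2 J := by
  obtain ⟨t₀, ht₀⟩ := hI.nonempty
  obtain ⟨y₀, hy₀⟩ := hJ.nonempty
  constructor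
  · intro t ht
    have hval := h ![t, 0, y₀, 0, 0] ⟨ht, hy₀⟩
    exact Prod.ext (by simpa [value] using congr_fun hval 0)
      (by simpa [value] using congr_fun hval 1)
  · intro y hy
    have hval := h ![t₀, 0, y, 0, 0] ⟨ht₀, hy⟩
    exact Prod.ext (by simpa [value] using congr_fun hval 2)
      (by simpa [value] using congr_fun hval 4)

theorem vectorField_eq_iff (hI : IsOpenInterval I) (hJ : IsOpenInterval J)
    (hF : F.IsSmoothOn I J) (hG : G.IsSmoothOn I J) :
    vectorField I J F = vectorField I J G ↔ EqOn F.1 G.1 I ∧ EqOn F.2 G.2 J := by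
  constructor
  · refine fun h => FieldPair.eqOn_of_value_eq hI hJ fun p hp => ?_
    rw [← vectorField_apply hI.isOpen hJ.isOpen hF hp, h,
      vectorField_apply hI.isOpen hJ.isOpen hG hp]
  · rintro ⟨h₁, h₂⟩
    refine eq_vectorField hI.isOpen hJ.isOpen hG (fun p hp => ?_)
      fun p hp => vectorField_apply_of_notMem hp
    have hd : EqOn (deriv F.1) (deriv G.1) I := fun t ht =>
      deriv_eq_of_eqOn hI.isOpen h₁ ht (hasDerivAt_of_contDiffOn hI.isOpen hG.1 ht)
    rw [vectorField_apply hI.isOpen hJ.isOpen hF hp, FieldPair.value, FieldPair.value, h₁ hp.1,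
      h₂ hp.2, hd hp.1, deriv_eq_of_eqOn hI.isOpen hd hp.1
        (hasDerivAt_of_contDiffOn hI.isOpen (contDiffOn_deriv hI.isOpen hG.1) hp.1),
      deriv_eq_of_eqOn hJ.isOpen h₂ hp.2 (hasDerivAt_of_contDiffOn hJ.isOpen hG.2 hp.2)]

theorem mem_symAlgebra_iff (hI : IsOpen I) (hJ : IsOpen J) :
    V ∈ symAlgebra I J ↔ ∃ F : FieldPair, F.IsSmoothOn I J ∧ V = vectorField I J F := by
  constructor
  · intro hV
    induction hV using Submodule.span_induction with
    | mem V hV =>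
      rcases hV with ((⟨f, hf, rfl⟩ | ⟨f, hf, rfl⟩) | ⟨f, hf, rfl⟩) | ⟨f, hf, rfl⟩
      · exact ⟨(fun t => (f t, 0), 0), ⟨hf.prodMk contDiffOn_const, contDiffOn_const⟩,
          by simp [vectorField, P_zero, S_zero, Z_zero]⟩
      · exact ⟨(0, fun y => (f y, 0)), ⟨contDiffOn_const, hf.prodMk contDiffOn_const⟩,
          by simp [vectorField, D_zero, P_zero, Z_zero]⟩
      · exact ⟨(fun t => (0, f t), 0), ⟨contDiffOn_const.prodMk hf, contDiffOn_const⟩,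
          by simp [vectorField, D_zero, S_zero, Z_zero]⟩
      · exact ⟨(0, fun y => (0, f y)), ⟨contDiffOn_const, contDiffOn_const.prodMk hf⟩,
          by simp [vectorField, D_zero, P_zero, S_zero]⟩
    | zero => exact ⟨0, ⟨contDiffOn_const, contDiffOn_const⟩, vectorField_zero.symm⟩
    | add V W _ _ hV hW =>
      obtain ⟨F, hF, rfl⟩ := hV
      obtain ⟨G, hG, rfl⟩ := hW
      exact ⟨F + G, hF.add hG, (vectorField_add hI hJ hF hG).symm⟩
    | smul c V _ hV =>
      obtain ⟨F, hF, rfl⟩ := hV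
      exact ⟨c • F, hF.smul c, (vectorField_smul hI hJ hF c).symm⟩
  · rintro ⟨F, hF, rfl⟩
    refine add_mem (add_mem (add_mem ?_ ?_) ?_) ?_ <;> refine Submodule.subset_span ?_
    · exact Or.inl (Or.inl (Or.inl ⟨_, contDiffOn_fst hF.1, rfl⟩))
    · exact Or.inl (Or.inr ⟨_, contDiffOn_snd hF.1, rfl⟩)
    · exact Or.inl (Or.inl (Or.inr ⟨_, contDiffOn_fst hF.2, rfl⟩))
    · exact Or.inr ⟨_, contDiffOn_snd hF.2, rfl⟩

end VectorFields

section LieBracket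

variable {I J : Set ℝ} {A B : BlockField} {F G : FieldPair} {p : Pt} {t k : ℝ}

theorem hasFDerivAt_comp_coord {f : ℝ → ℝ} {f' : ℝ} (i : Fin 5) (hf : HasDerivAt f f' (p i)) :
    HasFDerivAt (fun q : Pt => f (q i))
      (f' • ContinuousLinearMap.proj (R := ℝ) (φ := fun _ => ℝ) i) p :=
  hf.comp_hasFDerivAt p (hasFDerivAt_apply i p)

theorem fderiv_apply_of_hasFDerivAt {V : Pt → Pt} {L : Fin 5 → (Pt →L[ℝ] ℝ)}
    (h0 : HasFDerivAt (fun q => V q 0) (L 0) p) (h1 : HasFDerivAt (fun q => V q 1) (L 1) p)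
    (h2 : HasFDerivAt (fun q => V q 2) (L 2) p) (h3 : HasFDerivAt (fun q => V q 3) (L 3) p)
    (h4 : HasFDerivAt (fun q => V q 4) (L 4) p) (w : Pt) :
    fderiv ℝ V p w = ![L 0 w, L 1 w, L 2 w, L 3 w, L 4 w] := by
  have hV : HasFDerivAt V (ContinuousLinearMap.pi L) p := by
    rw [hasFDerivAt_pi]
    intro i
    fin_cases i <;> assumption
  rw [hV.fderiv]
  apply pt_ext <;> rfl

theorem fderiv_vectorField (hI : IsOpen I) (hJ : IsOpen J) (hF : F.IsSmoothOn I J)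
    (hp : p ∈ strip I J) (w : Pt) :
    fderiv ℝ (vectorField I J F) p w =
      ![(deriv F.1 (p 0)).1 * w 0,
        1 / 2 * (deriv (deriv F.1) (p 0)).1 * w 0 * p 1 + 1 / 2 * (deriv F.1 (p 0)).1 * w 1 +
          (deriv F.1 (p 0)).2 * w 0,
        (deriv F.2 (p 2)).1 * w 2,
        -(1 / 2 * (deriv (deriv F.1) (p 0)).1 * w 0 * p 3 + 1 / 2 * (deriv F.1 (p 0)).1 * w 3 +
          1 / 4 * (deriv (deriv (deriv F.1)) (p 0)).1 * w 0 * p 1 +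
          1 / 4 * (deriv (deriv F.1) (p 0)).1 * w 1) -
            1 / 2 * (deriv (deriv F.1) (p 0)).2 * w 0,
        -((deriv (deriv F.2) (p 2)).1 * w 2 * p 4 + (deriv F.2 (p 2)).1 * w 4) +
          (deriv F.2 (p 2)).2 * w 2] := by
  have hev : vectorField I J F =ᶠ[𝓝 p] F.value :=
    eventually_of_mem ((isOpen_strip hI hJ).mem_nhds hp) fun q hq => vectorField_apply hI hJ hF hq
  have hF' := contDiffOn_deriv hI hF.1
  have hf := hasFDerivAt_comp_coord 0 (hasDerivAt_fst hI hF.1 hp.1)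
  have hf' := hasFDerivAt_comp_coord 0 (hasDerivAt_fst hI hF' hp.1)
  have hf'' := hasFDerivAt_comp_coord 0 (hasDerivAt_fst hI (contDiffOn_deriv hI hF') hp.1)
  have hg := hasFDerivAt_comp_coord 0 (hasDerivAt_snd hI hF.1 hp.1)
  have hg' := hasFDerivAt_comp_coord 0 (hasDerivAt_snd hI hF' hp.1)
  have hα := hasFDerivAt_comp_coord 2 (hasDerivAt_fst hJ hF.2 hp.2)
  have hα' := hasFDerivAt_comp_coord 2 (hasDerivAt_fst hJ (contDiffOn_deriv hJ hF.2) hp.2)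
  have hβ := hasFDerivAt_comp_coord 2 (hasDerivAt_snd hJ hF.2 hp.2)
  rw [hev.fderiv_eq, fderiv_apply_of_hasFDerivAt (L := ![_, _, _, _, _]) hf
    (((hf'.const_mul (1 / 2)).mul (hasFDerivAt_apply 1 p)).add hg) hα
    ((((hf'.const_mul (1 / 2)).mul (hasFDerivAt_apply 3 p)).add
      ((hf''.const_mul (1 / 4)).mul (hasFDerivAt_apply 1 p))).neg.sub (hg'.const_mul (1 / 2)))
    ((hα'.mul (hasFDerivAt_apply 4 p)).neg.add hβ)]
  apply pt_ext <;> simp <;> ring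

theorem deriv_bracket (hI : IsOpen I) (hA : ContDiffOn ℝ ∞ A I) (hB : ContDiffOn ℝ ∞ B I)
    (ht : t ∈ I) : deriv (bracket k A B) t =
      ((A t).1 * (deriv (deriv B) t).1 - (B t).1 * (deriv (deriv A) t).1,
        (deriv A t).1 * (deriv B t).2 + (A t).1 * (deriv (deriv B) t).2 -
          k * ((deriv (deriv A) t).1 * (B t).2 + (deriv A t).1 * (deriv B t).2) -
          ((deriv B t).1 * (deriv A t).2 + (B t).1 * (deriv (deriv A) t).2 -
            k * ((deriv (deriv B) t).1 * (A t).2 + (deriv B t).1 * (deriv A t).2))) := by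
  have hA' := contDiffOn_deriv hI hA
  have hB' := contDiffOn_deriv hI hB
  have hA₁ := hasDerivAt_fst hI hA ht
  have hA₁' := hasDerivAt_fst hI hA' ht
  have hB₁ := hasDerivAt_fst hI hB ht
  have hB₁' := hasDerivAt_fst hI hB' ht
  refine HasDerivAt.deriv (((hA₁.mul hB₁').sub (hB₁.mul hA₁')).prodMk
    (((hA₁.mul (hasDerivAt_snd hI hB' ht)).sub
      ((hA₁'.const_mul k).mul (hasDerivAt_snd hI hB ht))).sub
      ((hB₁.mul (hasDerivAt_snd hI hA' ht)).sub
        ((hB₁'.const_mul k).mul (hasDerivAt_snd hI hA ht)))) |>.congr_deriv ?_)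
  exact Prod.ext (by ring) (by ring)

theorem deriv_deriv_bracket_fst (hI : IsOpen I) (hA : ContDiffOn ℝ ∞ A I)
    (hB : ContDiffOn ℝ ∞ B I) (ht : t ∈ I) : (deriv (deriv (bracket k A B)) t).1 =
      (deriv A t).1 * (deriv (deriv B) t).1 + (A t).1 * (deriv (deriv (deriv B)) t).1 -
        ((deriv B t).1 * (deriv (deriv A) t).1 + (B t).1 * (deriv (deriv (deriv A)) t).1) := by
  have hA' := contDiffOn_deriv hI hA
  have hB' := contDiffOn_deriv hI hB
  rw [← (hasDerivAt_fst hI (contDiffOn_deriv hI (contDiffOn_bracket hI k hA hB)) ht).deriv]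
  exact deriv_eq_of_eqOn hI (fun s hs => congrArg Prod.fst (deriv_bracket hI hA hB hs)) ht
    (((hasDerivAt_fst hI hA ht).mul (hasDerivAt_fst hI (contDiffOn_deriv hI hB') ht)).sub
      ((hasDerivAt_fst hI hB ht).mul (hasDerivAt_fst hI (contDiffOn_deriv hI hA') ht)))

theorem lieBracket_vectorField (hI : IsOpen I) (hJ : IsOpen J) (hF : F.IsSmoothOn I J)
    (hG : G.IsSmoothOn I J) :
    VectorField.lieBracket ℝ (vectorField I J F) (vectorField I J G) =
      vectorField I J (F.bracket G) := by
  refine eq_vectorField hI hJ (hF.bracket hI hJ hG) (fun p hp => ?_) fun p hp => ?_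
  · rw [VectorField.lieBracket, vectorField_apply hI hJ hF hp, vectorField_apply hI hJ hG hp,
      fderiv_vectorField hI hJ hF hp, fderiv_vectorField hI hJ hG hp]
    simp only [FieldPair.value, FieldPair.bracket, deriv_bracket hI hF.1 hG.1 hp.1,
      deriv_deriv_bracket_fst hI hF.1 hG.1 hp.1, deriv_bracket hJ hF.2 hG.2 hp.2]
    apply pt_ext <;> simp [bracket, Block.weight] <;> ring
  · rw [VectorField.lieBracket, vectorField_apply_of_notMem hp, vectorField_apply_of_notMem hp,
      map_zero, map_zero, sub_zero]

theorem bracket_linear_combination (hI : IsOpen I) (hA : ContDiffOn ℝ ∞ A I)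
    (hB : ContDiffOn ℝ ∞ B I) (a b c d : ℝ) :
    EqOn (bracket k (a • A + b • B) (c • A + d • B)) ((a * d - b * c) • bracket k A B) I := by
  intro t ht
  have hd : ∀ a b : ℝ, deriv (a • A + b • B) t = a • deriv A t + b • deriv B t := fun a b =>
    (((hasDerivAt_of_contDiffOn hI hA ht).const_smul a).add
      ((hasDerivAt_of_contDiffOn hI hB ht).const_smul b)).deriv
  simp only [bracket, hd, Pi.add_apply, Pi.smul_apply, Prod.fst_add, Prod.snd_add, Prod.smul_fst,
    Prod.smul_snd, smul_eq_mul, Prod.smul_mk]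
  exact Prod.ext (by ring) (by ring)

theorem FieldPair.IsSmoothOn.linear_combination (hF : F.IsSmoothOn I J) (hG : G.IsSmoothOn I J)
    (a b : ℝ) : (a • F + b • G).IsSmoothOn I J :=
  (hF.smul a).add (hG.smul b)

theorem vectorField_linear_combination (hI : IsOpen I) (hJ : IsOpen J) (hF : F.IsSmoothOn I J)
    (hG : G.IsSmoothOn I J) (a b : ℝ) : vectorField I J (a • F + b • G) =
      a • vectorField I J F + b • vectorField I J G := by
  rw [vectorField_add hI hJ (hF.smul a) (hG.smul b), vectorField_smul hI hJ hF,
    vectorField_smul hI hJ hG]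

theorem lieBracket_linear_combination (hI : IsOpenInterval I) (hJ : IsOpenInterval J)
    (hF : F.IsSmoothOn I J) (hG : G.IsSmoothOn I J) (a b c d : ℝ) :
    VectorField.lieBracket ℝ (vectorField I J (a • F + b • G)) (vectorField I J (c • F + d • G)) =
      (a * d - b * c) • VectorField.lieBracket ℝ (vectorField I J F) (vectorField I J G) := by
  have hbr := hF.bracket hI.isOpen hJ.isOpen hG
  have hab := hF.linear_combination hG a b
  have hcd := hF.linear_combination hG c d
  rw [lieBracket_vectorField hI.isOpen hJ.isOpen hF hG,
    lieBracket_vectorField hI.isOpen hJ.isOpen hab hcd, ← vectorField_smul hI.isOpen hJ.isOpen hbr,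
    vectorField_eq_iff hI hJ (hab.bracket hI.isOpen hJ.isOpen hcd) (hbr.smul _)]
  exact ⟨bracket_linear_combination hI.isOpen hF.1 hG.1 a b c d,
    bracket_linear_combination hJ.isOpen hF.2 hG.2 a b c d⟩

end LieBracket

/-- The point transformation that acts by `Φ` on `(t, x, u)` and by `Ψ` on `(y, v)`. -/
def pointMap (Φ Ψ : BlockMap) : Pt → Pt := fun p =>
  ![Φ.base (p 0), Φ.mult (p 0) * p 1 + Φ.shift (p 0), Ψ.base (p 2),
    1 / Φ.mult (p 0) * p 3
      - Φ.mult (p 0) * deriv (deriv Φ.base) (p 0) / (4 * deriv Φ.base (p 0) ^ 2) * p 1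
      - deriv Φ.shift (p 0) / (2 * deriv Φ.base (p 0)),
    Ψ.mult (p 2) * p 4 + Ψ.shift (p 2)]

section PointMap

variable {I J : Set ℝ} {F G : FieldPair} {p : Pt} {Φ Ψ : BlockMap} {σ : Block}
  {A B : BlockField} {t : ℝ}

theorem pointTransformation_eq_pointMap {ε : ℝ} (hε : ε = 1 ∨ ε = -1)
    (hΦ : ∀ t ∈ I, 0 < deriv Φ.base t ∧ Φ.mult t = ε * √(deriv Φ.base t))
    (hΨ : Block.yv.IsMultiplier J Ψ.base Ψ.mult) :
    EqOn (pointTransformation ε Φ.base Φ.shift Ψ.base Ψ.shift) (pointMap Φ Ψ) (strip I J) := by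
  intro p hp
  obtain ⟨hpos, hmult⟩ := hΦ _ hp.1
  have hsq := Real.sq_sqrt hpos.le
  have hs := (Real.sqrt_pos.2 hpos).ne'
  have hinv : ε / √(deriv Φ.base (p 0)) = 1 / Φ.mult (p 0) := by
    rw [hmult]
    rcases hε with rfl | rfl <;> field_simp
  have hcube : ε * deriv (deriv Φ.base) (p 0) / (4 * √(deriv Φ.base (p 0)) ^ 3) =
      Φ.mult (p 0) * deriv (deriv Φ.base) (p 0) / (4 * deriv Φ.base (p 0) ^ 2) := by
    rw [hmult, show deriv Φ.base (p 0) ^ 2 = (√(deriv Φ.base (p 0)) ^ 2) ^ 2 by rw [hsq]]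
    field_simp
  rw [pointTransformation, pointMap, ← hmult, ← (hΨ _ hp.2).2, hinv, hcube]

theorem fderiv_pointMap (hΦ : Φ.IsMoveOn .txu I) (hΨ : Ψ.IsMoveOn .yv J) (hp : p ∈ strip I J)
    (w : Pt) : fderiv ℝ (pointMap Φ Ψ) p w =
      ![deriv Φ.base (p 0) * w 0,
        1 / 2 * Φ.mult (p 0) * deriv (deriv Φ.base) (p 0) / deriv Φ.base (p 0) * w 0 * p 1 +
          Φ.mult (p 0) * w 1 + deriv Φ.shift (p 0) * w 0,
        deriv Ψ.base (p 2) * w 2,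
        -(1 / 2 * deriv (deriv Φ.base) (p 0) / (Φ.mult (p 0) * deriv Φ.base (p 0))) * w 0 * p 3 +
          1 / Φ.mult (p 0) * w 3 -
          (Φ.mult (p 0) * deriv (deriv (deriv Φ.base)) (p 0) / (4 * deriv Φ.base (p 0) ^ 2) -
            3 * Φ.mult (p 0) * deriv (deriv Φ.base) (p 0) ^ 2 / (8 * deriv Φ.base (p 0) ^ 3)) *
            w 0 * p 1 -
          Φ.mult (p 0) * deriv (deriv Φ.base) (p 0) / (4 * deriv Φ.base (p 0) ^ 2) * w 1 -
          (deriv (deriv Φ.shift) (p 0) / (2 * deriv Φ.base (p 0)) -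
            deriv Φ.shift (p 0) * deriv (deriv Φ.base) (p 0) / (2 * deriv Φ.base (p 0) ^ 2)) * w 0,
        -(Ψ.mult (p 2) * deriv (deriv Ψ.base) (p 2) / deriv Ψ.base (p 2)) * w 2 * p 4 +
          Ψ.mult (p 2) * w 4 + deriv Ψ.shift (p 2) * w 2] := by
  have hT := hΦ.hasDerivAt_base hp.1
  have hT' := hΦ.hasDerivAt_deriv_base hp.1
  have hT'' := hasDerivAt_of_contDiffOn hΦ.isOpen
    (contDiffOn_deriv hΦ.isOpen (contDiffOn_deriv hΦ.isOpen hΦ.contDiffOn_base)) hp.1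
  have hm := hΦ.hasDerivAt_mult hp.1
  have hX := hΦ.hasDerivAt_shift hp.1
  have hX' := hasDerivAt_of_contDiffOn hΦ.isOpen
    (contDiffOn_deriv hΦ.isOpen hΦ.contDiffOn_shift) hp.1
  have hT0 := hΦ.deriv_ne_zero _ hp.1
  have hY0 := hΨ.deriv_ne_zero _ hp.2
  have hm0 := hΦ.isMultiplier.ne_zero hp.1
  have hinv := (hasDerivAt_const (p 0) (1 : ℝ)).div hm hm0
  have hx := (hm.mul hT'').div ((hT'.pow 2).const_mul 4)
    (mul_ne_zero four_ne_zero (pow_ne_zero 2 hT0))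
  have hc := hX'.div (hT'.const_mul 2) (mul_ne_zero two_ne_zero hT0)
  rw [fderiv_apply_of_hasFDerivAt (L := ![_, _, _, _, _]) (hasFDerivAt_comp_coord 0 hT)
    (((hasFDerivAt_comp_coord 0 hm).mul (hasFDerivAt_apply 1 p)).add (hasFDerivAt_comp_coord 0 hX))
    (hasFDerivAt_comp_coord 2 (hΨ.hasDerivAt_base hp.2))
    ((((hasFDerivAt_comp_coord 0 hinv).mul (hasFDerivAt_apply 3 p)).sub
      ((hasFDerivAt_comp_coord 0 hx).mul (hasFDerivAt_apply 1 p))).sub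
      (hasFDerivAt_comp_coord 0 hc))
    (((hasFDerivAt_comp_coord 2 (hΨ.hasDerivAt_mult hp.2)).mul (hasFDerivAt_apply 4 p)).add
      (hasFDerivAt_comp_coord 2 (hΨ.hasDerivAt_shift hp.2)))]
  apply pt_ext
  · simp
  · simp [Block.weight]; field_simp; ring
  · simp
  · simp [Block.weight]; field_simp; ring
  · simp [Block.weight]; field_simp; ring

theorem BlockMap.Pushes.deriv_deriv_fst (h : Φ.IsMoveOn σ I) (hA : ContDiffOn ℝ ∞ A I)
    (hP : Φ.Pushes σ I A B) (ht : t ∈ I) :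
    (deriv (deriv B) (Φ.base t)).1 = deriv (Φ.pushFstDeriv A) t / deriv Φ.base t := by
  have hB' := contDiffOn_deriv h.image.isOpen (hP.contDiffOn h hA)
  have hcomp := h.hasDerivAt_comp_base (contDiffOn_fst hB') ht
  rw [(hasDerivAt_fst h.image.isOpen hB' (mem_image_of_mem _ ht)).deriv] at hcomp
  rw [eq_div_iff (h.deriv_ne_zero t ht), ← hcomp.deriv]
  exact deriv_eq_of_eqOn h.isOpen (fun s hs => hP.deriv_fst h hA hs) ht
    (hasDerivAt_of_contDiffOn h.isOpen (h.contDiffOn_pushFstDeriv hA) ht)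

theorem BlockMap.IsMoveOn.mult_sq (h : Φ.IsMoveOn .txu I) (ht : t ∈ I) :
    Φ.mult t ^ 2 = deriv Φ.base t := by
  obtain ⟨ε, hε, hmult⟩ := h.isMultiplier
  rw [(hmult t ht).2, mul_pow, Real.sq_sqrt (hmult t ht).1.le]
  rcases hε with rfl | rfl <;> norm_num

theorem FieldPair.value_pointMap (hΦ : Φ.IsMoveOn .txu I) (hΨ : Ψ.IsMoveOn .yv J)
    (hF : F.IsSmoothOn I J) (h₁ : Φ.Pushes .txu I F.1 G.1) (h₂ : Ψ.Pushes .yv J F.2 G.2)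
    (hp : p ∈ strip I J) :
    G.value (pointMap Φ Ψ p) = fderiv ℝ (pointMap Φ Ψ) p (F.value p) := by
  have hT0 := hΦ.deriv_ne_zero _ hp.1
  have hY0 := hΨ.deriv_ne_zero _ hp.2
  have hm0 := hΦ.isMultiplier.ne_zero hp.1
  have hmult := (hΨ.isMultiplier _ hp.2).2
  rw [fderiv_pointMap hΦ hΨ hp]
  apply pt_ext
  · simp [value, pointMap, h₁ _ hp.1, BlockMap.push]
  · simp [value, pointMap, h₁ _ hp.1, h₁.deriv_fst hΦ hF.1 hp.1, BlockMap.push,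
      BlockMap.pushFstDeriv, Block.weight]
    field_simp
    ring
  · simp [value, pointMap, h₂ _ hp.2, BlockMap.push]
  · simp [value, pointMap, h₁.deriv_fst hΦ hF.1 hp.1, h₁.deriv_deriv_fst hΦ hF.1 hp.1,
      h₁.deriv_snd hΦ hF.1 hp.1, (hΦ.hasDerivAt_push hF.1 hp.1).deriv,
      (hΦ.hasDerivAt_pushFstDeriv hF.1 hp.1).deriv, BlockMap.pushFstDeriv, Block.weight,
      ← hΦ.mult_sq hp.1]
    field_simp
    ring
  · simp [value, pointMap, h₂ _ hp.2, h₂.deriv_fst hΨ hF.2 hp.2, BlockMap.push,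
      BlockMap.pushFstDeriv, Block.weight, hmult]
    field_simp
    ring

end PointMap

/-- The space spanned by two elements of `𝔤` that are given by their components. -/
def spanFields (I J : Set ℝ) (F G : FieldPair) : Submodule ℝ (Pt → Pt) :=
  Submodule.span ℝ {vectorField I J F, vectorField I J G}

section Pseudogroup

variable {I J I' J' : Set ℝ} {F F' G G' : FieldPair} {Φ Ψ : BlockMap} {Θ : Pt → Pt}
  {s s' : Submodule ℝ (Pt → Pt)}

theorem pointMap_surjOn (hΦ : Φ.IsMoveOn .txu I) (hΨ : Ψ.IsMoveOn .yv J) :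
    SurjOn (pointMap Φ Ψ) (strip I J) (strip (Φ.base '' I) (Ψ.base '' J)) := by
  rintro q ⟨⟨t, ht, htq⟩, y, hy, hyq⟩
  have hm := hΦ.isMultiplier.ne_zero ht
  have hn := hΨ.isMultiplier.ne_zero hy
  refine ⟨![t, (q 1 - Φ.shift t) / Φ.mult t, y, Φ.mult t * (q 3
      + Φ.mult t * deriv (deriv Φ.base) t / (4 * deriv Φ.base t ^ 2) *
        ((q 1 - Φ.shift t) / Φ.mult t)
      + deriv Φ.shift t / (2 * deriv Φ.base t)), (q 4 - Ψ.shift y) / Ψ.mult y], ⟨ht, hy⟩, ?_⟩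
  apply pt_ext
  · simpa [pointMap] using htq
  · simp [pointMap, mul_div_cancel₀ _ hm]
  · simpa [pointMap] using hyq
  · simp [pointMap, hm]
    ring
  · simp [pointMap, mul_div_cancel₀ _ hn]

theorem isPushforward_vectorField_iff (hΦ : Φ.IsMoveOn .txu I) (hΨ : Ψ.IsMoveOn .yv J)
    (hΘ : EqOn Θ (pointMap Φ Ψ) (strip I J)) (hF : F.IsSmoothOn I J)
    (hG : G.IsSmoothOn (Φ.base '' I) (Ψ.base '' J)) :
    IsPushforward Θ (strip I J) (vectorField I J F) (vectorField (Φ.base '' I) (Ψ.base '' J) G) ↔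
      Φ.Pushes .txu I F.1 G.1 ∧ Ψ.Pushes .yv J F.2 G.2 := by
  have hvalue : IsPushforward Θ (strip I J) (vectorField I J F)
      (vectorField (Φ.base '' I) (Ψ.base '' J) G) ↔ ∀ p ∈ strip I J,
        G.value (pointMap Φ Ψ p) = fderiv ℝ (pointMap Φ Ψ) p (F.value p) := by
    refine forall₂_congr fun p hp => ?_
    have hmem : pointMap Φ Ψ p ∈ strip (Φ.base '' I) (Ψ.base '' J) :=
      ⟨mem_image_of_mem _ hp.1, mem_image_of_mem _ hp.2⟩
    rw [(hΘ.eventuallyEq_of_mem ((isOpen_strip hΦ.isOpen hΨ.isOpen).mem_nhds hp)).fderiv_eq,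
      hΘ hp, vectorField_apply hΦ.image.isOpen hΨ.image.isOpen hG hmem,
      vectorField_apply hΦ.isOpen hΨ.isOpen hF hp]
  rw [hvalue]
  refine ⟨fun h => ?_, fun h p hp => FieldPair.value_pointMap hΦ hΨ hF h.1 h.2 hp⟩
  obtain ⟨B₁, -, hP₁⟩ := hΦ.exists_pushes hF.1
  obtain ⟨B₂, -, hP₂⟩ := hΨ.exists_pushes hF.2
  have heq : ∀ q ∈ strip (Φ.base '' I) (Ψ.base '' J), FieldPair.value (B₁, B₂) q = G.value q := by
    intro q hq
    obtain ⟨p, hp, rfl⟩ := pointMap_surjOn hΦ hΨ hq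
    rw [h p hp, FieldPair.value_pointMap (G := (B₁, B₂)) hΦ hΨ hF hP₁ hP₂ hp]
  obtain ⟨h₁, h₂⟩ := FieldPair.eqOn_of_value_eq hΦ.image hΨ.image heq
  exact ⟨hP₁.congr_right h₁, hP₂.congr_right h₂⟩

theorem InPseudogroup.exists_blockMaps (hI : IsOpenInterval I) (hJ : IsOpenInterval J)
    (h : InPseudogroup I J I' J' Θ) : ∃ Φ Ψ : BlockMap, Φ.IsMoveOn .txu I ∧ Ψ.IsMoveOn .yv J ∧
      Φ.base '' I = I' ∧ Ψ.base '' J = J' ∧ EqOn Θ (pointMap Φ Ψ) (strip I J) := by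
  obtain ⟨ε, T, X, Y, V, hε, hT, hX, hY, hV, hT', hY', hI', hJ', rfl⟩ := h
  exact ⟨⟨T, fun t => ε * √(deriv T t), X⟩, ⟨Y, fun y => 1 / deriv Y y, V⟩,
    ⟨hI, hT, hX, ε, hε, fun t ht => ⟨hT' t ht, rfl⟩⟩, ⟨hJ, hY, hV, fun y hy => ⟨hY' y hy, rfl⟩⟩,
    hI', hJ', pointTransformation_eq_pointMap (Φ := ⟨T, _, X⟩) (Ψ := ⟨Y, _, V⟩) hε
      (fun t ht => ⟨hT' t ht, rfl⟩) fun y hy => ⟨hY' y hy, rfl⟩⟩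

theorem BlockMap.IsMoveOn.exists_inPseudogroup (hΦ : Φ.IsMoveOn .txu I) (hΨ : Ψ.IsMoveOn .yv J) :
    ∃ Θ, InPseudogroup I J (Φ.base '' I) (Ψ.base '' J) Θ ∧
      EqOn Θ (pointMap Φ Ψ) (strip I J) := by
  obtain ⟨ε, hε, hmult⟩ := hΦ.isMultiplier
  exact ⟨_, ⟨ε, _, _, _, _, hε, hΦ.contDiffOn_base, hΦ.contDiffOn_shift, hΨ.contDiffOn_base,
    hΨ.contDiffOn_shift, fun t ht => (hmult t ht).1, hΨ.deriv_ne_zero, rfl, rfl, rfl⟩,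
    pointTransformation_eq_pointMap hε hmult hΨ.isMultiplier⟩

theorem IsPushforward.linear_combination {Ω : Set Pt} {V₁ V₂ W₁ W₂ : Pt → Pt}
    (h₁ : IsPushforward Θ Ω V₁ W₁) (h₂ : IsPushforward Θ Ω V₂ W₂) (a b : ℝ) :
    IsPushforward Θ Ω (a • V₁ + b • V₂) (a • W₁ + b • W₂) := by
  intro p hp
  simp [h₁ p hp, h₂ p hp]

theorem gEquivalent_spanFields (hΦ : Φ.IsMoveOn .txu I) (hΨ : Ψ.IsMoveOn .yv J)
    (hF : F.IsSmoothOn I J) (hG : G.IsSmoothOn I J)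
    (hF₁ : Φ.Pushes .txu I F.1 F'.1) (hF₂ : Ψ.Pushes .yv J F.2 F'.2)
    (hG₁ : Φ.Pushes .txu I G.1 G'.1) (hG₂ : Ψ.Pushes .yv J G.2 G'.2) :
    GEquivalent I J (spanFields I J F G) (Φ.base '' I) (Ψ.base '' J)
      (spanFields (Φ.base '' I) (Ψ.base '' J) F' G') := by
  obtain ⟨Θ, hΘ, hrep⟩ := hΦ.exists_inPseudogroup hΨ
  have hFF' := (isPushforward_vectorField_iff hΦ hΨ hrep hF
    ⟨hF₁.contDiffOn hΦ hF.1, hF₂.contDiffOn hΨ hF.2⟩).2 ⟨hF₁, hF₂⟩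
  have hGG' := (isPushforward_vectorField_iff hΦ hΨ hrep hG
    ⟨hG₁.contDiffOn hΦ hG.1, hG₂.contDiffOn hΨ hG.2⟩).2 ⟨hG₁, hG₂⟩
  refine ⟨Θ, hΘ, fun V hV => ?_, fun W hW => ?_⟩
  · obtain ⟨a, b, rfl⟩ := Submodule.mem_span_pair.1 hV
    exact ⟨_, Submodule.mem_span_pair.2 ⟨a, b, rfl⟩, hFF'.linear_combination hGG' a b⟩
  · obtain ⟨a, b, rfl⟩ := Submodule.mem_span_pair.1 hW
    exact ⟨_, Submodule.mem_span_pair.2 ⟨a, b, rfl⟩, hFF'.linear_combination hGG' a b⟩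

theorem GEquivalent.exists_blockMaps (hI : IsOpenInterval I) (hJ : IsOpenInterval J)
    (hs : s ≤ symAlgebra I J) (hs' : s' ≤ symAlgebra I' J') (h : GEquivalent I J s I' J' s') :
    ∃ Φ Ψ : BlockMap, Φ.IsMoveOn .txu I ∧ Ψ.IsMoveOn .yv J ∧
      Φ.base '' I = I' ∧ Ψ.base '' J = J' ∧
      (∀ F : FieldPair, F.IsSmoothOn I J → vectorField I J F ∈ s →
        ∃ G : FieldPair, G.IsSmoothOn I' J' ∧ vectorField I' J' G ∈ s' ∧
          Φ.Pushes .txu I F.1 G.1 ∧ Ψ.Pushes .yv J F.2 G.2) ∧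
      ∀ G : FieldPair, G.IsSmoothOn I' J' → vectorField I' J' G ∈ s' →
        ∃ F : FieldPair, F.IsSmoothOn I J ∧ vectorField I J F ∈ s ∧
          Φ.Pushes .txu I F.1 G.1 ∧ Ψ.Pushes .yv J F.2 G.2 := by
  obtain ⟨Θ, hΘ, hpush, hpull⟩ := h
  obtain ⟨Φ, Ψ, hΦ, hΨ, rfl, rfl, hrep⟩ := hΘ.exists_blockMaps hI hJ
  refine ⟨Φ, Ψ, hΦ, hΨ, rfl, rfl, fun F hF hmem => ?_, fun G hG hmem => ?_⟩
  · obtain ⟨W, hW, hFW⟩ := hpush _ hmem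
    obtain ⟨G, hG, rfl⟩ := (mem_symAlgebra_iff hΦ.image.isOpen hΨ.image.isOpen).1 (hs' hW)
    exact ⟨G, hG, hW, (isPushforward_vectorField_iff hΦ hΨ hrep hF hG).1 hFW⟩
  · obtain ⟨V, hV, hVG⟩ := hpull _ hmem
    obtain ⟨F, hF, rfl⟩ := (mem_symAlgebra_iff hI.isOpen hJ.isOpen).1 (hs hV)
    exact ⟨F, hF, hV, (isPushforward_vectorField_iff hΦ hΨ hrep hF hG).1 hVG⟩

end Pseudogroup

/-- No nontrivial combination of `F` and `G` vanishes over smaller intervals. -/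
def FieldPair.IndependentOn (I J : Set ℝ) (F G : FieldPair) : Prop :=
  ∀ a b : ℝ, ∀ I' ⊆ I, ∀ J' ⊆ J, IsOpenInterval I' → IsOpenInterval J' →
    EqOn (a • F + b • G).1 0 I' → EqOn (a • F + b • G).2 0 J' → a = 0 ∧ b = 0

section Spans

variable {I J I' J' : Set ℝ} {F G : FieldPair} {V : Pt → Pt}

theorem mem_spanFields (hI : IsOpen I) (hJ : IsOpen J) (hF : F.IsSmoothOn I J)
    (hG : G.IsSmoothOn I J) :
    V ∈ spanFields I J F G ↔ ∃ a b : ℝ, vectorField I J (a • F + b • G) = V := by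
  simp only [spanFields, Submodule.mem_span_pair, vectorField_linear_combination hI hJ hF hG]

theorem spanFields_le_symAlgebra (hI : IsOpen I) (hJ : IsOpen J) (hF : F.IsSmoothOn I J)
    (hG : G.IsSmoothOn I J) : spanFields I J F G ≤ symAlgebra I J := by
  rw [spanFields, Submodule.span_le, insert_subset_iff, singleton_subset_iff]
  exact ⟨(mem_symAlgebra_iff hI hJ).2 ⟨F, hF, rfl⟩, (mem_symAlgebra_iff hI hJ).2 ⟨G, hG, rfl⟩⟩

theorem map_restrictTo_spanFields (hI : I' ⊆ I) (hJ : J' ⊆ J) :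
    (spanFields I J F G).map (restrictTo (strip I' J')) = spanFields I' J' F G := by
  simp only [spanFields, Submodule.map_span, image_pair, restrictTo_vectorField hI hJ]

theorem span_pair_linear_combination {E : Type*} [AddCommGroup E] [Module ℝ E] (V W : E)
    {a b c d : ℝ} (h : a * d - b * c ≠ 0) :
    Submodule.span ℝ {a • V + b • W, c • V + d • W} = Submodule.span ℝ {V, W} := by
  apply le_antisymm <;> rw [Submodule.span_le, insert_subset_iff, singleton_subset_iff] <;>
    simp only [SetLike.mem_coe, Submodule.mem_span_pair]
  · exact ⟨⟨a, b, rfl⟩, c, d, rfl⟩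
  · have hinv := mul_inv_cancel₀ h
    refine ⟨⟨d * (a * d - b * c)⁻¹, -b * (a * d - b * c)⁻¹, ?_⟩,
      -c * (a * d - b * c)⁻¹, a * (a * d - b * c)⁻¹, ?_⟩ <;> match_scalars
    exacts [by linear_combination hinv, by ring, by ring, by linear_combination hinv]

theorem spanFields_linear_combination (hI : IsOpen I) (hJ : IsOpen J) (hF : F.IsSmoothOn I J)
    (hG : G.IsSmoothOn I J) {a b c d : ℝ} (h : a * d - b * c ≠ 0) :
    spanFields I J (a • F + b • G) (c • F + d • G) = spanFields I J F G := by
  simp only [spanFields, vectorField_linear_combination hI hJ hF hG]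
  exact span_pair_linear_combination _ _ h

theorem vectorField_eq_zero_iff (hI : IsOpenInterval I) (hJ : IsOpenInterval J)
    (hF : F.IsSmoothOn I J) : vectorField I J F = 0 ↔ EqOn F.1 0 I ∧ EqOn F.2 0 J := by
  rw [← vectorField_zero (I := I) (J := J)]
  exact vectorField_eq_iff hI hJ hF ⟨contDiffOn_const, contDiffOn_const⟩

theorem FieldPair.IndependentOn.linearIndependent (hI : IsOpenInterval I) (hJ : IsOpenInterval J)
    (hF : F.IsSmoothOn I J) (hG : G.IsSmoothOn I J) (h : F.IndependentOn I J G) :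
    LinearIndependent ℝ ![vectorField I J F, vectorField I J G] := by
  rw [LinearIndependent.pair_iff]
  intro a b hab
  rw [← vectorField_linear_combination hI.isOpen hJ.isOpen hF hG] at hab
  obtain ⟨h₁, h₂⟩ :=
    (vectorField_eq_zero_iff hI hJ (hF.linear_combination hG a b)).1 hab
  exact h a b I Subset.rfl J Subset.rfl hI hJ h₁ h₂

theorem FieldPair.IndependentOn.finrank_spanFields (hI : IsOpenInterval I) (hJ : IsOpenInterval J)
    (hF : F.IsSmoothOn I J) (hG : G.IsSmoothOn I J) (h : F.IndependentOn I J G) :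
    Module.finrank ℝ (spanFields I J F G) = 2 := by
  rw [spanFields, ← Matrix.range_cons_cons_empty _ _ ![],
    finrank_span_eq_card (h.linearIndependent hI hJ hF hG), Fintype.card_fin]

theorem FieldPair.IndependentOn.restrictsFaithfully (hI : IsOpenInterval I)
    (hJ : IsOpenInterval J) (hF : F.IsSmoothOn I J) (hG : G.IsSmoothOn I J)
    (h : F.IndependentOn I J G) : RestrictsFaithfully I J (spanFields I J F G) := by
  intro I' hI' J' hJ' hI'' hJ'' V hV hne
  obtain ⟨a, b, rfl⟩ := (mem_spanFields hI.isOpen hJ.isOpen hF hG).1 hV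
  by_contra! hzero
  have hsmooth := hF.linear_combination hG a b
  have hres : vectorField I' J' (a • F + b • G) = 0 := by
    rw [← restrictTo_vectorField hI' hJ']
    exact indicator_eq_zero'.2 (disjoint_left.2 fun p hp hmem => hp (hzero p hmem))
  obtain ⟨h₁, h₂⟩ :=
    (vectorField_eq_zero_iff hI'' hJ'' (hsmooth.mono hI' hJ')).1 hres
  obtain ⟨rfl, rfl⟩ := h a b I' hI' J' hJ' hI'' hJ'' h₁ h₂
  exact hne (by rw [zero_smul, zero_smul, add_zero, vectorField_zero])

theorem RestrictsFaithfully.independentOn (hI : IsOpenInterval I) (hJ : IsOpenInterval J)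
    (hF : F.IsSmoothOn I J) (hG : G.IsSmoothOn I J)
    (h : RestrictsFaithfully I J (spanFields I J F G))
    (hli : LinearIndependent ℝ ![vectorField I J F, vectorField I J G]) :
    F.IndependentOn I J G := by
  intro a b I' hI' J' hJ' hI'' hJ'' h₁ h₂
  refine LinearIndependent.pair_iff.1 hli a b ?_
  rw [← vectorField_linear_combination hI.isOpen hJ.isOpen hF hG]
  by_contra hne
  obtain ⟨p, hp, hvalue⟩ := h I' hI' J' hJ' hI'' hJ'' _
    ((mem_spanFields hI.isOpen hJ.isOpen hF hG).2 ⟨a, b, rfl⟩) hne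
  refine hvalue ?_
  rw [← restrictTo_apply_of_mem hp (vectorField I J _), restrictTo_vectorField hI' hJ',
    (vectorField_eq_zero_iff hI'' hJ'' ((hF.linear_combination hG a b).mono hI' hJ')).2 ⟨h₁, h₂⟩,
    Pi.zero_apply]

theorem isAbelian_spanFields (hI : IsOpenInterval I) (hJ : IsOpenInterval J)
    (hF : F.IsSmoothOn I J) (hG : G.IsSmoothOn I J) : IsAbelian (spanFields I J F G) ↔
      VectorField.lieBracket ℝ (vectorField I J F) (vectorField I J G) = 0 := by
  refine ⟨fun h => h _ (Submodule.subset_span (mem_insert _ _)) _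
    (Submodule.subset_span (mem_insert_of_mem _ rfl)), fun h V hV W hW => ?_⟩
  obtain ⟨a, b, rfl⟩ := (mem_spanFields hI.isOpen hJ.isOpen hF hG).1 hV
  obtain ⟨c, d, rfl⟩ := (mem_spanFields hI.isOpen hJ.isOpen hF hG).1 hW
  rw [lieBracket_linear_combination hI hJ hF hG, h, smul_zero]

theorem FieldPair.IndependentOn.isTwoDimSubalgebra (hI : IsOpenInterval I) (hJ : IsOpenInterval J)
    (hF : F.IsSmoothOn I J) (hG : G.IsSmoothOn I J) (h : F.IndependentOn I J G)
    (hbr : VectorField.lieBracket ℝ (vectorField I J F) (vectorField I J G) ∈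
      spanFields I J F G) : IsTwoDimSubalgebra I J (spanFields I J F G) := by
  refine ⟨spanFields_le_symAlgebra hI.isOpen hJ.isOpen hF hG, h.finrank_spanFields hI hJ hF hG,
    fun V hV W hW => ?_⟩
  obtain ⟨a, b, rfl⟩ := (mem_spanFields hI.isOpen hJ.isOpen hF hG).1 hV
  obtain ⟨c, d, rfl⟩ := (mem_spanFields hI.isOpen hJ.isOpen hF hG).1 hW
  rw [lieBracket_linear_combination hI hJ hF hG]
  exact Submodule.smul_mem _ _ hbr

end Spans

/-- The components of the basis elements of the listed algebras. -/
def Label.comps (g β : ℝ → ℝ) : Label → FieldPair × FieldPair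
  | .s1 => ((affine 1 0 0, affine 1 0 0), (affine 0 1 0, affine 0 1 0))
  | .s2 δ => ((affine 1 0 0, affine 0 0 δ.val), (affine 0 1 0, affine 0 (-1) 0))
  | .s3 δ => ((affine 1 0 0, 0), (affine 0 1 0, affine 0 0 δ.val))
  | .s4 δ => ((affine 0 0 (-δ.val), affine 1 0 0), (affine 0 2 0, affine 0 1 0))
  | .s5 δ => ((0, affine 1 0 0), (affine 0 0 δ.val, affine 0 1 0))
  | .s6 δ δ' => ((affine 0 0 δ.val, affine 0 0 δ'.val), (affine 0 2 0, affine 0 (-1) 0))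
  | .s7 δ => ((affine 0 0 1, 0), (affine 0 2 0, affine 0 0 δ.val))
  | .s8 δ => ((0, affine 0 0 1), (affine 0 0 δ.val, affine 0 (-1) 0))
  | .s9 δ δ' => ((affine 1 0 0, affine 0 0 δ.val), (affine 0 0 (-δ'.val), affine 1 0 0))
  | .s10 δ δ' => ((affine 1 0 0, affine 1 0 0), (affine 0 0 δ.val, affine 0 0 δ'.val))
  | .s11 δ => ((affine 1 0 0, density β), (affine 0 0 δ.val, affine 0 0 1))
  | .s12 δ => ((affine 1 0 0, affine 0 0 δ.val), (affine 0 0 1, 0))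
  | .s13 δ => ((density g, affine 1 0 0), (affine 0 0 1, affine 0 0 δ.val))
  | .s14 δ => ((affine 0 0 (-δ.val), affine 1 0 0), (0, affine 0 0 1))
  | .s15 => ((affine 0 0 1, 0), (0, affine 0 0 1))
  | .s16 δ => ((affine 0 0 1, affine 0 0 δ.val), (density g, 0))
  | .s17 δ => ((affine 0 0 δ.val, affine 0 0 1), (0, density β))
  | .s18 => ((affine 0 0 1, affine 0 0 1), (density g, density β))

section Labels

variable {I J : Set ℝ} {g β : ℝ → ℝ} {l : Label}

theorem P_neg_const (c : ℝ) : P I J (fun _ => -c) = -P I J fun _ => c := by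
  rw [P, P, ← map_neg]
  congr 1
  funext p
  apply pt_ext <;> simp

theorem S_neg_id : S I J (fun y => -y) = -S I J fun y => y := by
  rw [S, S, ← map_neg]
  congr 1
  funext p
  apply pt_ext <;> simp

theorem Label.basis_eq (l : Label) : l.basis I J g β =
    (vectorField I J (l.comps g β).1, vectorField I J (l.comps g β).2) := by
  have hone : const 1 = fun _ => (1 : ℝ) := by funext; simp [const]
  have hconst : ∀ δ : Fin 2, const δ = fun _ => (δ.val : ℝ) := fun _ => rfl
  simp only [vectorField]
  cases l <;> simp only [basis, comps, hone, affine, density, Pi.zero_apply, Prod.fst_zero,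
      Prod.snd_zero, zero_mul, one_mul, neg_one_mul] <;>
    simp only [D_zero, P_zero, S_zero, Z_zero, P_neg_const, S_neg_id, add_zero, zero_add,
      sub_eq_add_neg, hconst, Prod.mk.injEq, and_true, true_and]
  all_goals exact add_comm _ _

theorem Label.algebra_eq_spanFields (l : Label) :
    l.algebra I J g β = spanFields I J (l.comps g β).1 (l.comps g β).2 := by
  rw [algebra, basis_eq, spanFields]

theorem Label.Admissible.isSmoothOn_comps (h : l.Admissible I J g β) :
    (l.comps g β).1.IsSmoothOn I J ∧ (l.comps g β).2.IsSmoothOn I J := by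
  have hzero : ∀ {I : Set ℝ}, ContDiffOn ℝ ∞ (0 : BlockField) I := contDiffOn_const
  cases l <;> simp only [Admissible] at h <;>
    simp only [comps, FieldPair.IsSmoothOn, contDiffOn_affine, contDiffOn_density, hzero, h,
      and_self]

theorem Label.bracket_comps (l : Label) (g β : ℝ → ℝ) :
    (l.comps g β).1.bracket (l.comps g β).2 =
      open Classical in if l.InAbelianPart then 0 else (l.comps g β).1 := by
  cases l <;> simp [InAbelianPart, comps, FieldPair.bracket, bracket_affine, bracket_zero_left,
    bracket_zero_right, bracket_affine_density, bracket_density_affine, Block.weight, affine_zero]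

end Labels

/-- Which components of the field `A` vanish identically on `I`: both (`0`), the first one only
(`1`), or not the first one (`2`). Moves preserve the level. -/
def level (I : Set ℝ) (A : BlockField) : Fin 3 :=
  open Classical in if EqOn A 0 I then 0 else if ∀ t ∈ I, (A t).1 = 0 then 1 else 2

/-- The levels of the two components of a field of `𝔤`. -/
def FieldPair.level (I J : Set ℝ) (F : FieldPair) : Fin 3 × Fin 3 :=
  (BLP.level I F.1, BLP.level J F.2)

/-- The levels of the nonzero elements of a space of vector fields; a `G`-invariant. -/
def elementLevels (I J : Set ℝ) (s : Submodule ℝ (Pt → Pt)) : Set (Fin 3 × Fin 3) :=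
  {τ | τ ≠ 0 ∧ ∃ F : FieldPair, F.IsSmoothOn I J ∧ vectorField I J F ∈ s ∧ F.level I J = τ}

section Levels

variable {σ : Block} {Φ : BlockMap} {A B : BlockField} {I : Set ℝ} {f : ℝ → ℝ} {a b : ℝ}

theorem level_eq_zero_iff : level I A = 0 ↔ EqOn A 0 I := by
  unfold level
  split_ifs <;> simp_all

theorem level_zero : level I 0 = 0 := level_eq_zero_iff.2 fun _ _ => rfl

theorem level_congr (h : EqOn A B I) : level I A = level I B := by
  have hzero : EqOn A 0 I ↔ EqOn B 0 I := ⟨h.symm.trans, h.trans⟩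
  have hfst : (∀ t ∈ I, (A t).1 = 0) ↔ ∀ t ∈ I, (B t).1 = 0 :=
    forall₂_congr fun t ht => by rw [h ht]
  classical simp only [level, hzero, hfst]

theorem level_affine (hI : IsOpenInterval I) (p q r : ℝ) :
    level I (affine p q r) = if p = 0 ∧ q = 0 then if r = 0 then 0 else 1 else 2 := by
  have hfst : (∀ t ∈ I, p + q * t = 0) ↔ p = 0 ∧ q = 0 := by
    refine ⟨fun h => ?_, fun h t _ => by simp [h]⟩
    obtain ⟨t, ht⟩ := hI.nonempty
    have hline : HasDerivAt (fun t => p + q * t) q t := by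
      simpa using ((hasDerivAt_id t).const_mul q).const_add p
    have hq : q = 0 := by
      rw [← hline.deriv]
      exact deriv_eq_of_eqOn hI.isOpen h ht (hasDerivAt_const t 0)
    exact ⟨by simpa [hq] using h t ht, hq⟩
  have hsnd : EqOn (affine p q r) 0 I ↔ (p = 0 ∧ q = 0) ∧ r = 0 := by
    simp only [EqOn, affine, Pi.zero_apply, Prod.mk_eq_zero, ← hfst]
    exact ⟨fun h => ⟨fun t ht => (h ht).1, (h hI.nonempty.some_mem).2⟩,
      fun h t ht => ⟨h.1 t ht, h.2⟩⟩
  rw [level]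
  simp only [hsnd, affine, hfst]
  split_ifs <;> simp_all

theorem level_density : level I (density f) = open Classical in if EqOn f 0 I then 0 else 1 := by
  have hzero : EqOn (density f) 0 I ↔ EqOn f 0 I := by simp [density, EqOn]
  simp only [level, hzero]
  split_ifs <;> simp_all [density]

theorem NowhereConstantOn.mono {I' : Set ℝ} (h : NowhereConstantOn f I) (hI : I' ⊆ I) :
    NowhereConstantOn f I' := fun K hK => h K (hK.trans hI)

theorem NowhereConstantOn.level (h : NowhereConstantOn f I) (hI : IsOpenInterval I) :
    level I (a • affine 0 0 1 + b • density f) = if a = 0 ∧ b = 0 then 0 else 1 := by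
  have hcomb : a • affine 0 0 1 + b • density f = density fun t => a + b * f t := by
    ext t <;> simp [affine, density]
  have hzero : EqOn (fun t => a + b * f t) 0 I ↔ a = 0 ∧ b = 0 := by
    refine ⟨fun h0 => ?_, fun ⟨ha, hb⟩ t _ => by simp [ha, hb]⟩
    have hb : b = 0 := by
      by_contra hb
      exact h I Subset.rfl hI ⟨-a / b, fun t ht => by
        have hzero : a + b * f t = 0 := h0 ht
        rw [eq_div_iff hb]
        linear_combination hzero⟩
    exact ⟨by simpa [hb] using h0 hI.nonempty.some_mem, hb⟩
  simp only [hcomb, level_density, hzero]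

theorem BlockMap.Pushes.level_eq (h : Φ.IsMoveOn σ I) (hA : ContDiffOn ℝ ∞ A I)
    (hP : Φ.Pushes σ I A B) : level (Φ.base '' I) B = level I A := by
  have hzero : EqOn B 0 (Φ.base '' I) ↔ EqOn A 0 I := by
    refine ⟨fun hB => hP.eqOn_zero h hA Subset.rfl h.isOpen fun t ht =>
      hB (mem_image_of_mem _ ht), fun hA => ?_⟩
    exact (hP.congr_left h.isOpen hA).unique BlockMap.pushes_zero
  have hfst : (∀ t ∈ Φ.base '' I, (B t).1 = 0) ↔ ∀ t ∈ I, (A t).1 = 0 := by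
    rw [forall_mem_image]
    refine forall₂_congr fun t ht => ?_
    rw [hP t ht, BlockMap.push, mul_eq_zero, or_iff_right (h.deriv_ne_zero t ht)]
  classical simp only [level, hzero, hfst]

end Levels

section Invariants

variable {I J I' J' : Set ℝ} {s s' : Submodule ℝ (Pt → Pt)} {F F' G G' : FieldPair}
  {Φ Ψ : BlockMap}

theorem GEquivalent.elementLevels_eq (hI : IsOpenInterval I) (hJ : IsOpenInterval J)
    (hs : s ≤ symAlgebra I J) (hs' : s' ≤ symAlgebra I' J') (h : GEquivalent I J s I' J' s') :
    elementLevels I J s = elementLevels I' J' s' := by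
  obtain ⟨Φ, Ψ, hΦ, hΨ, rfl, rfl, hpush, hpull⟩ := h.exists_blockMaps hI hJ hs hs'
  ext τ
  refine and_congr_right fun _ => ⟨fun ⟨F, hF, hmem, hτ⟩ => ?_, fun ⟨G, hG, hmem, hτ⟩ => ?_⟩
  · obtain ⟨G, hG, hmem', h₁, h₂⟩ := hpush F hF hmem
    exact ⟨G, hG, hmem', hτ ▸ Prod.ext (h₁.level_eq hΦ hF.1) (h₂.level_eq hΨ hF.2)⟩
  · obtain ⟨F, hF, hmem', h₁, h₂⟩ := hpull G hG hmem
    exact ⟨F, hF, hmem', hτ ▸ Prod.ext (h₁.level_eq hΦ hF.1).symm (h₂.level_eq hΨ hF.2).symm⟩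

theorem lieBracket_vectorField_eq_zero_iff (hI : IsOpenInterval I) (hJ : IsOpenInterval J)
    (hF : F.IsSmoothOn I J) (hG : G.IsSmoothOn I J) :
    VectorField.lieBracket ℝ (vectorField I J F) (vectorField I J G) = 0 ↔
      (F.bracket G).level I J = 0 := by
  rw [lieBracket_vectorField hI.isOpen hJ.isOpen hF hG,
    vectorField_eq_zero_iff hI hJ (hF.bracket hI.isOpen hJ.isOpen hG), ← level_eq_zero_iff,
    ← level_eq_zero_iff, FieldPair.level, Prod.mk_eq_zero]

theorem FieldPair.level_bracket_eq (hΦ : Φ.IsMoveOn .txu I) (hΨ : Ψ.IsMoveOn .yv J)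
    (hF : F.IsSmoothOn I J) (hG : G.IsSmoothOn I J)
    (hFF' : Φ.Pushes .txu I F.1 F'.1 ∧ Ψ.Pushes .yv J F.2 F'.2)
    (hGG' : Φ.Pushes .txu I G.1 G'.1 ∧ Ψ.Pushes .yv J G.2 G'.2) :
    (F'.bracket G').level (Φ.base '' I) (Ψ.base '' J) = (F.bracket G).level I J := by
  have hFG := hF.bracket hΦ.isOpen hΨ.isOpen hG
  exact Prod.ext ((hFF'.1.bracket hΦ hF.1 hG.1 hGG'.1).level_eq hΦ hFG.1)
    ((hFF'.2.bracket hΨ hF.2 hG.2 hGG'.2).level_eq hΨ hFG.2)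

theorem GEquivalent.isAbelian_iff (hI : IsOpenInterval I) (hJ : IsOpenInterval J)
    (hs : s ≤ symAlgebra I J) (hs' : s' ≤ symAlgebra I' J') (h : GEquivalent I J s I' J' s') :
    IsAbelian s ↔ IsAbelian s' := by
  obtain ⟨Φ, Ψ, hΦ, hΨ, rfl, rfl, hpush, hpull⟩ := h.exists_blockMaps hI hJ hs hs'
  refine ⟨fun hab V hV W hW => ?_, fun hab V hV W hW => ?_⟩
  · obtain ⟨F', hF', rfl⟩ := (mem_symAlgebra_iff hΦ.image.isOpen hΨ.image.isOpen).1 (hs' hV)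
    obtain ⟨G', hG', rfl⟩ := (mem_symAlgebra_iff hΦ.image.isOpen hΨ.image.isOpen).1 (hs' hW)
    obtain ⟨F, hF, hFs, hFF'⟩ := hpull F' hF' hV
    obtain ⟨G, hG, hGs, hGG'⟩ := hpull G' hG' hW
    rw [lieBracket_vectorField_eq_zero_iff hΦ.image hΨ.image hF' hG',
      FieldPair.level_bracket_eq hΦ hΨ hF hG hFF' hGG',
      ← lieBracket_vectorField_eq_zero_iff hI hJ hF hG]
    exact hab _ hFs _ hGs
  · obtain ⟨F, hF, rfl⟩ := (mem_symAlgebra_iff hI.isOpen hJ.isOpen).1 (hs hV)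
    obtain ⟨G, hG, rfl⟩ := (mem_symAlgebra_iff hI.isOpen hJ.isOpen).1 (hs hW)
    obtain ⟨F', hF', hFs, hFF'⟩ := hpush F hF hV
    obtain ⟨G', hG', hGs, hGG'⟩ := hpush G hG hW
    rw [lieBracket_vectorField_eq_zero_iff hI hJ hF hG,
      ← FieldPair.level_bracket_eq hΦ hΨ hF hG hFF' hGG',
      ← lieBracket_vectorField_eq_zero_iff hΦ.image hΨ.image hF' hG']
    exact hab _ hFs _ hGs

end Invariants

/-- Levels attained by nonzero elements of the listed algebra, whatever `g` and `β` are. -/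
def Label.levels : Label → Finset (Fin 3 × Fin 3)
  | .s1 => {(2, 2)}
  | .s2 δ => {(2, 2), (2, δ.castSucc)}
  | .s3 δ => {(2, 0), (2, δ.castSucc)}
  | .s4 δ => {(2, 2), (δ.castSucc, 2)}
  | .s5 δ => {(0, 2), (δ.castSucc, 2)}
  | .s6 δ δ' => {(2, 2), (δ.castSucc, δ'.castSucc)}
  | .s7 δ => {(1, 0), (2, δ.castSucc)}
  | .s8 δ => {(0, 1), (δ.castSucc, 2)}
  | .s9 δ δ' => {(2, 2), (2, δ.castSucc), (δ'.castSucc, 2)}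
  | .s10 δ δ' => {(2, 2), (δ.castSucc, δ'.castSucc)}
  | .s11 δ => {(δ.castSucc, 1), (2, 1)}
  | .s12 δ => {(1, 0), (2, δ.castSucc)}
  | .s13 δ => {(1, δ.castSucc), (1, 2)}
  | .s14 δ => {(0, 1), (δ.castSucc, 2)}
  | .s15 => {(1, 0), (0, 1), (1, 1)}
  | .s16 δ => {(1, 0), (1, δ.castSucc)}
  | .s17 δ => {(0, 1), (δ.castSucc, 1)}
  | .s18 => {(1, 1)}

/-- Levels that nonzero elements of the listed algebra attain exactly when the parameter function
is constant. -/
def Label.exceptionalLevels : Label → Finset (Fin 3 × Fin 3)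
  | .s11 _ => {(2, 0)}
  | .s13 _ => {(0, 2)}
  | _ => ∅

section ListedLevels

variable {I J I' J' : Set ℝ} {g β : ℝ → ℝ} {l l' : Label} {a b : ℝ} {τ : Fin 3 × Fin 3}

theorem Label.Admissible.mono (h : l.Admissible I J g β) (hI : I' ⊆ I) (hJ : J' ⊆ J) :
    l.Admissible I' J' g β := by
  cases l <;> simp only [Admissible] at h ⊢
  case s6 | s10 => exact h
  case s11 => exact h.mono hJ
  case s13 => exact h.mono hI
  case s16 => exact ⟨h.1.mono hI, h.2.mono hI⟩
  case s17 => exact ⟨h.1.mono hJ, h.2.mono hJ⟩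
  case s18 => exact ⟨⟨h.1.1.mono hI, h.1.2.mono hI⟩, h.2.1.mono hJ, h.2.2.mono hJ⟩

theorem ite_eq_castSucc (δ : Fin 2) : (if δ = 0 then 0 else 1 : Fin 3) = δ.castSucc := by
  decide +revert

theorem level_smul_density_add_affine_eq (f : ℝ → ℝ) (a b : ℝ) :
    level I (a • density f + b • affine 0 0 1) = 0 ∨
      level I (a • density f + b • affine 0 0 1) = 1 := by
  have hcomb : a • density f + b • affine 0 0 1 = density fun t => a * f t + b := by
    ext t <;> simp [affine, density]
  rw [hcomb, level_density]
  split_ifs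
  exacts [Or.inl rfl, Or.inr rfl]

theorem Label.level_mem (hI : IsOpenInterval I) (hJ : IsOpenInterval J)
    (hl : l.Admissible I J g β) (hab : ¬(a = 0 ∧ b = 0)) :
    (a • (l.comps g β).1 + b • (l.comps g β).2).level I J ∈ l.levels ∪ l.exceptionalLevels := by
  have hg := level_smul_density_add_affine_eq (I := I) g a b
  have hβ := level_smul_density_add_affine_eq (I := J) β a b
  cases l
  case s16 =>
    have hlevel := (hl.2.level hI).trans (if_neg hab)
    by_cases ha : a = 0 <;>
      simp_all [comps, levels, exceptionalLevels, FieldPair.level, level_affine, smul_affine,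
        ite_eq_castSucc, level_zero]
  case s17 =>
    have hlevel := (hl.2.level hJ).trans (if_neg hab)
    by_cases ha : a = 0 <;>
      simp_all [comps, levels, exceptionalLevels, FieldPair.level, level_affine, smul_affine,
        ite_eq_castSucc, level_zero]
  case s18 =>
    simp [comps, levels, exceptionalLevels, FieldPair.level, hl.1.2.level hI, hl.2.2.level hJ, hab]
  all_goals
    by_cases ha : a = 0 <;> by_cases hb : b = 0 <;>
      simp_all [comps, levels, exceptionalLevels, FieldPair.level, level_affine, smul_affine,
        affine_add, ite_eq_castSucc, level_zero]
  all_goals tauto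

theorem exists_level_density_add_affine_eq_one (hI : IsOpenInterval I) (f : ℝ → ℝ) :
    ∃ b : ℝ, level I (density f + b • affine 0 0 1) = 1 := by
  obtain ⟨t, ht⟩ := hI.nonempty
  have hcomb : density f + (1 - f t) • affine 0 0 1 = density fun x => f x + (1 - f t) := by
    ext x <;> simp [affine, density]
  refine ⟨1 - f t, ?_⟩
  rw [hcomb, level_density, if_neg fun h => one_ne_zero (α := ℝ) ?_]
  have hzero : f t + (1 - f t) = 0 := h ht
  linarith

theorem Label.exists_level_eq (hI : IsOpenInterval I) (hJ : IsOpenInterval J)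
    (hl : l.Admissible I J g β) (hτ : τ ∈ l.levels) :
    ∃ a b : ℝ, (a • (l.comps g β).1 + b • (l.comps g β).2).level I J = τ := by
  suffices h : (l.comps g β).1.level I J = τ ∨ (l.comps g β).2.level I J = τ ∨
      ∃ b : ℝ, ((l.comps g β).1 + b • (l.comps g β).2).level I J = τ by
    obtain h | h | ⟨b, h⟩ := h
    exacts [⟨1, 0, by simpa using h⟩, ⟨0, 1, by simpa using h⟩, ⟨1, b, by simpa using h⟩]
  have hdensity : ∀ {I : Set ℝ} {f : ℝ → ℝ}, IsOpenInterval I → NowhereConstantOn f I →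
      level I (density f) = 1 := fun hI hf => by simpa using hf.level (a := 0) (b := 1) hI
  obtain ⟨b, hb⟩ := exists_level_density_add_affine_eq_one hI g
  obtain ⟨b', hb'⟩ := exists_level_density_add_affine_eq_one hJ β
  cases l
  case s11 =>
    refine or_rotate.1 (Or.imp_left (fun h => ⟨b', h⟩) ?_)
    simp_all [comps, levels, FieldPair.level, level_affine, smul_affine, affine_add,
      ite_eq_castSucc]
    tauto
  case s13 =>
    refine or_rotate.1 (Or.imp_left (fun h => ⟨b, h⟩) ?_)
    simp_all [comps, levels, FieldPair.level, level_affine, smul_affine, affine_add,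
      ite_eq_castSucc]
    tauto
  case' s16 => have hg := hdensity hI hl.2
  case' s17 => have hβ := hdensity hJ hl.2
  case' s18 => have hg := hdensity hI hl.1.2; have hβ := hdensity hJ hl.2.2
  all_goals
    refine Or.imp_right (Or.imp_right fun h => ⟨1, h⟩) ?_
    simp_all [comps, levels, FieldPair.level, level_affine, affine_add, ite_eq_castSucc,
      level_zero]
  all_goals tauto

theorem Label.zero_notMem_levels (hl : l.Admissible I J g β) :
    0 ∉ l.levels ∪ l.exceptionalLevels := by
  cases l <;> simp only [Admissible] at hl <;> decide +revert

theorem Label.eq_of_levels_subset (hab : l.InAbelianPart ↔ l'.InAbelianPart) :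
    l.levels ⊆ l'.levels ∪ l'.exceptionalLevels →
      l'.levels ⊆ l.levels ∪ l.exceptionalLevels → l = l' := by
  cases l <;> cases l' <;>
    simp only [InAbelianPart, iff_true, iff_false, not_true, iff_self] at hab <;>
    clear hab <;>
    simp only [s2.injEq, s3.injEq, s4.injEq, s5.injEq, s6.injEq, s7.injEq, s8.injEq, s9.injEq,
      s10.injEq, s11.injEq, s12.injEq, s13.injEq, s14.injEq, s16.injEq, s17.injEq, reduceCtorEq,
      levels, exceptionalLevels, implies_true] <;>
    decide +revert

end ListedLevels

section ListedAlgebras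

variable {I J I' J' : Set ℝ} {g β g' β' : ℝ → ℝ} {l l' : Label}

theorem Label.Admissible.independentOn (hl : l.Admissible I J g β) :
    (l.comps g β).1.IndependentOn I J (l.comps g β).2 := by
  intro a b I' hI J' hJ hI' hJ' h₁ h₂
  by_contra hab
  have hl' := hl.mono hI hJ
  refine zero_notMem_levels hl' ?_
  convert level_mem hI' hJ' hl' hab
  exact (Prod.ext (level_eq_zero_iff.2 h₁) (level_eq_zero_iff.2 h₂)).symm

theorem Label.Admissible.isTwoDimSubalgebra (hI : IsOpenInterval I) (hJ : IsOpenInterval J)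
    (hl : l.Admissible I J g β) : IsTwoDimSubalgebra I J (l.algebra I J g β) := by
  obtain ⟨hF, hG⟩ := hl.isSmoothOn_comps
  rw [algebra_eq_spanFields]
  refine hl.independentOn.isTwoDimSubalgebra hI hJ hF hG ?_
  rw [lieBracket_vectorField hI.isOpen hJ.isOpen hF hG, bracket_comps]
  split_ifs
  · rw [vectorField_zero]
    exact Submodule.zero_mem _
  · exact Submodule.subset_span (mem_insert _ _)

theorem Label.Admissible.restrictsFaithfully (hI : IsOpenInterval I) (hJ : IsOpenInterval J)
    (hl : l.Admissible I J g β) : RestrictsFaithfully I J (l.algebra I J g β) := by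
  obtain ⟨hF, hG⟩ := hl.isSmoothOn_comps
  rw [algebra_eq_spanFields]
  exact hl.independentOn.restrictsFaithfully hI hJ hF hG

theorem Label.Admissible.isAbelian_iff (hI : IsOpenInterval I) (hJ : IsOpenInterval J)
    (hl : l.Admissible I J g β) : IsAbelian (l.algebra I J g β) ↔ l.InAbelianPart := by
  obtain ⟨hF, hG⟩ := hl.isSmoothOn_comps
  rw [algebra_eq_spanFields, isAbelian_spanFields hI hJ hF hG,
    lieBracket_vectorField hI.isOpen hJ.isOpen hF hG, bracket_comps]
  split_ifs with h
  · exact iff_of_true vectorField_zero h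
  · exact iff_of_false ((hl.independentOn.linearIndependent hI hJ hF hG).ne_zero 0) h

theorem Label.Admissible.levels_subset_elementLevels (hI : IsOpenInterval I)
    (hJ : IsOpenInterval J) (hl : l.Admissible I J g β) :
    ↑l.levels ⊆ elementLevels I J (l.algebra I J g β) := by
  intro τ hτ
  obtain ⟨hF, hG⟩ := hl.isSmoothOn_comps
  obtain ⟨a, b, hab⟩ := exists_level_eq hI hJ hl hτ
  refine ⟨fun hzero => zero_notMem_levels hl (Finset.mem_union_left _ (hzero ▸ hτ)), _,
    hF.linear_combination hG a b, ?_, hab⟩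
  rw [algebra_eq_spanFields]
  exact (mem_spanFields hI.isOpen hJ.isOpen hF hG).2 ⟨a, b, rfl⟩

theorem Label.Admissible.elementLevels_subset (hI : IsOpenInterval I) (hJ : IsOpenInterval J)
    (hl : l.Admissible I J g β) :
    elementLevels I J (l.algebra I J g β) ⊆ ↑(l.levels ∪ l.exceptionalLevels) := by
  rintro τ ⟨hτ, F, hF, hmem, rfl⟩
  obtain ⟨hF₁, hF₂⟩ := hl.isSmoothOn_comps
  rw [algebra_eq_spanFields, mem_spanFields hI.isOpen hJ.isOpen hF₁ hF₂] at hmem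
  obtain ⟨a, b, hab⟩ := hmem
  obtain ⟨h₁, h₂⟩ := (vectorField_eq_iff hI hJ (hF₁.linear_combination hF₂ a b) hF).1 hab
  have hlevel : (a • (l.comps g β).1 + b • (l.comps g β).2).level I J = F.level I J :=
    Prod.ext (level_congr h₁) (level_congr h₂)
  rw [← hlevel] at hτ ⊢
  refine level_mem hI hJ hl fun ⟨ha, hb⟩ => hτ ?_
  rw [ha, hb, zero_smul, zero_smul, add_zero]
  exact Prod.ext level_zero level_zero

theorem Label.Admissible.eq_of_gEquivalent (hI : IsOpenInterval I) (hJ : IsOpenInterval J)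
    (hI' : IsOpenInterval I') (hJ' : IsOpenInterval J') (hl : l.Admissible I J g β)
    (hl' : l'.Admissible I' J' g' β')
    (h : GEquivalent I J (l.algebra I J g β) I' J' (l'.algebra I' J' g' β')) : l = l' := by
  have hs := (hl.isTwoDimSubalgebra hI hJ).1
  have hs' := (hl'.isTwoDimSubalgebra hI' hJ').1
  have hlevels := h.elementLevels_eq hI hJ hs hs'
  have hab := h.isAbelian_iff hI hJ hs hs'
  rw [hl.isAbelian_iff hI hJ, hl'.isAbelian_iff hI' hJ'] at hab
  refine eq_of_levels_subset hab (Finset.coe_subset.1 ?_) (Finset.coe_subset.1 ?_)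
  · exact (hl.levels_subset_elementLevels hI hJ).trans
      (hlevels.subset.trans (hl'.elementLevels_subset hI' hJ'))
  · exact (hl'.levels_subset_elementLevels hI' hJ').trans
      (hlevels.superset.trans (hl.elementLevels_subset hI hJ))

end ListedAlgebras

/-- Two smooth pairs of block fields, over open intervals, that span a two-dimensional space over
all smaller intervals. -/
structure FieldPair.IsFrame (I J : Set ℝ) (F G : FieldPair) : Prop where
  isOpenInterval_left : IsOpenInterval I
  isOpenInterval_right : IsOpenInterval J
  isSmoothOn_left : F.IsSmoothOn I J
  isSmoothOn_right : G.IsSmoothOn I J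
  independentOn : F.IndependentOn I J G

/-- Some change of basis, followed by moves of the two blocks over smaller intervals, turns the
pairs `F` and `G` into the basis of a listed algebra. -/
def FieldPair.ReducesToList (I J : Set ℝ) (F G : FieldPair) : Prop :=
  ∃ a b c d : ℝ, a * d - b * c ≠ 0 ∧
    ∃ (I' J' : Set ℝ) (ρ : Reduction .txu I I') (τ : Reduction .yv J J') (l : Label) (g β : ℝ → ℝ),
      l.Admissible I' J' g β ∧
      ρ.Sends (a • F + b • G).1 (l.comps g β).1.1 ∧ τ.Sends (a • F + b • G).2 (l.comps g β).1.2 ∧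
      ρ.Sends (c • F + d • G).1 (l.comps g β).2.1 ∧ τ.Sends (c • F + d • G).2 (l.comps g β).2.2

section Frames

variable {I J I' J' : Set ℝ} {F G F' G' : FieldPair} {ρ : Reduction .txu I I'}
  {τ : Reduction .yv J J'} {σ : Block} {a b c d : ℝ}

theorem linear_combination_linear_combination {E : Type*} [AddCommGroup E] [Module ℝ E] (V W : E)
    (a b c d a' b' : ℝ) : a' • (a • V + b • W) + b' • (c • V + d • W) =
      (a' * a + b' * c) • V + (a' * b + b' * d) • W := by
  module

theorem eq_zero_and_eq_zero_of_det_ne_zero (hdet : a * d - b * c ≠ 0) {a' b' : ℝ}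
    (h₁ : a' * a + b' * c = 0) (h₂ : a' * b + b' * d = 0) : a' = 0 ∧ b' = 0 := by
  refine ⟨(mul_eq_zero.1 ?_).resolve_right hdet, (mul_eq_zero.1 ?_).resolve_right hdet⟩
  · linear_combination d * h₁ - c * h₂
  · linear_combination a * h₂ - b * h₁

theorem exists_reduction_of_subset (hI' : IsOpenInterval I') (h : I' ⊆ I) :
    ∃ ρ : Reduction σ I I', ∀ A, ContDiffOn ℝ ∞ A I → ρ.Sends A A := by
  have hmove := isMoveOn_add_const (σ := σ) hI' 0 0
  refine ⟨⟨_, I', h, hmove, by simp⟩, fun A hA => ⟨hA.mono h, fun t _ => ?_⟩⟩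
  simp [BlockMap.push, BlockMap.pushFstDeriv]

theorem FieldPair.IndependentOn.linear_combination (h : F.IndependentOn I J G)
    (hdet : a * d - b * c ≠ 0) : (a • F + b • G).IndependentOn I J (c • F + d • G) := by
  intro a' b' I' hI J' hJ hI' hJ' h₁ h₂
  rw [linear_combination_linear_combination] at h₁ h₂
  obtain ⟨e₁, e₂⟩ := h _ _ I' hI J' hJ hI' hJ' h₁ h₂
  exact eq_zero_and_eq_zero_of_det_ne_zero hdet e₁ e₂

theorem FieldPair.IndependentOn.of_sends (h : F.IndependentOn I J G) (h₁ : ρ.Sends F.1 F'.1)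
    (h₂ : τ.Sends F.2 F'.2) (h₃ : ρ.Sends G.1 G'.1) (h₄ : τ.Sends G.2 G'.2) :
    F'.IndependentOn I' J' G' := by
  intro a b I₀ hI J₀ hJ hI₀ hJ₀ hzero₁ hzero₂
  obtain ⟨I₁, hI₁, hI₁', hcomb₁⟩ := ((h₁.smul a).add (h₃.smul b)).exists_eqOn_zero hI₀ hI hzero₁
  obtain ⟨J₁, hJ₁, hJ₁', hcomb₂⟩ := ((h₂.smul a).add (h₄.smul b)).exists_eqOn_zero hJ₀ hJ hzero₂
  exact h a b I₁ hI₁ J₁ hJ₁ hI₁' hJ₁' hcomb₁ hcomb₂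

theorem FieldPair.IsFrame.linear_combination (h : F.IsFrame I J G) (hdet : a * d - b * c ≠ 0) :
    (a • F + b • G).IsFrame I J (c • F + d • G) :=
  ⟨h.1, h.2, h.3.linear_combination h.4 a b, h.3.linear_combination h.4 c d,
    h.5.linear_combination hdet⟩

theorem FieldPair.IsFrame.bracket_linear_combination (h : F.IsFrame I J G) (a b c d : ℝ) :
    EqOn ((a • F + b • G).bracket (c • F + d • G)).1 ((a * d - b * c) • (F.bracket G).1) I ∧
      EqOn ((a • F + b • G).bracket (c • F + d • G)).2 ((a * d - b * c) • (F.bracket G).2) J :=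
  ⟨BLP.bracket_linear_combination h.1.isOpen h.3.1 h.4.1 a b c d,
    BLP.bracket_linear_combination h.2.isOpen h.3.2 h.4.2 a b c d⟩

theorem FieldPair.IsFrame.of_sends (h : F.IsFrame I J G) (h₁ : ρ.Sends F.1 F'.1)
    (h₂ : τ.Sends F.2 F'.2) (h₃ : ρ.Sends G.1 G'.1) (h₄ : τ.Sends G.2 G'.2) :
    F'.IsFrame I' J' G' :=
  ⟨ρ.isOpenInterval, τ.isOpenInterval, ⟨h₁.contDiffOn, h₂.contDiffOn⟩,
    ⟨h₃.contDiffOn, h₄.contDiffOn⟩, h.5.of_sends h₁ h₂ h₃ h₄⟩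

theorem FieldPair.IsFrame.ne_zero_left (h : F.IsFrame I J G) : F ≠ 0 := by
  rintro rfl
  refine one_ne_zero (h.5 1 0 I Subset.rfl J Subset.rfl h.1 h.2 ?_ ?_).1 <;> intro t _ <;> simp

theorem FieldPair.IsFrame.ne_zero_right (h : F.IsFrame I J G) : G ≠ 0 := by
  rintro rfl
  refine one_ne_zero (h.5 0 1 I Subset.rfl J Subset.rfl h.1 h.2 ?_ ?_).2 <;> intro t _ <;> simp

theorem FieldPair.IsFrame.ne_zero_right_of_sends (h : F.IsFrame I J G) {A B : BlockField}
    (h₁ : ρ.Sends G.1 A) (h₂ : τ.Sends G.2 B) : ¬(A = 0 ∧ B = 0) := by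
  rintro ⟨rfl, rfl⟩
  obtain ⟨A, hA⟩ := ρ.exists_sends h.isSmoothOn_left.1
  obtain ⟨B, hB⟩ := τ.exists_sends h.isSmoothOn_left.2
  exact (h.of_sends (F' := (A, B)) (G' := 0) hA hB h₁ h₂).ne_zero_right rfl

theorem FieldPair.ReducesToList.of_sends (h : F'.ReducesToList I' J' G') (h₁ : ρ.Sends F.1 F'.1)
    (h₂ : τ.Sends F.2 F'.2) (h₃ : ρ.Sends G.1 G'.1) (h₄ : τ.Sends G.2 G'.2) :
    F.ReducesToList I J G := by
  obtain ⟨a, b, c, d, hdet, I'', J'', ρ', τ', l, g, β, hl, k₁, k₂, k₃, k₄⟩ := h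
  exact ⟨a, b, c, d, hdet, I'', J'', ρ.trans ρ', τ.trans τ', l, g, β, hl,
    ((h₁.smul a).add (h₃.smul b)).trans k₁, ((h₂.smul a).add (h₄.smul b)).trans k₂,
    ((h₁.smul c).add (h₃.smul d)).trans k₃, ((h₂.smul c).add (h₄.smul d)).trans k₄⟩

theorem FieldPair.ReducesToList.of_linear_combination (hdet : a * d - b * c ≠ 0)
    (h : (a • F + b • G).ReducesToList I J (c • F + d • G)) : F.ReducesToList I J G := by
  obtain ⟨a', b', c', d', hdet', I', J', ρ, τ, l, g, β, hl, hsends⟩ := h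
  simp only [linear_combination_linear_combination] at hsends
  refine ⟨_, _, _, _, ?_, I', J', ρ, τ, l, g, β, hl, hsends⟩
  convert mul_ne_zero hdet' hdet using 1
  ring

theorem FieldPair.ReducesToList.swap (h : G.ReducesToList I J F) : F.ReducesToList I J G := by
  refine of_linear_combination (a := 0) (b := 1) (c := 1) (d := 0) (by norm_num) ?_
  simpa only [zero_smul, one_smul, zero_add, add_zero] using h

theorem FieldPair.reducesToList_of_sends {A B A' B' : BlockField} (h₁ : ρ.Sends F.1 A)
    (h₂ : τ.Sends F.2 B) (h₃ : ρ.Sends G.1 A') (h₄ : τ.Sends G.2 B') (ha : a ≠ 0) (hd : d ≠ 0)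
    (l : Label) {g β : ℝ → ℝ} (hl : l.Admissible I' J' g β)
    (hF : (a • A, a • B) = (l.comps g β).1) (hG : (d • A', d • B') = (l.comps g β).2) :
    F.ReducesToList I J G := by
  refine ⟨a, 0, 0, d, by simp [ha, hd], I', J', ρ, τ, l, g, β, hl, ?_⟩
  rw [zero_smul, zero_smul, add_zero, zero_add, ← hF, ← hG]
  exact ⟨h₁.smul a, h₂.smul a, h₃.smul d, h₄.smul d⟩

theorem reducesToList_affine (hI : IsOpenInterval I) (hJ : IsOpenInterval J)
    {p q r p' q' r' P Q R P' Q' R' M N a d : ℝ} (hM : M ≠ 0) (hN : N ≠ 0) (ha : a ≠ 0) (hd : d ≠ 0)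
    (l : Label) {g β : ℝ → ℝ} (hl : ∀ I' J', l.Admissible I' J' g β)
    (hF : (affine (a * (M ^ 2 * p)) (a * q) (a * (M * r)),
      affine (a * (1 / N * p')) (a * q') (a * (N * r'))) = (l.comps g β).1)
    (hG : (affine (d * (M ^ 2 * P)) (d * Q) (d * (M * R)),
      affine (d * (1 / N * P')) (d * Q') (d * (N * R'))) = (l.comps g β).2) :
    FieldPair.ReducesToList I J (affine p q r, affine p' q' r')
      (affine P Q R, affine P' Q' R') := by
  obtain ⟨I', ρ, hρ⟩ := exists_reduction_dilate (σ := .txu) hI hM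
  obtain ⟨J', τ, hτ⟩ := exists_reduction_dilate (σ := .yv) hJ hN
  refine FieldPair.reducesToList_of_sends (hρ p q r) (hτ p' q' r') (hρ P Q R) (hτ P' Q' R') ha hd l
    (hl I' J') ?_ ?_
  · rw [← hF, smul_affine, smul_affine]; rfl
  · rw [← hG, smul_affine, smul_affine]; rfl

end Frames

section NonAbelian

variable {I J : Set ℝ} {F G : FieldPair} {σ : Block} {A B : BlockField}

/-- The shapes, in one block, of a pair `A`, `B` with `[A, B] = A` that has been straightened. -/
inductive IsNonAbelianForm (σ : Block) : BlockField → BlockField → Prop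
  | translation {s : ℝ} (hs : s ≠ 0) : IsNonAbelianForm σ (affine s 0 0) (affine 0 1 0)
  | dilation (δ : Fin 2) : IsNonAbelianForm σ (affine 0 0 δ.val) (affine 0 σ.weight⁻¹ 0)
  | vanishing (δ : Fin 2) : IsNonAbelianForm σ (affine 0 0 0) (affine 0 0 δ.val)

theorem exists_reduction_isNonAbelianForm (hI : IsOpenInterval I) (hA : ContDiffOn ℝ ∞ A I)
    (hB : ContDiffOn ℝ ∞ B I) (hb : EqOn (bracket σ.weight A B) A I) :
    ∃ (I' : Set ℝ) (ρ : Reduction σ I I') (A' B' : BlockField),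
      IsNonAbelianForm σ A' B' ∧ ρ.Sends A A' ∧ ρ.Sends B B' := by
  by_cases hfstA : ∀ t ∈ I, (A t).1 = 0
  · by_cases hfstB : ∀ t ∈ I, (B t).1 = 0
    · obtain ⟨δ, I', ρ, hρ⟩ := exists_reduction_of_fst_eq_zero (σ := σ) hI hB hfstB
      have hzero := eqOn_zero_of_bracket_eq_left hI.isOpen hA hB hb hfstA hfstB
      refine ⟨I', ρ, _, _, .vanishing δ, ?_, hρ⟩
      rw [affine_zero]
      exact ρ.sends_zero.congr hzero.symm (eqOn_refl _ _)
    · push Not at hfstB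
      obtain ⟨t, ht, hne⟩ := hfstB
      obtain ⟨δ, I', ρ, h₁, h₂⟩ := exists_reduction_of_bracket_eq_left_of_fst_eq_zero hI.isOpen
        hA hB hb hfstA ht hne
      exact ⟨I', ρ, _, _, .dilation δ, h₁, h₂⟩
  · push Not at hfstA
    obtain ⟨t, ht, hne⟩ := hfstA
    obtain ⟨s, I', ρ, hs, h₁, h₂⟩ := exists_reduction_of_bracket_eq_left hI.isOpen hA hB hb ht hne
    exact ⟨I', ρ, _, _, .translation hs, h₁, h₂⟩

theorem reducesToList_of_isNonAbelianForm {A A' B B' : BlockField}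
    (hA : IsNonAbelianForm .txu A A') (hB : IsNonAbelianForm .yv B B')
    (h : FieldPair.IsFrame I J (A, B) (A', B')) : FieldPair.ReducesToList I J (A, B) (A', B') := by
  have hone : (1 : ℝ) ≠ 0 := one_ne_zero
  have hF := h.ne_zero_left
  cases hA <;> cases hB
  case translation.translation s hs s' hs' =>
    exact reducesToList_affine h.1 h.2 hone (div_ne_zero hs' hs) (inv_ne_zero hs) hone .s1
      (g := 0) (β := 0) (fun _ _ => trivial) (by simp [Label.comps, hs, hs'])
      (by simp [Label.comps])
  case translation.dilation s hs δ =>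
    exact reducesToList_affine h.1 h.2 hone hs (inv_ne_zero hs) hone (.s2 δ) (g := 0) (β := 0)
      (fun _ _ => trivial) (by simp [Label.comps, hs]) (by simp [Label.comps, Block.weight])
  case translation.vanishing s hs δ =>
    exact reducesToList_affine h.1 h.2 hone hone (inv_ne_zero hs) hone (.s3 δ) (g := 0) (β := 0)
      (fun _ _ => trivial) (by simp [Label.comps, hs, affine_zero]) (by simp [Label.comps])
  case dilation.translation δ s hs =>
    exact reducesToList_affine h.1 h.2 (neg_ne_zero.2 hs) hone (inv_ne_zero hs) hone (.s4 δ)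
      (g := 0) (β := 0) (fun _ _ => trivial) (by simp [Label.comps, hs])
      (by simp [Label.comps, Block.weight])
  case dilation.dilation δ δ' =>
    refine reducesToList_affine h.1 h.2 hone hone hone hone (.s6 δ δ') (g := 0) (β := 0)
      (fun _ _ hδ => hF ?_) (by simp [Label.comps]) (by simp [Label.comps, Block.weight])
    simp_all [affine_zero]
  case dilation.vanishing δ δ' =>
    have hδ : δ ≠ 0 := fun hδ => hF (by simp [hδ, affine_zero])
    exact reducesToList_affine h.1 h.2 hone hone hone hone (.s7 δ') (g := 0) (β := 0)
      (fun _ _ => trivial) (by simp [Label.comps, Fin.eq_one_of_ne_zero δ hδ, affine_zero])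
      (by simp [Label.comps, Block.weight])
  case vanishing.translation δ s hs =>
    exact reducesToList_affine h.1 h.2 hone hone (inv_ne_zero hs) hone (.s5 δ) (g := 0) (β := 0)
      (fun _ _ => trivial) (by simp [Label.comps, hs, affine_zero]) (by simp [Label.comps])
  case vanishing.dilation δ δ' =>
    have hδ : δ' ≠ 0 := fun hδ => hF (by simp [hδ, affine_zero])
    exact reducesToList_affine h.1 h.2 hone hone hone hone (.s8 δ) (g := 0) (β := 0)
      (fun _ _ => trivial) (by simp [Label.comps, Fin.eq_one_of_ne_zero δ' hδ, affine_zero])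
      (by simp [Label.comps, Block.weight])
  case vanishing.vanishing => exact absurd (by simp [affine_zero]) hF

theorem FieldPair.IsFrame.reducesToList_of_bracket_eq_left (h : F.IsFrame I J G)
    (h₁ : EqOn (F.bracket G).1 F.1 I) (h₂ : EqOn (F.bracket G).2 F.2 J) :
    F.ReducesToList I J G := by
  obtain ⟨I', ρ, A, A', hA, hρA, hρA'⟩ :=
    exists_reduction_isNonAbelianForm h.1 h.isSmoothOn_left.1 h.isSmoothOn_right.1 h₁
  obtain ⟨J', τ, B, B', hB, hτB, hτB'⟩ :=
    exists_reduction_isNonAbelianForm h.2 h.isSmoothOn_left.2 h.isSmoothOn_right.2 h₂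
  have hframe := h.of_sends (F' := (A, B)) (G' := (A', B')) hρA hτB hρA' hτB'
  exact (reducesToList_of_isNonAbelianForm hA hB hframe).of_sends hρA hτB hρA' hτB'

end NonAbelian

/-- A frame whose two elements commute. -/
structure FieldPair.IsCommutingFrame (I J : Set ℝ) (F G : FieldPair) : Prop
    extends F.IsFrame I J G where
  bracket_fst : EqOn (F.bracket G).1 0 I
  bracket_snd : EqOn (F.bracket G).2 0 J

section Abelian

variable {I J I' J' : Set ℝ} {F G F' G' : FieldPair} {ρ : Reduction .txu I I'}
  {τ : Reduction .yv J J'} {σ : Block} {A B : BlockField} {a b c d t y : ℝ}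

theorem FieldPair.IsCommutingFrame.of_sends (h : F.IsCommutingFrame I J G)
    (h₁ : ρ.Sends F.1 F'.1) (h₂ : τ.Sends F.2 F'.2) (h₃ : ρ.Sends G.1 G'.1)
    (h₄ : τ.Sends G.2 G'.2) : F'.IsCommutingFrame I' J' G' :=
  ⟨h.toIsFrame.of_sends h₁ h₂ h₃ h₄, (h₁.bracket h₃).eqOn ρ.sends_zero h.bracket_fst,
    (h₂.bracket h₄).eqOn τ.sends_zero h.bracket_snd⟩

theorem FieldPair.IsCommutingFrame.linear_combination (h : F.IsCommutingFrame I J G)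
    (hdet : a * d - b * c ≠ 0) : (a • F + b • G).IsCommutingFrame I J (c • F + d • G) := by
  obtain ⟨h₁, h₂⟩ := h.toIsFrame.bracket_linear_combination a b c d
  refine ⟨h.toIsFrame.linear_combination hdet, fun t ht => ?_, fun y hy => ?_⟩
  · rw [h₁ ht, Pi.smul_apply, h.bracket_fst ht, Pi.zero_apply, smul_zero]
  · rw [h₂ hy, Pi.smul_apply, h.bracket_snd hy, Pi.zero_apply, smul_zero]

theorem FieldPair.IsCommutingFrame.swap (h : F.IsCommutingFrame I J G) :
    G.IsCommutingFrame I J F := by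
  simpa using h.linear_combination (a := 0) (b := 1) (c := 1) (d := 0) (by norm_num)

theorem exists_pow_three_eq (c : ℝ) : ∃ M : ℝ, M ^ 3 = c := by
  rcases le_total 0 c with h | h
  · exact ⟨_, Real.rpow_inv_natCast_pow h three_ne_zero⟩
  · exact ⟨_, by rw [Odd.neg_pow (by decide),
      Real.rpow_inv_natCast_pow (neg_nonneg.2 h) three_ne_zero, neg_neg]⟩

theorem exists_scaling (b c : ℝ) {k : ℝ} (hk : k ≠ 0) :
    ∃ M N : ℝ, M ≠ 0 ∧ N ≠ 0 ∧ ∃ δ δ' : Fin 2, N * b / M ^ 2 = δ.val ∧ N * M * c = k * δ'.val := by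
  rcases eq_or_ne b 0 with rfl | hb
  · obtain ⟨M, hM, δ', h⟩ := exists_mul_eq_zero_or_one (c / k)
    refine ⟨M, 1, hM, one_ne_zero, 0, δ', by simp, ?_⟩
    rw [← h]
    field_simp
  rcases eq_or_ne c 0 with rfl | hc
  · exact ⟨1, b⁻¹, one_ne_zero, inv_ne_zero hb, 1, 0, by simp [hb], by simp⟩
  obtain ⟨M, hM⟩ := exists_pow_three_eq (k * b / c)
  have hM₀ : M ≠ 0 := by
    rintro rfl
    exact div_ne_zero (mul_ne_zero hk hb) hc (by simpa using hM.symm)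
  refine ⟨M, M ^ 2 / b, hM₀, by positivity, 1, 1, by simp [field], ?_⟩
  calc M ^ 2 / b * M * c = M ^ 3 * c / b := by ring
    _ = k * (1 : Fin 2).val := by rw [hM]; simp [field]

theorem FieldPair.IsCommutingFrame.reducesToList_s9 (h : F.IsCommutingFrame I J G) (ht : t ∈ I)
    (hF : (F.1 t).1 ≠ 0) (hG : ∀ t ∈ I, (G.1 t).1 = 0) (hy : y ∈ J) (hG' : (G.2 y).1 ≠ 0)
    (hF' : ∀ y ∈ J, (F.2 y).1 = 0) : F.ReducesToList I J G := by
  obtain ⟨s, c, I', ρ, hs, h₁, h₃⟩ := exists_reduction_const_of_bracket_eq_zero_of_fst_eq_zero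
    h.1.1.isOpen h.isSmoothOn_left.1 h.isSmoothOn_right.1 h.bracket_fst ht hF hG
  obtain ⟨s', b, J', τ, hs', h₄, h₂⟩ := exists_reduction_const_of_bracket_eq_zero_of_fst_eq_zero
    h.1.2.isOpen h.isSmoothOn_right.2 h.isSmoothOn_left.2 h.swap.bracket_snd hy hG' hF'
  obtain ⟨M, N, hM, hN, δ, δ', hδ, hδ'⟩ :=
    exists_scaling (b / s) (c / s') (neg_ne_zero.2 (one_ne_zero (α := ℝ)))
  refine FieldPair.ReducesToList.of_sends (F' := (affine s 0 0, affine 0 0 b))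
    (G' := (affine 0 0 c, affine s' 0 0)) ?_ h₁ h₂ h₃ h₄
  have e₁ : 1 / (M ^ 2 * s) * (M ^ 2 * s) = 1 := by field_simp
  have e₂ : 1 / (M ^ 2 * s) * (N * b) = δ.val := by rw [← hδ]; field_simp
  have e₃ : N / s' * (M * c) = -δ'.val := by rw [← neg_one_mul, ← hδ']; field_simp
  have e₄ : N / s' * (1 / N * s') = 1 := by field_simp
  exact reducesToList_affine ρ.isOpenInterval τ.isOpenInterval hM hN
    (one_div_ne_zero (mul_ne_zero (pow_ne_zero 2 hM) hs)) (div_ne_zero hN hs') (.s9 δ δ')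
    (g := 0) (β := 0) (fun _ _ => trivial)
    (by simp only [mul_zero, e₁, e₂, Label.comps]) (by simp only [mul_zero, e₃, e₄, Label.comps])

theorem FieldPair.IsCommutingFrame.reducesToList_s10 (h : F.IsCommutingFrame I J G) (ht : t ∈ I)
    (hF : (F.1 t).1 ≠ 0) (hG : ∀ t ∈ I, (G.1 t).1 = 0) (hy : y ∈ J) (hF' : (F.2 y).1 ≠ 0)
    (hG' : ∀ y ∈ J, (G.2 y).1 = 0) : F.ReducesToList I J G := by
  obtain ⟨s, c, I', ρ, hs, h₁, h₃⟩ := exists_reduction_const_of_bracket_eq_zero_of_fst_eq_zero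
    h.1.1.isOpen h.isSmoothOn_left.1 h.isSmoothOn_right.1 h.bracket_fst ht hF hG
  obtain ⟨s', b, J', τ, hs', h₂, h₄⟩ := exists_reduction_const_of_bracket_eq_zero_of_fst_eq_zero
    h.1.2.isOpen h.isSmoothOn_left.2 h.isSmoothOn_right.2 h.bracket_snd hy hF' hG'
  obtain ⟨M, d, hM, hd, δ', δ, hδ', hδ⟩ := exists_scaling (s' * b / s) c (one_ne_zero (α := ℝ))
  have ha : 1 / (M ^ 2 * s) ≠ 0 := one_div_ne_zero (mul_ne_zero (pow_ne_zero 2 hM) hs)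
  have e₁ : 1 / (M ^ 2 * s) * (M ^ 2 * s) = 1 := by field_simp
  have e₂ : 1 / (M ^ 2 * s) * (1 / (s' * (1 / (M ^ 2 * s))) * s') = 1 := by field_simp
  have e₃ : d * (M * c) = δ.val := by rw [← one_mul (δ.val : ℝ), ← hδ, mul_assoc]
  have e₄ : d * (s' * (1 / (M ^ 2 * s)) * b) = δ'.val := by rw [← hδ']; field_simp
  refine FieldPair.ReducesToList.of_sends (reducesToList_affine ρ.isOpenInterval τ.isOpenInterval
    hM (mul_ne_zero hs' ha) ha hd (.s10 δ δ') (g := 0) (β := 0) (fun _ _ hzero => ?_)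
    (by simp only [mul_zero, e₁, e₂, Label.comps]) (by simp only [mul_zero, e₃, e₄, Label.comps]))
    h₁ h₂ h₃ h₄
  have hc : c = 0 := by simpa [(Prod.mk.inj hzero).1, hM, hd] using e₃
  have hb : b = 0 := by simpa [(Prod.mk.inj hzero).2, hM, hd, hs, hs'] using e₄
  exact h.ne_zero_right_of_sends h₃ h₄ (by simp [hc, hb, affine_zero])

theorem FieldPair.IsCommutingFrame.reducesToList_s11 (h : F.IsCommutingFrame I J G)
    (ht : t ∈ I) (hF : (F.1 t).1 ≠ 0) (hG : ∀ t ∈ I, (G.1 t).1 = 0)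
    (hF' : ∀ y ∈ J, (F.2 y).1 = 0) (hG' : ∀ y ∈ J, (G.2 y).1 = 0) (hy : y ∈ J)
    (hne : (G.2 y).2 ≠ 0) : F.ReducesToList I J G := by
  obtain ⟨s, r, I', ρ, hs, h₁, h₃⟩ := exists_reduction_const_of_bracket_eq_zero_of_fst_eq_zero
    h.1.1.isOpen h.isSmoothOn_left.1 h.isSmoothOn_right.1 h.bracket_fst ht hF hG
  obtain ⟨J', τ, f, hf, h₄, h₂⟩ := exists_reduction_density (σ := .yv) h.1.2.isOpen
    h.isSmoothOn_right.2 h.isSmoothOn_left.2 hG' hF' hy hne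
  obtain ⟨M, hM, δ, hδ⟩ := exists_mul_eq_zero_or_one r
  obtain ⟨I'', ρ', hρ'⟩ := exists_reduction_dilate (σ := .txu) ρ.isOpenInterval hM
  have hMs : M ^ 2 * s ≠ 0 := mul_ne_zero (pow_ne_zero 2 hM) hs
  refine FieldPair.reducesToList_of_sends (h₁.trans (hρ' s 0 0)) h₂ (h₃.trans (hρ' 0 0 r)) h₄
    (inv_ne_zero hMs) one_ne_zero (.s11 δ) (g := 0) (β := (M ^ 2 * s)⁻¹ • f)
    (contDiffOn_const.smul hf) ?_ ?_
  · simp only [Label.comps, smul_affine, smul_density, Block.dilation, inv_mul_cancel₀ hMs,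
      mul_zero]
  · simp [Label.comps, hδ]

theorem FieldPair.IsCommutingFrame.reducesToList_s12 (h : F.IsCommutingFrame I J G)
    (ht : t ∈ I) (hF : (F.1 t).1 ≠ 0) (hG : ∀ t ∈ I, (G.1 t).1 = 0)
    (hF' : ∀ y ∈ J, (F.2 y).1 = 0) (hG' : EqOn G.2 0 J) : F.ReducesToList I J G := by
  obtain ⟨s, r, I', ρ, hs, h₁, h₃⟩ := exists_reduction_const_of_bracket_eq_zero_of_fst_eq_zero
    h.1.1.isOpen h.isSmoothOn_left.1 h.isSmoothOn_right.1 h.bracket_fst ht hF hG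
  obtain ⟨δ, J', τ, h₂⟩ := exists_reduction_of_fst_eq_zero (σ := .yv) h.1.2 h.isSmoothOn_left.2 hF'
  have h₄ : τ.Sends G.2 (affine 0 0 0) := .zero_of_eqOn_zero hG'
  have hr : r ≠ 0 := fun hr => h.ne_zero_right_of_sends h₃ h₄ (by simp [hr, affine_zero])
  exact .of_sends (reducesToList_affine ρ.isOpenInterval τ.isOpenInterval one_ne_zero hs
    (inv_ne_zero hs) (inv_ne_zero hr) (.s12 δ) (g := 0) (β := 0) (fun _ _ => trivial)
    (by simp [Label.comps, hs]) (by simp [Label.comps, hr, affine_zero])) h₁ h₂ h₃ h₄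

theorem FieldPair.IsCommutingFrame.reducesToList_s13 (h : F.IsCommutingFrame I J G)
    (hy : y ∈ J) (hF' : (F.2 y).1 ≠ 0) (hG' : ∀ y ∈ J, (G.2 y).1 = 0)
    (hF : ∀ t ∈ I, (F.1 t).1 = 0) (hG : ∀ t ∈ I, (G.1 t).1 = 0) (ht : t ∈ I)
    (hne : (G.1 t).2 ≠ 0) : F.ReducesToList I J G := by
  obtain ⟨s, r, J', τ, hs, h₂, h₄⟩ := exists_reduction_const_of_bracket_eq_zero_of_fst_eq_zero
    h.1.2.isOpen h.isSmoothOn_left.2 h.isSmoothOn_right.2 h.bracket_snd hy hF' hG'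
  obtain ⟨I', ρ, f, hf, h₃, h₁⟩ := exists_reduction_density (σ := .txu) h.1.1.isOpen
    h.isSmoothOn_right.1 h.isSmoothOn_left.1 hG hF ht hne
  obtain ⟨N, hN, δ, hδ⟩ := exists_mul_eq_zero_or_one r
  obtain ⟨J'', τ', hτ'⟩ := exists_reduction_dilate (σ := .yv) τ.isOpenInterval hN
  have hNs : 1 / N * s ≠ 0 := mul_ne_zero (one_div_ne_zero hN) hs
  refine FieldPair.reducesToList_of_sends h₁ (h₂.trans (hτ' s 0 0)) h₃ (h₄.trans (hτ' 0 0 r))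
    (inv_ne_zero hNs) one_ne_zero (.s13 δ) (g := (1 / N * s)⁻¹ • f) (β := 0)
    (contDiffOn_const.smul hf) ?_ ?_
  · simp only [Label.comps, smul_affine, smul_density, Block.dilation, inv_mul_cancel₀ hNs,
      mul_zero]
  · simp [Label.comps, hδ]

theorem FieldPair.IsCommutingFrame.reducesToList_s14 (h : F.IsCommutingFrame I J G)
    (hy : y ∈ J) (hF' : (F.2 y).1 ≠ 0) (hG' : ∀ y ∈ J, (G.2 y).1 = 0)
    (hF : ∀ t ∈ I, (F.1 t).1 = 0) (hG : EqOn G.1 0 I) : F.ReducesToList I J G := by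
  obtain ⟨s, r, J', τ, hs, h₂, h₄⟩ := exists_reduction_const_of_bracket_eq_zero_of_fst_eq_zero
    h.1.2.isOpen h.isSmoothOn_left.2 h.isSmoothOn_right.2 h.bracket_snd hy hF' hG'
  obtain ⟨δ, I', ρ, h₁⟩ := exists_reduction_of_fst_eq_zero (σ := .txu) h.1.1 h.isSmoothOn_left.1 hF
  have h₃ : ρ.Sends G.1 (affine 0 0 0) := .zero_of_eqOn_zero hG
  have hr : r ≠ 0 := fun hr => h.ne_zero_right_of_sends h₃ h₄ (by simp [hr, affine_zero])
  exact .of_sends (reducesToList_affine ρ.isOpenInterval τ.isOpenInterval (neg_ne_zero.2 hs)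
    one_ne_zero (inv_ne_zero hs) (inv_ne_zero hr) (.s14 δ) (g := 0) (β := 0) (fun _ _ => trivial)
    (by simp [Label.comps, hs]) (by simp [Label.comps, hr, affine_zero])) h₁ h₂ h₃ h₄

end Abelian

/-- No nontrivial combination of the block fields `A` and `B` vanishes over smaller intervals. -/
def BlockField.IndependentOn (I : Set ℝ) (A B : BlockField) : Prop :=
  ∀ a b : ℝ, ∀ I' ⊆ I, IsOpenInterval I' → EqOn (a • A + b • B) 0 I' → a = 0 ∧ b = 0

/-- A frame in which neither `∂_t` nor `∂_y` occurs. -/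
structure FieldPair.IsVerticalFrame (I J : Set ℝ) (F G : FieldPair) : Prop
    extends F.IsFrame I J G where
  fst_left_eq_zero : ∀ t ∈ I, (F.1 t).1 = 0
  snd_left_eq_zero : ∀ y ∈ J, (F.2 y).1 = 0
  fst_right_eq_zero : ∀ t ∈ I, (G.1 t).1 = 0
  snd_right_eq_zero : ∀ y ∈ J, (G.2 y).1 = 0

section Vertical

variable {I J I' J' : Set ℝ} {F G : FieldPair} {σ : Block} {A B : BlockField} {a b c d : ℝ}

theorem FieldPair.IsFrame.mono (h : F.IsFrame I J G) (hI' : IsOpenInterval I')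
    (hJ' : IsOpenInterval J') (hI : I' ⊆ I) (hJ : J' ⊆ J) : F.IsFrame I' J' G :=
  ⟨hI', hJ', ⟨h.3.1.mono hI, h.3.2.mono hJ⟩, ⟨h.4.1.mono hI, h.4.2.mono hJ⟩,
    fun a b _ hI₀ _ hJ₀ => h.5 a b _ (hI₀.trans hI) _ (hJ₀.trans hJ)⟩

theorem FieldPair.IsVerticalFrame.mono (h : F.IsVerticalFrame I J G) (hI' : IsOpenInterval I')
    (hJ' : IsOpenInterval J') (hI : I' ⊆ I) (hJ : J' ⊆ J) : F.IsVerticalFrame I' J' G :=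
  ⟨h.1.mono hI' hJ' hI hJ, fun t ht => h.2 t (hI ht), fun y hy => h.3 y (hJ hy),
    fun t ht => h.4 t (hI ht), fun y hy => h.5 y (hJ hy)⟩

theorem FieldPair.IsVerticalFrame.linear_combination (h : F.IsVerticalFrame I J G)
    (hdet : a * d - b * c ≠ 0) : (a • F + b • G).IsVerticalFrame I J (c • F + d • G) := by
  refine ⟨h.1.linear_combination hdet, fun t ht => ?_, fun y hy => ?_, fun t ht => ?_,
    fun y hy => ?_⟩
  · simp [h.2 t ht, h.4 t ht]
  · simp [h.3 y hy, h.5 y hy]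
  · simp [h.2 t ht, h.4 t ht]
  · simp [h.3 y hy, h.5 y hy]

theorem FieldPair.IsFrame.reducesToList_of_subset (h : F.IsFrame I J G) (hI' : IsOpenInterval I')
    (hJ' : IsOpenInterval J') (hI : I' ⊆ I) (hJ : J' ⊆ J) (hlist : F.ReducesToList I' J' G) :
    F.ReducesToList I J G := by
  obtain ⟨ρ, hρ⟩ := exists_reduction_of_subset (σ := .txu) hI' hI
  obtain ⟨τ, hτ⟩ := exists_reduction_of_subset (σ := .yv) hJ' hJ
  exact hlist.of_sends (hρ _ h.3.1) (hτ _ h.3.2) (hρ _ h.4.1) (hτ _ h.4.2)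

theorem BlockField.exists_eqOn_zero_of_not_independentOn (h : ¬A.IndependentOn I B) :
    ∃ a b c d : ℝ, a * d - b * c ≠ 0 ∧ ∃ I' ⊆ I, IsOpenInterval I' ∧
      EqOn (c • A + d • B) 0 I' := by
  simp only [IndependentOn, not_forall] at h
  obtain ⟨c, d, I', hI', hint, hzero, hne⟩ := h
  refine ⟨d, -c, c, d, fun hdet => hne ?_, I', hI', hint, hzero⟩
  exact ⟨by nlinarith [mul_self_nonneg c, mul_self_nonneg d],
    by nlinarith [mul_self_nonneg c, mul_self_nonneg d]⟩

theorem BlockField.IndependentOn.linear_combination (h : A.IndependentOn I B)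
    (hdet : a * d - b * c ≠ 0) : (a • A + b • B).IndependentOn I (c • A + d • B) := by
  intro a' b' I' hI hI' hzero
  rw [linear_combination_linear_combination] at hzero
  obtain ⟨e₁, e₂⟩ := h _ _ I' hI hI' hzero
  exact eq_zero_and_eq_zero_of_det_ne_zero hdet e₁ e₂

theorem BlockField.IndependentOn.exists_reduction_density (h : A.IndependentOn I B)
    (hI : IsOpenInterval I) (hA : ContDiffOn ℝ ∞ A I) (hB : ContDiffOn ℝ ∞ B I)
    (hfstA : ∀ t ∈ I, (A t).1 = 0) (hfstB : ∀ t ∈ I, (B t).1 = 0) :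
    ∃ (I' : Set ℝ) (ρ : Reduction σ I I') (f : ℝ → ℝ),
      (ContDiffOn ℝ ∞ f I' ∧ NowhereConstantOn f I') ∧
        ρ.Sends A (affine 0 0 1) ∧ ρ.Sends B (density f) := by
  obtain ⟨t, ht, hne⟩ : ∃ t ∈ I, (A t).2 ≠ 0 := by
    by_contra! hzero
    refine one_ne_zero (h 1 0 I Subset.rfl hI fun t ht => ?_).1
    simpa using Prod.ext (hfstA t ht) (hzero t ht)
  obtain ⟨I', ρ, f, hf, h₁, h₂⟩ :=
    BLP.exists_reduction_density (σ := σ) hI.isOpen hA hB hfstA hfstB ht hne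
  refine ⟨I', ρ, f, ⟨hf, fun I₀ hsub hI₀ hconst => ?_⟩, h₁, h₂⟩
  obtain ⟨c, hc⟩ := hconst
  obtain ⟨I₁, hI₁, hint, hzero⟩ := ((h₁.smul (-c)).add (h₂.smul 1)).exists_eqOn_zero hI₀ hsub
    fun t ht => by simp [affine, density, hc t ht]
  exact one_ne_zero (h (-c) 1 I₁ hI₁ hint hzero).2

theorem FieldPair.IsVerticalFrame.reducesToList_s18 (h : F.IsVerticalFrame I J G)
    (ht : F.1.IndependentOn I G.1) (hy : F.2.IndependentOn J G.2) : F.ReducesToList I J G := by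
  obtain ⟨I', ρ, g, hg, h₁, h₃⟩ := ht.exists_reduction_density (σ := .txu) h.1.1
    h.isSmoothOn_left.1 h.isSmoothOn_right.1 h.2 h.4
  obtain ⟨J', τ, β, hβ, h₂, h₄⟩ := hy.exists_reduction_density (σ := .yv) h.1.2
    h.isSmoothOn_left.2 h.isSmoothOn_right.2 h.3 h.5
  exact FieldPair.reducesToList_of_sends h₁ h₂ h₃ h₄ one_ne_zero one_ne_zero .s18 ⟨hg, hβ⟩
    (by simp [Label.comps]) (by simp [Label.comps])

theorem FieldPair.IsVerticalFrame.reducesToList_s16 (h : F.IsVerticalFrame I J G)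
    (ht : F.1.IndependentOn I G.1) (hy : EqOn G.2 0 J) : F.ReducesToList I J G := by
  obtain ⟨I', ρ, g, hg, h₁, h₃⟩ := ht.exists_reduction_density (σ := .txu) h.1.1
    h.isSmoothOn_left.1 h.isSmoothOn_right.1 h.2 h.4
  obtain ⟨δ, J', τ, h₂⟩ :=
    exists_reduction_of_fst_eq_zero (σ := .yv) h.1.2 h.isSmoothOn_left.2 h.3
  exact FieldPair.reducesToList_of_sends h₁ h₂ h₃ (.zero_of_eqOn_zero hy) one_ne_zero one_ne_zero
    (.s16 δ) (β := 0) hg (by simp [Label.comps]) (by simp [Label.comps, affine_zero])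

theorem FieldPair.IsVerticalFrame.reducesToList_s17 (h : F.IsVerticalFrame I J G)
    (ht : EqOn G.1 0 I) (hy : F.2.IndependentOn J G.2) : F.ReducesToList I J G := by
  obtain ⟨δ, I', ρ, h₁⟩ :=
    exists_reduction_of_fst_eq_zero (σ := .txu) h.1.1 h.isSmoothOn_left.1 h.2
  obtain ⟨J', τ, β, hβ, h₂, h₄⟩ := hy.exists_reduction_density (σ := .yv) h.1.2
    h.isSmoothOn_left.2 h.isSmoothOn_right.2 h.3 h.5
  exact FieldPair.reducesToList_of_sends h₁ h₂ (.zero_of_eqOn_zero ht) h₄ one_ne_zero one_ne_zero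
    (.s17 δ) (g := 0) hβ (by simp [Label.comps]) (by simp [Label.comps, affine_zero])

theorem FieldPair.IsVerticalFrame.reducesToList_s15 (h : F.IsVerticalFrame I J G)
    (ht : EqOn G.1 0 I) (hy : EqOn F.2 0 J) : F.ReducesToList I J G := by
  obtain ⟨δ, I', ρ, h₁⟩ :=
    exists_reduction_of_fst_eq_zero (σ := .txu) h.1.1 h.isSmoothOn_left.1 h.2
  obtain ⟨δ', J', τ, h₄⟩ :=
    exists_reduction_of_fst_eq_zero (σ := .yv) h.1.2 h.isSmoothOn_right.2 h.5
  have h₂ : τ.Sends F.2 (affine 0 0 0) := .zero_of_eqOn_zero hy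
  have h₃ : ρ.Sends G.1 (affine 0 0 0) := .zero_of_eqOn_zero ht
  have hframe := h.1.of_sends (F' := (affine 0 0 δ.val, affine 0 0 0))
    (G' := (affine 0 0 0, affine 0 0 δ'.val)) h₁ h₂ h₃ h₄
  have hδ : δ ≠ 0 := fun hδ => hframe.ne_zero_left (by simp [hδ, affine_zero])
  have hδ' : δ' ≠ 0 := fun hδ => hframe.ne_zero_right (by simp [hδ, affine_zero])
  exact FieldPair.reducesToList_of_sends h₁ h₂ h₃ h₄ one_ne_zero one_ne_zero .s15 (g := 0) (β := 0)
    trivial (by simp [Label.comps, Fin.eq_one_of_ne_zero δ hδ, affine_zero])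
    (by simp [Label.comps, Fin.eq_one_of_ne_zero δ' hδ', affine_zero])

theorem FieldPair.IsVerticalFrame.reducesToList_of_linear_combination
    (h : F.IsVerticalFrame I J G) (hdet : a * d - b * c ≠ 0) (hI' : IsOpenInterval I')
    (hJ' : IsOpenInterval J') (hI : I' ⊆ I) (hJ : J' ⊆ J)
    (hlist : (a • F + b • G).IsVerticalFrame I' J' (c • F + d • G) →
      (a • F + b • G).ReducesToList I' J' (c • F + d • G)) : F.ReducesToList I J G :=
  have hframe := h.linear_combination hdet
  .of_linear_combination hdet
    (hframe.1.reducesToList_of_subset hI' hJ' hI hJ (hlist (hframe.mono hI' hJ' hI hJ)))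

theorem FieldPair.IsVerticalFrame.reducesToList_of_fst_eqOn_zero (h : F.IsVerticalFrame I J G)
    (ht : EqOn G.1 0 I) : F.ReducesToList I J G := by
  by_cases hy : F.2.IndependentOn J G.2
  · exact h.reducesToList_s17 ht hy
  simp only [BlockField.IndependentOn, not_forall] at hy
  obtain ⟨a, b, J', hJ, hJ', hzero, hne⟩ := hy
  have ha : a ≠ 0 := by
    rintro rfl
    exact hne (h.independentOn 0 b I Subset.rfl J' hJ h.1.1 hJ' (fun t hmem => by simp [ht hmem])
      hzero)
  refine h.reducesToList_of_linear_combination (a := a) (b := b) (c := 0) (d := 1) (by simpa)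
    h.1.1 hJ' Subset.rfl hJ fun hframe => hframe.reducesToList_s15 (fun t hmem => ?_) hzero
  simp [ht hmem]

theorem FieldPair.IsVerticalFrame.reducesToList (h : F.IsVerticalFrame I J G) :
    F.ReducesToList I J G := by
  by_cases ht : F.1.IndependentOn I G.1
  · by_cases hy : F.2.IndependentOn J G.2
    · exact h.reducesToList_s18 ht hy
    obtain ⟨a, b, c, d, hdet, J', hJ, hJ', hzero⟩ :=
      BlockField.exists_eqOn_zero_of_not_independentOn hy
    exact h.reducesToList_of_linear_combination hdet h.1.1 hJ' Subset.rfl hJ fun hframe =>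
      hframe.reducesToList_s16 (ht.linear_combination hdet) hzero
  · obtain ⟨a, b, c, d, hdet, I', hI, hI', hzero⟩ :=
      BlockField.exists_eqOn_zero_of_not_independentOn ht
    exact h.reducesToList_of_linear_combination hdet hI' h.1.2 hI Subset.rfl fun hframe =>
      hframe.reducesToList_of_fst_eqOn_zero hzero

end Vertical

section CommutingFrames

variable {I J : Set ℝ} {F G : FieldPair} {t y : ℝ}

theorem FieldPair.IsCommutingFrame.reducesToList_of_fst_right_eq_zero
    (h : F.IsCommutingFrame I J G) (ht : t ∈ I) (hF : (F.1 t).1 ≠ 0)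
    (hG : ∀ t ∈ I, (G.1 t).1 = 0) : F.ReducesToList I J G := by
  by_cases hG' : ∀ y ∈ J, (G.2 y).1 = 0
  · by_cases hF' : ∀ y ∈ J, (F.2 y).1 = 0
    · by_cases hsnd : ∀ y ∈ J, (G.2 y).2 = 0
      · exact h.reducesToList_s12 ht hF hG hF' fun y hy => Prod.ext (hG' y hy) (hsnd y hy)
      · push Not at hsnd
        obtain ⟨y, hy, hne⟩ := hsnd
        exact h.reducesToList_s11 ht hF hG hF' hG' hy hne
    · push Not at hF'
      obtain ⟨y, hy, hne⟩ := hF'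
      exact h.reducesToList_s10 ht hF hG hy hne hG'
  push Not at hG'
  obtain ⟨y, hy, hne⟩ := hG'
  obtain ⟨ρ, hρ⟩ := exists_reduction_of_subset (σ := .txu) h.1.1 Subset.rfl
  obtain ⟨c, J', τ, B, B', h₄, h₂, ⟨y, hy, hne⟩, hzero⟩ :=
    exists_reduction_smul_add_fst_eq_zero (σ := .yv) h.1.2.isOpen h.isSmoothOn_right.2
      h.isSmoothOn_left.2 h.swap.bracket_snd hy hne
  have h₁ := hρ _ h.isSmoothOn_left.1
  have h₃ := hρ _ h.isSmoothOn_right.1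
  have hcomm := h.of_sends (F' := (F.1, B')) (G' := (G.1, B)) h₁ h₂ h₃ h₄
  have hdet : (1 : ℝ) * 1 - c * 0 ≠ 0 := by norm_num
  refine .of_sends (F' := (F.1, B')) (G' := (G.1, B)) (.of_linear_combination hdet
    ((hcomm.linear_combination hdet).reducesToList_s9 ht ?_ (fun t ht => ?_) hy ?_
      fun y hy => ?_)) h₁ h₂ h₃ h₄
  · simpa [hG t ht] using hF
  · simp [hG t ht]
  · simpa using hne
  · simpa [add_comm] using hzero y hy

theorem FieldPair.IsCommutingFrame.reducesToList_of_fst_left_ne_zero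
    (h : F.IsCommutingFrame I J G) (ht : t ∈ I) (hF : (F.1 t).1 ≠ 0) : F.ReducesToList I J G := by
  obtain ⟨τ, hτ⟩ := exists_reduction_of_subset (σ := .yv) h.1.2 Subset.rfl
  obtain ⟨c, I', ρ, A, A', h₁, h₃, ⟨t, ht, hne⟩, hzero⟩ :=
    exists_reduction_smul_add_fst_eq_zero (σ := .txu) h.1.1.isOpen h.isSmoothOn_left.1
      h.isSmoothOn_right.1 h.bracket_fst ht hF
  have h₂ := hτ _ h.isSmoothOn_left.2
  have h₄ := hτ _ h.isSmoothOn_right.2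
  have hcomm := h.of_sends (F' := (A, F.2)) (G' := (A', G.2)) h₁ h₂ h₃ h₄
  have hdet : (1 : ℝ) * 1 - 0 * c ≠ 0 := by norm_num
  refine .of_sends (F' := (A, F.2)) (G' := (A', G.2)) (.of_linear_combination hdet
    ((hcomm.linear_combination hdet).reducesToList_of_fst_right_eq_zero ht ?_ fun t ht => ?_))
      h₁ h₂ h₃ h₄
  · simpa using hne
  · simpa using hzero t ht

theorem FieldPair.IsCommutingFrame.reducesToList_of_snd_right_eq_zero
    (h : F.IsCommutingFrame I J G) (hF : ∀ t ∈ I, (F.1 t).1 = 0) (hG : ∀ t ∈ I, (G.1 t).1 = 0)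
    (hy : y ∈ J) (hF' : (F.2 y).1 ≠ 0) (hG' : ∀ y ∈ J, (G.2 y).1 = 0) :
    F.ReducesToList I J G := by
  by_cases hsnd : ∀ t ∈ I, (G.1 t).2 = 0
  · exact h.reducesToList_s14 hy hF' hG' hF fun t ht => Prod.ext (hG t ht) (hsnd t ht)
  · push Not at hsnd
    obtain ⟨t, ht, hne⟩ := hsnd
    exact h.reducesToList_s13 hy hF' hG' hF hG ht hne

theorem FieldPair.IsCommutingFrame.reducesToList_of_snd_left_ne_zero
    (h : F.IsCommutingFrame I J G) (hF : ∀ t ∈ I, (F.1 t).1 = 0) (hG : ∀ t ∈ I, (G.1 t).1 = 0)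
    (hy : y ∈ J) (hF' : (F.2 y).1 ≠ 0) : F.ReducesToList I J G := by
  obtain ⟨ρ, hρ⟩ := exists_reduction_of_subset (σ := .txu) h.1.1 Subset.rfl
  obtain ⟨c, J', τ, B, B', h₂, h₄, ⟨y, hy, hne⟩, hzero⟩ :=
    exists_reduction_smul_add_fst_eq_zero (σ := .yv) h.1.2.isOpen h.isSmoothOn_left.2
      h.isSmoothOn_right.2 h.bracket_snd hy hF'
  have h₁ := hρ _ h.isSmoothOn_left.1
  have h₃ := hρ _ h.isSmoothOn_right.1
  have hcomm := h.of_sends (F' := (F.1, B)) (G' := (G.1, B')) h₁ h₂ h₃ h₄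
  have hdet : (1 : ℝ) * 1 - 0 * c ≠ 0 := by norm_num
  refine .of_sends (F' := (F.1, B)) (G' := (G.1, B')) (.of_linear_combination hdet
    ((hcomm.linear_combination hdet).reducesToList_of_snd_right_eq_zero (fun t ht => ?_)
      (fun t ht => ?_) hy ?_ fun y hy => ?_)) h₁ h₂ h₃ h₄
  · simp [hF t ht]
  · simp [hF t ht, hG t ht]
  · simpa using hne
  · simpa using hzero y hy

theorem FieldPair.IsCommutingFrame.reducesToList (h : F.IsCommutingFrame I J G) :
    F.ReducesToList I J G := by
  by_cases hF : ∀ t ∈ I, (F.1 t).1 = 0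
  · by_cases hG : ∀ t ∈ I, (G.1 t).1 = 0
    · by_cases hF' : ∀ y ∈ J, (F.2 y).1 = 0
      · by_cases hG' : ∀ y ∈ J, (G.2 y).1 = 0
        · exact IsVerticalFrame.reducesToList ⟨h.1, hF, hF', hG, hG'⟩
        · push Not at hG'
          obtain ⟨y, hy, hne⟩ := hG'
          exact (h.swap.reducesToList_of_snd_left_ne_zero hG hF hy hne).swap
      · push Not at hF'
        obtain ⟨y, hy, hne⟩ := hF'
        exact h.reducesToList_of_snd_left_ne_zero hF hG hy hne
    · push Not at hG
      obtain ⟨t, ht, hne⟩ := hG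
      exact (h.swap.reducesToList_of_fst_left_ne_zero ht hne).swap
  · push Not at hF
    obtain ⟨t, ht, hne⟩ := hF
    exact h.reducesToList_of_fst_left_ne_zero ht hne

end CommutingFrames

section Completeness

variable {I J : Set ℝ} {F G : FieldPair} {s : Submodule ℝ (Pt → Pt)}

theorem exists_linearIndependent_span_pair_eq {E : Type*} [AddCommGroup E] [Module ℝ E]
    {s : Submodule ℝ E} (h : Module.finrank ℝ s = 2) :
    ∃ V ∈ s, ∃ W ∈ s, LinearIndependent ℝ ![V, W] ∧ Submodule.span ℝ {V, W} = s := by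
  have : FiniteDimensional ℝ s := Module.finite_of_finrank_pos (by omega)
  have b := Module.finBasisOfFinrankEq ℝ s h
  have hb : ![(b 0 : E), (b 1 : E)] = s.subtype ∘ b := by
    funext i
    fin_cases i <;> rfl
  refine ⟨_, (b 0).2, _, (b 1).2, ?_, ?_⟩
  · rw [hb]
    exact b.linearIndependent.map' s.subtype (Submodule.ker_subtype s)
  · rw [← Matrix.range_cons_cons_empty _ _ ![], hb, range_comp, Submodule.span_image, b.span_eq,
      Submodule.map_top, Submodule.range_subtype]

theorem IsTwoDimSubalgebra.exists_spanFields_eq (hI : IsOpen I) (hJ : IsOpen J)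
    (h : IsTwoDimSubalgebra I J s) : ∃ F G : FieldPair, F.IsSmoothOn I J ∧ G.IsSmoothOn I J ∧
      LinearIndependent ℝ ![vectorField I J F, vectorField I J G] ∧ spanFields I J F G = s := by
  obtain ⟨V, hV, W, hW, hli, hspan⟩ := exists_linearIndependent_span_pair_eq h.2.1
  obtain ⟨F, hF, rfl⟩ := (mem_symAlgebra_iff hI hJ).1 (h.1 hV)
  obtain ⟨G, hG, rfl⟩ := (mem_symAlgebra_iff hI hJ).1 (h.1 hW)
  exact ⟨F, G, hF, hG, hli, hspan⟩

theorem exists_eqOn_bracket_of_isTwoDimSubalgebra (hI : IsOpenInterval I) (hJ : IsOpenInterval J)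
    (hF : F.IsSmoothOn I J) (hG : G.IsSmoothOn I J)
    (h : IsTwoDimSubalgebra I J (spanFields I J F G)) :
    ∃ a b : ℝ, EqOn (F.bracket G).1 (a • F + b • G).1 I ∧
      EqOn (F.bracket G).2 (a • F + b • G).2 J := by
  have hmem := h.2.2 _ (Submodule.subset_span (mem_insert _ _)) _
    (Submodule.subset_span (mem_insert_of_mem _ rfl))
  rw [lieBracket_vectorField hI.isOpen hJ.isOpen hF hG,
    mem_spanFields hI.isOpen hJ.isOpen hF hG] at hmem
  obtain ⟨a, b, hab⟩ := hmem
  exact ⟨a, b, (vectorField_eq_iff hI hJ (hF.bracket hI.isOpen hJ.isOpen hG)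
    (hF.linear_combination hG a b)).1 hab.symm⟩

theorem exists_mul_sub_mul_eq_one {a b : ℝ} (h : ¬(a = 0 ∧ b = 0)) :
    ∃ c d : ℝ, a * d - b * c = 1 := by
  have hpos : a ^ 2 + b ^ 2 ≠ 0 := fun hzero =>
    h ⟨by nlinarith [sq_nonneg a, sq_nonneg b], by nlinarith [sq_nonneg a, sq_nonneg b]⟩
  exact ⟨-b / (a ^ 2 + b ^ 2), a / (a ^ 2 + b ^ 2), by field_simp; ring⟩

theorem FieldPair.IsFrame.reducesToList_of_bracket_eq (h : F.IsFrame I J G) (a b : ℝ)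
    (h₁ : EqOn (F.bracket G).1 (a • F + b • G).1 I)
    (h₂ : EqOn (F.bracket G).2 (a • F + b • G).2 J) : F.ReducesToList I J G := by
  by_cases hzero : a = 0 ∧ b = 0
  · obtain ⟨rfl, rfl⟩ := hzero
    rw [zero_smul, zero_smul, add_zero] at h₁ h₂
    exact IsCommutingFrame.reducesToList ⟨h, h₁, h₂⟩
  obtain ⟨c, d, hdet⟩ := exists_mul_sub_mul_eq_one hzero
  have hne : a * d - b * c ≠ 0 := hdet ▸ one_ne_zero
  obtain ⟨k₁, k₂⟩ := h.bracket_linear_combination a b c d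
  rw [hdet, one_smul] at k₁ k₂
  exact .of_linear_combination hne ((h.linear_combination hne).reducesToList_of_bracket_eq_left
    (k₁.trans h₁) (k₂.trans h₂))

theorem FieldPair.ReducesToList.exists_gEquivalent (hF : F.IsSmoothOn I J) (hG : G.IsSmoothOn I J)
    (h : F.ReducesToList I J G) :
    ∃ I₀ ⊆ I, ∃ J₀ ⊆ J, IsOpenInterval I₀ ∧ IsOpenInterval J₀ ∧
      ∃ I' J' : Set ℝ, IsOpenInterval I' ∧ IsOpenInterval J' ∧
      ∃ (l : Label) (g β : ℝ → ℝ), l.Admissible I' J' g β ∧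
        GEquivalent I₀ J₀ ((spanFields I J F G).map (restrictTo (strip I₀ J₀))) I' J'
          (l.algebra I' J' g β) := by
  obtain ⟨a, b, c, d, hdet, I', J', ρ, τ, l, g, β, hl, h₁, h₂, h₃, h₄⟩ := h
  have hI₀ := ρ.isMoveOn.isOpenInterval
  have hJ₀ := τ.isMoveOn.isOpenInterval
  refine ⟨ρ.dom, ρ.dom_subset, τ.dom, τ.dom_subset, hI₀, hJ₀, I', J', ρ.isOpenInterval,
    τ.isOpenInterval, l, g, β, hl, ?_⟩
  replace hF := hF.mono ρ.dom_subset τ.dom_subset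
  replace hG := hG.mono ρ.dom_subset τ.dom_subset
  rw [map_restrictTo_spanFields ρ.dom_subset τ.dom_subset,
    ← spanFields_linear_combination hI₀.isOpen hJ₀.isOpen hF hG hdet, l.algebra_eq_spanFields]
  simpa only [ρ.image_dom, τ.image_dom] using gEquivalent_spanFields ρ.isMoveOn τ.isMoveOn
    (hF.linear_combination hG a b) (hF.linear_combination hG c d) h₁.2 h₂.2 h₃.2 h₄.2

theorem IsTwoDimSubalgebra.exists_gEquivalent_algebra (hI : IsOpenInterval I)
    (hJ : IsOpenInterval J) (h : IsTwoDimSubalgebra I J s) (hs : RestrictsFaithfully I J s) :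
    ∃ I₀ ⊆ I, ∃ J₀ ⊆ J, IsOpenInterval I₀ ∧ IsOpenInterval J₀ ∧
      ∃ I' J' : Set ℝ, IsOpenInterval I' ∧ IsOpenInterval J' ∧
      ∃ (l : Label) (g β : ℝ → ℝ), l.Admissible I' J' g β ∧
        GEquivalent I₀ J₀ (s.map (restrictTo (strip I₀ J₀))) I' J' (l.algebra I' J' g β) := by
  obtain ⟨F, G, hF, hG, hli, rfl⟩ := h.exists_spanFields_eq hI.isOpen hJ.isOpen
  obtain ⟨a, b, h₁, h₂⟩ := exists_eqOn_bracket_of_isTwoDimSubalgebra hI hJ hF hG h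
  have hframe : F.IsFrame I J G := ⟨hI, hJ, hF, hG, hs.independentOn hI hJ hF hG hli⟩
  exact (hframe.reducesToList_of_bracket_eq a b h₁ h₂).exists_gEquivalent hF hG

end Completeness

end BLP

end

theorem mainTheorem7 :
    -- the listed algebras are two-dimensional subalgebras, Abelian or not as claimed
    (∀ I J : Set ℝ, BLP.IsOpenInterval I → BLP.IsOpenInterval J →
      ∀ (l : BLP.Label) (g β : ℝ → ℝ), l.Admissible I J g β →
        BLP.IsTwoDimSubalgebra I J (l.algebra I J g β) ∧
        BLP.RestrictsFaithfully I J (l.algebra I J g β) ∧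
        (BLP.IsAbelian (l.algebra I J g β) ↔ l.InAbelianPart)) ∧
    -- every two-dimensional subalgebra is locally equivalent to a listed one
    (∀ I J : Set ℝ, BLP.IsOpenInterval I → BLP.IsOpenInterval J →
      ∀ s : Submodule ℝ (BLP.Pt → BLP.Pt),
        BLP.IsTwoDimSubalgebra I J s → BLP.RestrictsFaithfully I J s →
        ∃ I₀ ⊆ I, ∃ J₀ ⊆ J, BLP.IsOpenInterval I₀ ∧ BLP.IsOpenInterval J₀ ∧
        ∃ I' J' : Set ℝ, BLP.IsOpenInterval I' ∧ BLP.IsOpenInterval J' ∧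
        ∃ (l : BLP.Label) (g β : ℝ → ℝ), l.Admissible I' J' g β ∧
          BLP.GEquivalent I₀ J₀ (s.map (BLP.restrictTo (BLP.strip I₀ J₀)))
            I' J' (l.algebra I' J' g β)) ∧
    -- algebras of different families, or of one family with different `δ, δ'`, are inequivalent
    (∀ I J I' J' : Set ℝ, BLP.IsOpenInterval I → BLP.IsOpenInterval J →
      BLP.IsOpenInterval I' → BLP.IsOpenInterval J' →
      ∀ (l l' : BLP.Label) (g β g' β' : ℝ → ℝ),
        l.Admissible I J g β → l'.Admissible I' J' g' β' → l ≠ l' →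
        ¬ BLP.GEquivalent I J (l.algebra I J g β) I' J' (l'.algebra I' J' g' β')) :=
  ⟨fun _ _ hI hJ _ _ _ hl =>
      ⟨hl.isTwoDimSubalgebra hI hJ, hl.restrictsFaithfully hI hJ, hl.isAbelian_iff hI hJ⟩,
    fun _ _ hI hJ _ hs hf => hs.exists_gEquivalent_algebra hI hJ hf,
    fun _ _ _ _ hI hJ hI' hJ' _ _ _ _ _ _ hl hl' hne h =>
      hne (hl.eq_of_gEquivalent hI hJ hI' hJ' hl' h)⟩
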